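/- Let $n\ge 1$, $N=2^n$, $M=2^m$ with $0\le m<n$, and let $|\psi\rangle=\sum_{j<N}x_j|j\rangle$ be an arbitrary normalized $n$-qubit state with complex amplitudes (bits of $j$ most significant first). Let $U=U_{\rm CSP}U_{\rm SP}$ be the SP+CSP state-preparation unitary. It acts on $n$ data qubits, on ancilla registers $A$ (of $M-1$ qubits) and $B$ (of $N/M-1$ qubits), and on a flag register $F$; the qubits of each ancilla register are labelled by pairs $(s,p)$ with $0\le p<2^s$. * $\mathrm{SPF}$ (on $k$ data qubits and an angle register): for $s=0,\dots,k-1$ in turn, the angle qubit $(s,p)$ whose index $p$ is given by data qubits $0,\dots,s-1$ is moved to position $(s,0)$ by controlled swaps and is then swapped with data qubit $s$; afterwards all controlled swaps are undone. * $\mathrm{FLAG}$ (on $k$ data qubits and a flag register): for each $s$, flips flag $(s,0)$ and then moves it, by controlled swaps, to the position $(s,p)$ given by data qubits $0,\dots,s-1$. * $U_{\rm SP}$ (on the first $m$ data qubits, $A$ and $F$) applies in turn: $R_y(\theta_{s,p})$ on every qubit of $A$; $\mathrm{SPF}$; $X$ on all flags; $\mathrm{FLAG}$; $R_y(-\theta_{s,p})$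 on every qubit $(s,p)$ of $A$, controlled on its flag; $\mathrm{FLAG}^\dagger$; $X$ on all flags. Here $\theta_{s,p}$ are the binary-tree angles of the block norms $y_i=\big(\sum_{\lfloor jM/N\rfloor=i}|x_j|^2\big)^{1/2}$. * $U_{\rm CSP}$ (on the last $n-m$ data qubits, $B$ and $F$, controlled on the value $k$ of the first $m$ data qubits) applies in turn: $X$ on all flags; $\mathrm{LOADF}$; $\mathrm{SPF}$; $\mathrm{FLAG}$; $\mathrm{LOADF}^\dagger$; $\mathrm{FLAG}^\dagger$; $X$ on all flags. Here $\mathrm{LOADF}$ applies to each qubit $(s,p)$ of $B$, controlled on its flag, the rotation $R_y(\theta^{(k)}_{s,p})$ given by the tree angles of the block $(|x_{kN/M+l}|)_{l<N/M}$, followed for $s=n-m-1$ by $\mathrm{diag}(e^{i\varphi^{(k)}_{2p}},e^{i\varphi^{(k)}_{2p+1}})$, where $e^{i\varphi^{(k)}_{l}}$ is the phase of $x_{kN/M+l}$. (The tree angles of $v_0,\dots,v_{2^k-1}$ are $\theta_{s,p}=2\cos^{-1}\Big(\big(\sum_{l<2^{k-s-1}}v_{p2^{k-s}+l}^2\big)^{1/2}\big/\big(\sum_{l<2^{k-s}}v_{p2^{k-s}+l}^2\big)^{1/2}\Big)$,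 arbitrary but fixed if the denominator vanishes.) Then $U|0^n\rangle|0\cdots0\rangle=|\psi\rangle|0\cdots0\rangle$, but for every nonzero $|\chi\rangle\perp|0^n\rangle$ the state $U|\chi\rangle|0\cdots0\rangle$ does not have registers $A$ and $B$ all in $|0\rangle$. Nevertheless the reflection can be implemented, as follows. Circuits consist of layers of gates on disjoint qubits, each gate being an arbitrary one-qubit unitary or a CNOT. The depth of a circuit is its number of layers. Its spacetime allocation is the sum over layers of the number of active qubits, a qubit being active in a layer if a gate acts on it there or if, for some input state of the data qubits (all ancillae starting in $|0\rangle$), it is not in $|0\rangle$ at that time. For every $c$ there is a constant $K$ such that, whenever $\max(N/M,M)\le cN/n$, the following holds for every $|\psi\rangle$. There are such circuits $C_U$ and $C_R$ on the above qubits and some further ancillae, $O(N)$ qubits altogether (at most $KN$). When the further ancillae start in $|0\rangle$, they are returned to $|0\rangle$, and $C_U$ acts as $U$ and $C_R$ as the reflection $I-2|0\rangle\langle0|$ about the data qubits together with $A$ and $B$ being in $|0\rangle$ (tensored with the identity on $F$). Under $C_U$, the $\ell''$ ancillae outside $A$ and $B$ begin in $|0\rangle$ if and only if they end in $|0\rangle$.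 With $\ell'=M+N/M-2$ the size of $A$ and $B$ together, and with $U$ now denoting the unitary of $C_U$ on all qubits, $$ (I-2|\psi\rangle\langle\psi|)\otimes|0^{\ell'}\rangle\otimes|0^{\ell''}\rangle = U\big[I-2|0^n\rangle\langle0^n|\otimes|0^{\ell'}\rangle\langle0^{\ell'}|\otimes I_{\ell''}\big]U^\dagger\big[I_n\otimes|0^{\ell'}\rangle\otimes|0^{\ell''}\rangle\big]. $$ The circuit consisting of $C_U^\dagger$, then $C_R$, then $C_U$ maps $|\phi\rangle|0\cdots0\rangle$ to $\big((I-2|\psi\rangle\langle\psi|)|\phi\rangle\big)|0\cdots0\rangle$ for every $n$-qubit state $|\phi\rangle$, has depth at most $Kn$, and has spacetime allocation at most $KN$. Moreover, for a suitable absolute constant $c$, every $n\ge1$ admits an $m$ with $0\le m<n$ and $\max(N/M,M)\le cN/n$; hence reflections about arbitrary $n$-qubit states are implemented in depth $O(n)$ and spacetime allocation $O(N)$. -/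

import Mathlib

noncomputable section

namespace StatePrep

open scoped Matrix

/-! ### Registers, states and operators

A register with wire set `W` has computational basis `W → Bool` (`false` is `|0⟩`, `true` is `|1⟩`);
its states are vectors `(W → Bool) → ℂ` and its operators are matrices with that index set. -/

section Operators

variable {W : Type} [Fintype W] [DecidableEq W]

/-- The basis vector `|z⟩`. -/
def ket (z : W → Bool) : (W → Bool) → ℂ := Pi.single z 1

open Classical in
/-- The state `φ` placed on the wires in the image of the injective map `d`, all other wires in
`|0⟩`. -/
def inject {ι : Type} (d : ι → W) (φ : (ι → Bool) → ℂ) : (W → Bool) → ℂ := fun y =>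
  if ∀ w, w ∉ Set.range d → y w = false then φ (fun i => y (d i)) else 0

/-- The linear operator `|x⟩ ↦ |f x⟩`. -/
def basisOp (f : (W → Bool) → (W → Bool)) : Matrix (W → Bool) (W → Bool) ℂ :=
  Matrix.of fun y x => if y = f x then 1 else 0

open Classical in
/-- The operator applying, for all `ν` in parallel, the one-qubit operator `G x ν` to the wire
`a ν`, where `G x ν` may depend on the basis state `x` of the wires outside the image of `a`
(a multiply controlled one-qubit operator). -/
def parallelOp {κ : Type} [Fintype κ] (a : κ → W)
    (G : (W → Bool) → κ → Matrix Bool Bool ℂ) : Matrix (W → Bool) (W → Bool) ℂ :=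
  Matrix.of fun y x =>
    if ∀ w, w ∉ Set.range a → y w = x w then ∏ ν, G x ν (y (a ν)) (x (a ν)) else 0

open Classical in
/-- `I - 2 |0⟩⟨0|_K ⊗ I`: the reflection about all wires in `K` being in `|0⟩`. -/
def zeroReflection (K : Set W) : Matrix (W → Bool) (W → Bool) ℂ :=
  1 - (2 : ℂ) • Matrix.diagonal fun y => if ∀ w ∈ K, y w = false then 1 else 0

/-- `I - 2 |ψ⟩⟨ψ|`. -/
def stateReflection (ψ : (W → Bool) → ℂ) : Matrix (W → Bool) (W → Bool) ℂ :=
  1 - (2 : ℂ) • Matrix.vecMulVec ψ (star ψ)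

/-- The rotation `R_y(θ)`. -/
def Ry (θ : ℝ) : Matrix Bool Bool ℂ :=
  Matrix.of fun i j =>
    match i, j with
    | false, false => (Real.cos (θ / 2) : ℂ)
    | false, true => -(Real.sin (θ / 2) : ℂ)
    | true, false => (Real.sin (θ / 2) : ℂ)
    | true, true => (Real.cos (θ / 2) : ℂ)

end Operators

/-! ### Circuits over arbitrary one-qubit gates and CNOT -/

section Circuits

variable {W : Type} [Fintype W] [DecidableEq W]

/-- The gate set `{U(2), CNOT}`. -/
inductive Gate (W : Type) : Type
  | single (w : W) (u : Matrix.unitaryGroup Bool ℂ) : Gate W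
  | cnot (control target : W) (h : control ≠ target) : Gate W

/-- The wires a gate acts on. -/
def Gate.wires : Gate W → Set W
  | .single w _ => {w}
  | .cnot c t _ => {c, t}

/-- The operator of a gate on the whole register. -/
def Gate.op : Gate W → Matrix (W → Bool) (W → Bool) ℂ
  | .single w u => parallelOp (fun _ : Unit => w) fun _ _ => (u : Matrix Bool Bool ℂ)
  | .cnot c t _ => basisOp fun x => Function.update x t (xor (x t) (x c))

def Gate.dagger : Gate W → Gate W
  | .single w u => .single w u⁻¹
  | .cnot c t h => .cnot c t h

/-- A circuit is a list of layers, the first layer being applied first; a layer is a list of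
gates. -/
abbrev Circuit (W : Type) : Type := List (List (Gate W))

/-- The gates in each layer act on pairwise disjoint sets of wires. -/
def Circuit.Valid (C : Circuit W) : Prop :=
  ∀ L ∈ C, L.Pairwise fun g h => Disjoint g.wires h.wires

def Circuit.op (C : Circuit W) : Matrix (W → Bool) (W → Bool) ℂ :=
  C.flatten.foldl (fun T g => g.op * T) 1

def Circuit.dagger (C : Circuit W) : Circuit W :=
  (C.map fun L => (L.map Gate.dagger).reverse).reverse

def Circuit.depth (C : Circuit W) : ℕ := C.length

/-- Wire `w` is active in layer `t` when the circuit is run with an arbitrary state on the wires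
`d` and all other wires initially in `|0⟩`: a gate of that layer acts on `w`, or, for some input
state, `w` is not in `|0⟩` at that time. -/
def Circuit.Active {ι : Type} (d : ι → W) (C : Circuit W) (t : ℕ) (w : W) : Prop :=
  (∃ L, C[t]? = some L ∧ ∃ g ∈ L, w ∈ g.wires) ∨
    ∃ φ : (ι → Bool) → ℂ, ∃ y : W → Bool,
      y w = true ∧ (Circuit.op (C.take t) *ᵥ inject d φ) y ≠ 0

open Classical in
/-- Spacetime allocation: the number of active wires, summed over the layers. -/
def Circuit.spacetimeAllocation {ι : Type} (d : ι → W) (C : Circuit W) : ℕ :=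
  ∑ t ∈ Finset.range C.depth, (Finset.univ.filter fun w => C.Active d t w).card

end Circuits

/-! ### The subroutines SPF and FLAG -/

/-- The index set of the pairs `(s, p)` with `s < k` and `p < 2 ^ s`; it has `2 ^ k - 1`
elements. -/
abbrev Node (k : ℕ) : Type := Σ s : Fin k, Fin (2 ^ (s : ℕ))

theorem add_two_pow_lt {s q i : ℕ} (hq : q < s) (hi : i < 2 ^ (s - 1 - q)) :
    i + 2 ^ (s - 1 - q) < 2 ^ s := by
  have h : 2 ^ (s - 1 - q + 1) ≤ 2 ^ s := Nat.pow_le_pow_right (by norm_num) (by omega)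
  rw [pow_succ] at h
  omega

section Subroutines

variable {W : Type} [DecidableEq W]

def xMap (w : W) : (W → Bool) → (W → Bool) := fun x => Function.update x w (!x w)

def swapMap (a b : W) : (W → Bool) → (W → Bool) := fun x => x ∘ Equiv.swap a b

/-- The controlled swap, with control `c`. -/
def cswapMap (c a b : W) : (W → Bool) → (W → Bool) := fun x => if x c then swapMap a b x else x

/-- Apply the maps of a list one after the other, the head first. -/
def runMaps (l : List ((W → Bool) → (W → Bool))) : (W → Bool) → (W → Bool) :=
  fun x => l.foldl (fun y f => f y) x

/-- The layer of parallel controlled swaps `CSWAP(D_q, S_i, S_{i + 2 ^ t})`, `i < 2 ^ t`, with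
`t = s - 1 - q`, where `S` is the part of the tree register with first index `s`. -/
def csLayer {k : ℕ} (d : Fin k → W) (a : Node k → W) (s : Fin k) (q : Fin (s : ℕ)) :
    List ((W → Bool) → (W → Bool)) :=
  (List.finRange (2 ^ ((s : ℕ) - 1 - (q : ℕ)))).map fun (i : Fin (2 ^ ((s : ℕ) - 1 - (q : ℕ)))) =>
    cswapMap (d ⟨q, q.2.trans s.2⟩)
      (a ⟨s, ⟨i, (Nat.le_add_right _ _).trans_lt (add_two_pow_lt q.2 i.2)⟩⟩)
      (a ⟨s, ⟨i + 2 ^ ((s : ℕ) - 1 - q), add_two_pow_lt q.2 i.2⟩⟩)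

/-- SPF with data wires `d` and angle wires `a`. For each `s` in turn, controlled on the data
wires `q < s`, the angle qubit selected by their values is moved to the top of the part `s` of the
angle register and is then swapped with data wire `s`; finally the controlled swaps are undone. -/
def spfMap {k : ℕ} (d : Fin k → W) (a : Node k → W) : (W → Bool) → (W → Bool) :=
  runMaps
    (((List.finRange k).flatMap fun (s : Fin k) =>
        ((List.finRange (s : ℕ)).flatMap fun q => csLayer d a s q) ++
          [swapMap (d s) (a ⟨s, ⟨0, by positivity⟩⟩)]) ++
      (List.finRange k).reverse.flatMap fun (s : Fin k) =>
        (List.finRange (s : ℕ)).reverse.flatMap fun q => csLayer d a s q)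

/-- FLAG with data wires `d` and flag wires `f`. For each `s`, the flag `(s, 0)` is flipped and is
then moved by controlled swaps to the position selected by the data wires `q < s`. -/
def flagMap {k : ℕ} (d : Fin k → W) (f : Node k → W) : (W → Bool) → (W → Bool) :=
  runMaps
    (((List.finRange k).map fun (s : Fin k) => xMap (f ⟨s, ⟨0, by positivity⟩⟩)) ++
      (List.finRange k).flatMap fun (s : Fin k) =>
        (List.finRange (s : ℕ)).reverse.flatMap fun q => csLayer d f s q)

/-- `X` on every wire in the image of the injective map `f`. -/
def xAll [Fintype W] {k : ℕ} (f : Node k → W) : Matrix (W → Bool) (W → Bool) ℂ :=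
  parallelOp f fun _ _ => Matrix.of fun i j => if i = j then 0 else 1

end Subroutines

/-! ### The SP+CSP state-preparation protocol

The `n = m + r` data qubits are split into the first `m` and the last `r` qubits, so that
`N = 2 ^ (m + r)`, `M = 2 ^ m` and `N / M = 2 ^ r`. -/

/-- The data qubits, the registers `A` and `B` of `M - 1` and `N / M - 1` qubits, and the flag
register `F`, which is shared by the two parts of the protocol. -/
inductive Wire (m r : ℕ) : Type
  | data (i : Fin (m + r)) : Wire m r
  | regA (ν : Node m) : Wire m r
  | regB (ν : Node r) : Wire m r
  | regF (ν : Node (max m r)) : Wire m r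
  deriving DecidableEq, Fintype

section Protocol

variable (m r : ℕ)

/-- The flag wire used for the node `ν` in the SP part. -/
def flagSP (ν : Node m) : Wire m r := .regF ⟨⟨ν.1, lt_max_of_lt_left ν.1.2⟩, ν.2⟩

/-- The flag wire used for the node `ν` in the CSP part. -/
def flagCSP (ν : Node r) : Wire m r := .regF ⟨⟨ν.1, lt_max_of_lt_right ν.1.2⟩, ν.2⟩

def dataSP (i : Fin m) : Wire m r := .data (Fin.castAdd r i)

def dataCSP (i : Fin r) : Wire m r := .data (Fin.natAdd m i)

/-- The number `k` whose binary digits, most significant first, are the first `m` data bits. -/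
def address (x : Wire m r → Bool) : ℕ :=
  ∑ i : Fin m, if x (dataSP m r i) then 2 ^ (m - 1 - (i : ℕ)) else 0

variable {m r}

/-- The amplitude of `|j⟩`, the binary digits of `j` being read most significant first. -/
def amplitude {n : ℕ} (ψ : (Fin n → Bool) → ℂ) (j : ℕ) : ℂ :=
  ψ fun i => j.testBit (n - 1 - (i : ℕ))

/-- The angle `θ_{s,p}` of the binary tree of depth `k` for the weights `v 0, …, v (2 ^ k - 1)`. -/
def treeAngle (k : ℕ) (v : ℕ → ℝ) (s p : ℕ) : ℝ :=
  2 * Real.arccos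
    (√(∑ l ∈ Finset.range (2 ^ (k - s - 1)), v (p * 2 ^ (k - s) + l) ^ 2) /
      √(∑ l ∈ Finset.range (2 ^ (k - s)), v (p * 2 ^ (k - s) + l) ^ 2))

/-- `y_i`, the norm of the block of amplitudes whose first `m` bits are those of `i`. -/
def blockNorm (ψ : (Fin (m + r) → Bool) → ℂ) (i : ℕ) : ℝ :=
  √(∑ l ∈ Finset.range (2 ^ r), ‖amplitude ψ (i * 2 ^ r + l)‖ ^ 2)

/-- The angle `θ_{s,p}` of the SP part. -/
def angleSP (ψ : (Fin (m + r) → Bool) → ℂ) (ν : Node m) : ℝ :=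
  treeAngle m (blockNorm ψ) ν.1 ν.2

/-- The angle `θ^{(k)}_{s,p}` of the CSP part. -/
def angleCSP (ψ : (Fin (m + r) → Bool) → ℂ) (k : ℕ) (ν : Node r) : ℝ :=
  treeAngle r (fun l => ‖amplitude ψ (k * 2 ^ r + l)‖) ν.1 ν.2

/-- The phase `z / |z|`, and `1` for `z = 0`. -/
def phase (z : ℂ) : ℂ := if z = 0 then 1 else z / (‖z‖ : ℂ)

/-- The one-qubit gate preparing `|θ^{(k)}_{s,p}⟩` from `|0⟩`: a rotation `R_y`, followed for the
last value `s = r - 1` by the phases of the two amplitudes concerned. -/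
def rotCSP (ψ : (Fin (m + r) → Bool) → ℂ) (k : ℕ) (ν : Node r) : Matrix Bool Bool ℂ :=
  if (ν.1 : ℕ) + 1 = r then
    Matrix.diagonal (fun b : Bool =>
      phase (amplitude ψ (k * 2 ^ r + (2 * (ν.2 : ℕ) + cond b 1 0)))) * Ry (angleCSP ψ k ν)
  else Ry (angleCSP ψ k ν)

/-- LOADF: controlled on the address `k` and on the flag `(s, p)`, the gate preparing
`|θ^{(k)}_{s,p}⟩` is applied to the qubit `(s, p)` of register `B`. -/
def loadf (ψ : (Fin (m + r) → Bool) → ℂ) : Matrix (Wire m r → Bool) (Wire m r → Bool) ℂ :=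
  parallelOp Wire.regB fun x ν =>
    if x (flagCSP m r ν) then rotCSP ψ (address m r x) ν else 1

/-- `U_SP`: load the angles into `A`, inject them into the first `m` data qubits, and clear `A`
with the help of the flags. -/
def unitarySP (ψ : (Fin (m + r) → Bool) → ℂ) : Matrix (Wire m r → Bool) (Wire m r → Bool) ℂ :=
  xAll (flagSP m r) * (basisOp (flagMap (dataSP m r) (flagSP m r)))ᴴ *
    parallelOp Wire.regA (fun x ν => if x (flagSP m r ν) then Ry (-angleSP ψ ν) else 1) *
    basisOp (flagMap (dataSP m r) (flagSP m r)) * xAll (flagSP m r) *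
    basisOp (spfMap (dataSP m r) Wire.regA) *
    parallelOp Wire.regA (fun _ ν => Ry (angleSP ψ ν))

/-- `U_CSP`: the same on the last `r` data qubits with the register `B`, the angles being loaded
and unloaded by LOADF. -/
def unitaryCSP (ψ : (Fin (m + r) → Bool) → ℂ) : Matrix (Wire m r → Bool) (Wire m r → Bool) ℂ :=
  xAll (flagCSP m r) * (basisOp (flagMap (dataCSP m r) (flagCSP m r)))ᴴ * (loadf ψ)ᴴ *
    basisOp (flagMap (dataCSP m r) (flagCSP m r)) * basisOp (spfMap (dataCSP m r) Wire.regB) *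
    loadf ψ * xAll (flagCSP m r)

/-- The state-preparation unitary of the SP+CSP protocol. -/
def prepUnitary (ψ : (Fin (m + r) → Bool) → ℂ) : Matrix (Wire m r → Bool) (Wire m r → Bool) ℂ :=
  unitaryCSP ψ * unitarySP ψ

/-- All wires of a compiled circuit: those of the protocol and `g` further ancillae, on which the
subroutines are implemented. -/
abbrev FullWire (m r g : ℕ) : Type := Wire m r ⊕ Fin g

/-- The circuit `C` acts as `T` whenever the further ancillae start in `|0⟩`, and returns them to
`|0⟩`. -/
def Implements {g : ℕ} (C : Circuit (FullWire m r g))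
    (T : Matrix (Wire m r → Bool) (Wire m r → Bool) ℂ) : Prop :=
  ∀ φ : (Wire m r → Bool) → ℂ, C.op *ᵥ inject Sum.inl φ = inject Sum.inl (T *ᵥ φ)

/-- The data wires of a compiled circuit. -/
def dataWire (m r g : ℕ) (i : Fin (m + r)) : FullWire m r g := .inl (.data i)

/-- The data qubits together with registers `A` and `B`. -/
def coreDAB (m r : ℕ) : Set (Wire m r) :=
  Set.range Wire.data ∪ Set.range Wire.regA ∪ Set.range Wire.regB

/-- The ancillae of a compiled circuit that belong neither to `A` nor to `B`. -/
def otherAncillae (m r g : ℕ) : Set (FullWire m r g) :=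
  Set.range (Sum.inl ∘ Wire.regF) ∪ Set.range Sum.inr

end Protocol

end StatePrep

end

open StatePrep
open scoped Matrix

noncomputable section

namespace StatePrep

set_option linter.unusedSectionVars false
set_option linter.unusedVariables false

/-! ### Basis vectors, embeddings of registers, and operators on them -/

section OperatorCalculus

variable {W : Type} [Fintype W] [DecidableEq W]

/-! The proof combines three facts: the protocol has product-form matrix elements, conjugating a
reflection by it gives the desired reflection, and every ingredient has a cheap circuit.

Matrix elements. SPF permutes basis states: it exchanges data bit `s` with the tree bit at the node
of part `s` lying on the path spelled by the new data bits (`Routed`, `routed_spfMap`). On clean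
flags, X followed by FLAG leaves set exactly the flags off this path (`flagMap_flipAll`), so
unloading cancels loading off the path and does nothing on it. Hence a matrix element of load – SPF
– unload is a product over nodes (`load_spf_unload_apply`): off the path the ancilla is unchanged;
on the path it receives the old data bit and contributes one rotation entry. Starting from zero, the
entries along a path telescope (`treeNorm_mul_Ry`): SP yields the block norm, and CSP turns the
block norm into the amplitude, the phase being attached at the last level (`prod_rotCSP`). A nonzero
input data bit necessarily ends in `A` or `B` (`prepUnitary_dirty`).

Reflection. The protocol unitary `U` never changes the flags. Therefore the inverse of `U` sends a
state with clean ancillae into the sector of zero flags, where reflecting about data, `A` and `B`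
being zero is the same as reflecting about the single vector `|0…0⟩`. Conjugation by `U` gives the
reflection about `U|0…0⟩`, which is `ψ` with clean ancillae (`prepUnitary_reflection`). What the
inverse of `U` leaves in `A` and `B` does no harm, because `U` is applied afterwards.

Circuits. Classical values are computed by levelled programs (`Prog`), a level being one parallel
layer of two-input instructions. SPF looks sequential, since each level is controlled by freshly
swapped data; but the final data bits can be read off the tree register alone, and once they are
known and copied all levels can be routed in parallel (`computesFrom_spfMap`). Controlled rotations
share an eigenbasis, so only diagonal operators need controls; these are phases applied to computed
bits, one for each address and literal (`exists_mux`).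

Cost. An auxiliary wire is active only between its first and last use (`touches_of_active`). The
fan-out trees for the roughly `N` conjunctions start as late as possible, so their lifetimes form a
geometric series (`sum_sub_size_lt`) and cost `O(N)` instead of `O(nN)`. All other registers have
`O(max (N / M) M)` wires and may be charged for the whole depth `O(n)`; the hypothesis on the
splitting bounds this by `O(N)`. -/

theorem mulVec_ket {α : Type} [Fintype α] (T : Matrix α (W → Bool) ℂ) (x : W → Bool) :
    T *ᵥ ket x = fun y => T y x := by
  ext y
  simp [ket, Matrix.mulVec, dotProduct_single]

theorem ket_apply (x y : W → Bool) : ket x y = if y = x then 1 else 0 := by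
  simp [ket, Pi.single_apply]

theorem matrix_ext_ket {α : Type} [Fintype α] {S T : Matrix α (W → Bool) ℂ}
    (h : ∀ x, S *ᵥ ket x = T *ᵥ ket x) : S = T := by
  ext y x
  have := congrFun (h x) y
  simpa [mulVec_ket] using this

theorem basisOp_mulVec_ket (f : (W → Bool) → (W → Bool)) (x : W → Bool) :
    basisOp f *ᵥ ket x = ket (f x) := by
  ext y
  simp [mulVec_ket, basisOp, ket_apply]

theorem basisOp_comp (f g : (W → Bool) → (W → Bool)) :
    basisOp f * basisOp g = basisOp (f ∘ g) :=
  matrix_ext_ket fun x => by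
    simp [← Matrix.mulVec_mulVec, basisOp_mulVec_ket]

/-- The wires in the image of `d` are in the basis state `x`, all others in `false`. -/
def embed {ι : Type} (d : ι → W) (x : ι → Bool) : W → Bool :=
  Function.extend d x fun _ => false

theorem embed_apply {ι : Type} {d : ι → W} (hd : Function.Injective d) (x : ι → Bool) (i : ι) :
    embed d x (d i) = x i := hd.extend_apply _ _ _

theorem embed_of_notMem {ι : Type} {d : ι → W} (x : ι → Bool) {w : W} (hw : w ∉ Set.range d) :
    embed d x w = false :=
  Function.extend_apply' _ _ _ (by simpa using hw)

theorem embed_inl {V A : Type} [Fintype V] [DecidableEq V] [Fintype A] [DecidableEq A]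
    (x : V → Bool) : embed (Sum.inl : V → V ⊕ A) x = Sum.elim x fun _ => false := by
  ext w
  rcases w with v | a
  · exact embed_apply Sum.inl_injective x v
  · exact embed_of_notMem x (by simp)

theorem eq_embed_iff {ι : Type} {d : ι → W} (hd : Function.Injective d) (x : ι → Bool)
    (y : W → Bool) :
    y = embed d x ↔ (∀ w, w ∉ Set.range d → y w = false) ∧ (fun i => y (d i)) = x := by
  constructor
  · rintro rfl
    exact ⟨fun w hw => embed_of_notMem x hw, funext fun i => embed_apply hd x i⟩
  · rintro ⟨h1, rfl⟩
    ext w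
    by_cases hw : w ∈ Set.range d
    · obtain ⟨i, rfl⟩ := hw
      rw [embed_apply hd]
    · rw [h1 w hw, embed_of_notMem _ hw]

/-- The isometry `φ ↦ inject d φ` as a matrix. -/
def injectOp {ι : Type} (d : ι → W) : Matrix (W → Bool) (ι → Bool) ℂ :=
  Matrix.of fun y x => if y = embed d x then 1 else 0

variable {ι : Type} [Fintype ι] [DecidableEq ι]

theorem injectOp_mulVec {d : ι → W} (hd : Function.Injective d) (φ : (ι → Bool) → ℂ) :
    injectOp d *ᵥ φ = inject d φ := by
  classical
  ext y
  simp only [Matrix.mulVec, dotProduct, injectOp, Matrix.of_apply, inject, eq_embed_iff hd]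
  by_cases h : ∀ w, w ∉ Set.range d → y w = false
  · rw [if_pos h, Finset.sum_eq_single (fun i => y (d i))]
    · rw [if_pos ⟨h, rfl⟩, one_mul]
    · intro x _ hx
      rw [if_neg fun h' => hx h'.2.symm, zero_mul]
    · simp
  · simp only [h, false_and, if_false, zero_mul, Finset.sum_const_zero]

theorem injectOp_mulVec_ket (d : ι → W) (x : ι → Bool) :
    injectOp d *ᵥ ket x = ket (embed d x) := by
  ext y
  simp [mulVec_ket, injectOp, ket_apply]

theorem injectOp_isometry {d : ι → W} (hd : Function.Injective d) :
    (injectOp d)ᴴ * injectOp d = 1 := by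
  ext x x'
  simp only [Matrix.mul_apply, Matrix.conjTranspose_apply, injectOp, Matrix.of_apply]
  have hinj : Function.Injective (embed d) := fun a b hab => by
    ext i
    rw [← embed_apply hd a i, hab, embed_apply hd]
  simp [Matrix.one_apply, hinj.eq_iff, eq_comm]

theorem inject_ket {d : ι → W} (hd : Function.Injective d) (x : ι → Bool) :
    inject d (ket x) = ket (embed d x) := by
  rw [← injectOp_mulVec hd, injectOp_mulVec_ket]

theorem inject_inject {V A : Type} [Fintype V] [DecidableEq V] [Fintype A] [DecidableEq A]
    {d : ι → V} (hd : Function.Injective d) (φ : (ι → Bool) → ℂ) :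
    inject (Sum.inl : V → V ⊕ A) (inject d φ) = inject (Sum.inl ∘ d : ι → V ⊕ A) φ := by
  classical
  rw [← injectOp_mulVec Sum.inl_injective, ← injectOp_mulVec hd,
    ← injectOp_mulVec (Sum.inl_injective.comp hd), Matrix.mulVec_mulVec]
  congr 1
  refine matrix_ext_ket fun x => ?_
  rw [← Matrix.mulVec_mulVec, injectOp_mulVec_ket, injectOp_mulVec_ket, injectOp_mulVec_ket]
  congr 1
  refine (eq_embed_iff (Sum.inl_injective.comp hd) _ _).2 ⟨?_, ?_⟩
  · intro w hw
    rw [embed_inl]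
    rcases w with v | a
    · exact embed_of_notMem _ fun ⟨i, hi⟩ => hw ⟨i, by simp [hi]⟩
    · rfl
  · ext i
    simp [embed_inl, embed_apply hd]

/-! ### Multiply controlled one-qubit operators -/

variable {κ : Type} [Fintype κ]

/-- `G x` does not depend on the wires in the image of `a`. -/
def Indep (a : κ → W) {β : Type} (G : (W → Bool) → β) : Prop :=
  ∀ x y, (∀ w, w ∉ Set.range a → y w = x w) → G y = G x

theorem parallelOp_apply_of {a : κ → W} {G : (W → Bool) → κ → Matrix Bool Bool ℂ}
    {x y : W → Bool} (h : ∀ w, w ∉ Set.range a → y w = x w) :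
    parallelOp a G y x = ∏ ν, G x ν (y (a ν)) (x (a ν)) := by
  simp only [parallelOp, Matrix.of_apply]
  rw [if_pos h]

theorem parallelOp_apply_of_not {a : κ → W} {G : (W → Bool) → κ → Matrix Bool Bool ℂ}
    {x y : W → Bool} (h : ¬ ∀ w, w ∉ Set.range a → y w = x w) :
    parallelOp a G y x = 0 := by
  simp only [parallelOp, Matrix.of_apply]
  rw [if_neg h]

theorem parallelOp_congr {a : κ → W} {G G' : (W → Bool) → κ → Matrix Bool Bool ℂ}
    (h : ∀ x ν, G x ν = G' x ν) : parallelOp a G = parallelOp a G' := by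
  rw [show G = G' from funext fun x => funext fun ν => h x ν]

open Classical in
/-- `x` with the wires in the image of `a` overwritten by `b`. -/
def overwrite (a : κ → W) (x : W → Bool) (b : κ → Bool) : W → Bool := Function.extend a b x

theorem overwrite_apply {a : κ → W} (ha : Function.Injective a) (x : W → Bool) (b : κ → Bool)
    (ν : κ) : overwrite a x b (a ν) = b ν := ha.extend_apply _ _ _

theorem overwrite_of_notMem {a : κ → W} (x : W → Bool) (b : κ → Bool) {w : W}
    (hw : w ∉ Set.range a) : overwrite a x b w = x w :=
  Function.extend_apply' _ _ _ (by simpa using hw)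

theorem eq_overwrite {a : κ → W} (ha : Function.Injective a) {x y : W → Bool}
    (h : ∀ w, w ∉ Set.range a → y w = x w) : y = overwrite a x fun ν => y (a ν) := by
  ext w
  by_cases hw : w ∈ Set.range a
  · obtain ⟨i, rfl⟩ := hw
    rw [overwrite_apply ha]
  · rw [overwrite_of_notMem _ _ hw, h w hw]

/-- A sum over basis states supported on those agreeing with `x` off the image of `a`. -/
theorem sum_eq_sum_overwrite [DecidableEq κ] {a : κ → W} (ha : Function.Injective a) (x : W → Bool)
    (F : (W → Bool) → ℂ) (hF : ∀ z, (¬ ∀ w, w ∉ Set.range a → z w = x w) → F z = 0) :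
    ∑ z, F z = ∑ b : κ → Bool, F (overwrite a x b) := by
  classical
  have hinj : Function.Injective (overwrite a x) := fun b c h => by
    ext ν
    rw [← overwrite_apply ha x b ν, h, overwrite_apply ha]
  rw [← Finset.sum_image (s := Finset.univ) (g := overwrite a x) (f := F)
    (fun _ _ _ _ h => hinj h)]
  refine (Finset.sum_subset (Finset.subset_univ _) fun z _ hz => hF z fun h => hz ?_).symm
  exact Finset.mem_image.2 ⟨_, Finset.mem_univ _, (eq_overwrite ha h).symm⟩

/-- The controls lie off the targets, so `G` sees the same control values before and after `H` acts.
The sum over intermediate states runs over target values only and factors wire by wire. -/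
theorem parallelOp_mul {a : κ → W} (ha : Function.Injective a)
    (G H : (W → Bool) → κ → Matrix Bool Bool ℂ) (hG : Indep a G) :
    parallelOp a G * parallelOp a H = parallelOp a fun x ν => G x ν * H x ν := by
  classical
  ext y x
  rw [Matrix.mul_apply]
  rw [sum_eq_sum_overwrite ha x _ fun z hz => by rw [parallelOp_apply_of_not hz, mul_zero]]
  have hz : ∀ b, ∀ w, w ∉ Set.range a → overwrite a x b w = x w :=
    fun b w hw => overwrite_of_notMem _ _ hw
  by_cases h : ∀ w, w ∉ Set.range a → y w = x w
  · rw [parallelOp_apply_of h]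
    simp only [Matrix.mul_apply]
    rw [Finset.prod_univ_sum]
    rw [Fintype.piFinset_univ]
    refine Finset.sum_congr rfl fun b _ => ?_
    rw [parallelOp_apply_of (hz b), parallelOp_apply_of (fun w hw => by rw [h w hw, hz b w hw]),
      hG _ _ (hz b), ← Finset.prod_mul_distrib]
    simp only [overwrite_apply ha]
  · rw [parallelOp_apply_of_not h]
    refine Finset.sum_eq_zero fun b _ => ?_
    rw [parallelOp_apply_of_not, zero_mul]
    exact fun h' => h fun w hw => by rw [h' w hw, hz b w hw]

theorem parallelOp_one {a : κ → W} (ha : Function.Injective a) :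
    parallelOp a (fun _ _ => 1) = 1 := by
  ext y x
  by_cases h : ∀ w, w ∉ Set.range a → y w = x w
  · rw [parallelOp_apply_of h]
    simp only [Matrix.one_apply]
    by_cases hxy : y = x
    · simp [hxy]
    · rw [if_neg hxy]
      by_contra hne
      rw [← ne_eq, Finset.prod_ne_zero_iff] at hne
      refine hxy (funext fun w => ?_)
      by_cases hw : w ∈ Set.range a
      · obtain ⟨ν, rfl⟩ := hw
        by_contra hν
        exact hne ν (Finset.mem_univ _) (if_neg hν)
      · exact h w hw
  · rw [parallelOp_apply_of_not h, Matrix.one_apply_ne]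
    rintro rfl
    exact h fun _ _ => rfl

theorem parallelOp_conjTranspose {a : κ → W} (G : (W → Bool) → κ → Matrix Bool Bool ℂ)
    (hG : Indep a G) : (parallelOp a G)ᴴ = parallelOp a fun x ν => (G x ν)ᴴ := by
  ext y x
  rw [Matrix.conjTranspose_apply]
  by_cases h : ∀ w, w ∉ Set.range a → y w = x w
  · rw [parallelOp_apply_of h, parallelOp_apply_of fun w hw => (h w hw).symm, hG _ _ h]
    simp [star_prod]
  · rw [parallelOp_apply_of_not h, parallelOp_apply_of_not fun h' => h fun w hw => (h' w hw).symm]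
    simp

/-- A diagonal controlled operator multiplies basis states by phases. -/
theorem parallelOp_diagonal_mulVec_ket {a : κ → W} (ha : Function.Injective a)
    (v : (W → Bool) → κ → Bool → ℂ) (x : W → Bool) :
    parallelOp a (fun x ν => Matrix.diagonal (v x ν)) *ᵥ ket x =
      (∏ ν, v x ν (x (a ν))) • ket x := by
  ext y
  rw [mulVec_ket]
  simp only [Pi.smul_apply, smul_eq_mul, ket_apply]
  by_cases h : ∀ w, w ∉ Set.range a → y w = x w
  · rw [parallelOp_apply_of h]
    by_cases hxy : y = x
    · subst hxy
      simp
    · rw [if_neg hxy, mul_zero]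
      by_contra hne
      rw [← ne_eq, Finset.prod_ne_zero_iff] at hne
      refine hxy (funext fun w => ?_)
      by_cases hw : w ∈ Set.range a
      · obtain ⟨ν, rfl⟩ := hw
        by_contra hν
        exact hne ν (Finset.mem_univ _) (Matrix.diagonal_apply_ne _ hν)
      · exact h w hw
  · rw [parallelOp_apply_of_not h, if_neg, mul_zero]
    rintro rfl
    exact h fun _ _ => rfl

/-- Conjugating a controlled operator by a bijection of basis states which acts on the controls
only. -/
theorem basisOp_conj_parallelOp {a : κ → W}
    (f : (W → Bool) → (W → Bool)) (hf : Function.Injective f)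
    (hfa : ∀ x ν, f x (a ν) = x (a ν))
    (hoff : ∀ x y, (∀ w, w ∉ Set.range a → y w = x w) → ∀ w, w ∉ Set.range a → f y w = f x w)
    (G : (W → Bool) → κ → Matrix Bool Bool ℂ) :
    (basisOp f)ᴴ * parallelOp a G * basisOp f = parallelOp a fun x => G (f x) := by
  ext y x
  have h1 : ((basisOp f)ᴴ * parallelOp a G * basisOp f) y x = parallelOp a G (f y) (f x) := by
    simp [Matrix.mul_apply, basisOp, Matrix.conjTranspose_apply]
  rw [h1]
  by_cases h : ∀ w, w ∉ Set.range a → y w = x w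
  · rw [parallelOp_apply_of h, parallelOp_apply_of (hoff _ _ h)]
    simp [hfa]
  · rw [parallelOp_apply_of_not h, parallelOp_apply_of_not]
    intro h'
    apply h
    -- `f` fixes the targets, and off them `f y` agrees with `f x`. So `f y` is also the image of
    -- `x` carrying the target values of `y`, and injectivity shows that `y` and `x` agree off the
    -- targets.
    have : f y = f (overwrite a x fun ν => y (a ν)) := by
      ext w
      by_cases hw : w ∈ Set.range a
      · obtain ⟨ν, rfl⟩ := hw
        rw [hfa, hfa, overwrite]
        by_cases hν : ∃ μ, a μ = a ν
        · rw [Function.extend_def, dif_pos hν]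
          rw [hν.choose_spec]
        · exact absurd ⟨ν, rfl⟩ hν
      · rw [h' w hw]
        exact (hoff _ _ (fun v hv => overwrite_of_notMem _ _ hv) w hw).symm
    intro w hw
    rw [hf this, overwrite_of_notMem _ _ hw]

end OperatorCalculus

/-! ### Operators acting on a part of the wires -/

section Local

variable {W : Type} [Fintype W] [DecidableEq W]

/-- `T = T' ⊗ I` with `T'` acting on the wires in `S`. -/
structure ActsOn (S : Set W) (T : Matrix (W → Bool) (W → Bool) ℂ) : Prop where
  eq_of_ne : ∀ {y x}, T y x ≠ 0 → ∀ w, w ∉ S → y w = x w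
  congr : ∀ {y x y' x'}, (∀ w, w ∉ S → y w = x w) → (∀ w, w ∉ S → y' w = x' w) →
    (∀ w ∈ S, y w = y' w) → (∀ w ∈ S, x w = x' w) → T y x = T y' x'

open Classical in
-- In either order a single intermediate basis state contributes: the one in which only the factor
-- applied first has changed its wires. Both entries are then the product of one entry of `A` and
-- one of `B`, each depending on its own wires only.
theorem ActsOn.commute {S S' : Set W} {A B : Matrix (W → Bool) (W → Bool) ℂ}
    (hA : ActsOn S A) (hB : ActsOn S' B) (h : Disjoint S S') : A * B = B * A := by
  ext y x
  set z : W → Bool := fun w => if w ∈ S then x w else y w with hz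
  set z' : W → Bool := fun w => if w ∈ S then y w else x w with hz'
  have hS' : ∀ w, w ∈ S' → w ∉ S := fun w h1 h2 => Set.disjoint_left.1 h h2 h1
  have h1 : (A * B) y x = A y z * B z x := by
    rw [Matrix.mul_apply]
    refine Finset.sum_eq_single z (fun u _ hu => ?_) (by simp)
    by_contra hne
    refine hu (funext fun w => ?_)
    have ha := hA.eq_of_ne (left_ne_zero_of_mul hne) w
    have hb := hB.eq_of_ne (right_ne_zero_of_mul hne) w
    by_cases hw : w ∈ S
    · simp only [hz, if_pos hw]
      exact hb fun h2 => hS' w h2 hw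
    · simp only [hz, if_neg hw]
      exact (ha hw).symm
  have h2 : (B * A) y x = B y z' * A z' x := by
    rw [Matrix.mul_apply]
    refine Finset.sum_eq_single z' (fun u _ hu => ?_) (by simp)
    by_contra hne
    refine hu (funext fun w => ?_)
    have hb := hB.eq_of_ne (left_ne_zero_of_mul hne) w
    have ha := hA.eq_of_ne (right_ne_zero_of_mul hne) w
    by_cases hw : w ∈ S
    · simp only [hz', if_pos hw]
      exact (hb fun h2 => hS' w h2 hw).symm
    · simp only [hz', if_neg hw]
      exact ha hw
  rw [h1, h2, mul_comm]
  by_cases hoff : ∀ w, w ∉ S → w ∉ S' → y w = x w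
  · congr 1
    · refine hB.congr (fun w hw => ?_) (fun w hw => ?_) (fun w hw => ?_) (fun w hw => ?_)
      · by_cases hs : w ∈ S
        · simp [hz, hs]
        · simpa [hz, hs] using hoff w hs hw
      · by_cases hs : w ∈ S
        · simp [hz', hs]
        · simpa [hz', hs] using hoff w hs hw
      · simp [hz, hS' w hw]
      · simp [hz', hS' w hw]
    · refine hA.congr (fun w hw => ?_) (fun w hw => ?_) (fun w hw => ?_) (fun w hw => ?_)
      · simp [hz, hw]
      · simp [hz', hw]
      · simp [hz', hw]
      · simp [hz, hw]
  -- A discrepancy between `y` and `x` on a wire outside both sets makes both sides vanish.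
  · push Not at hoff
    obtain ⟨w, hw1, hw2, hw3⟩ := hoff
    have e1 : B z x = 0 := by
      by_contra hne
      have := hB.eq_of_ne hne w hw2
      simp only [hz, if_neg hw1] at this
      exact hw3 this
    have e2 : A z' x = 0 ∨ B y z' = 0 := by
      by_contra hne
      push Not at hne
      have := hB.eq_of_ne hne.2 w hw2
      simp only [hz', if_neg hw1] at this
      exact hw3 this
    rcases e2 with e2 | e2 <;> simp [e1, e2]

theorem ActsOn.one (S : Set W) : ActsOn S (1 : Matrix (W → Bool) (W → Bool) ℂ) where
  eq_of_ne {y x} h w _ := by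
    rw [Matrix.one_apply] at h
    by_cases hxy : y = x
    · rw [hxy]
    · simp [hxy] at h
  congr {y x y' x'} h h' hy hx := by
    have : y = x ↔ y' = x' := by
      constructor
      · rintro rfl
        ext w
        by_cases hw : w ∈ S
        · rw [← hy w hw, hx w hw]
        · exact h' w hw
      · rintro rfl
        ext w
        by_cases hw : w ∈ S
        · rw [hy w hw, ← hx w hw]
        · exact h w hw
    simp [Matrix.one_apply, this]

theorem ActsOn.mono {S S' : Set W} (hS : S ⊆ S') {T : Matrix (W → Bool) (W → Bool) ℂ}
    (h : ActsOn S T) : ActsOn S' T where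
  eq_of_ne hne w hw := h.eq_of_ne hne w fun h' => hw (hS h')
  congr {y x y' x'} h1 h2 hy hx := by
    by_cases hyx : ∀ w, w ∉ S → y w = x w
    · refine h.congr hyx (fun w hw => ?_) (fun w hw => hy w (hS hw)) fun w hw => hx w (hS hw)
      by_cases hw' : w ∈ S'
      · rw [← hy w hw', ← hx w hw', hyx w hw]
      · exact h2 w hw'
    · have e1 : T y x = 0 := by
        by_contra hne
        exact hyx fun w hw => h.eq_of_ne hne w hw
      have e2 : T y' x' = 0 := by
        by_contra hne
        refine hyx fun w hw => ?_
        by_cases hw' : w ∈ S'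
        · rw [hy w hw', hx w hw', h.eq_of_ne hne w hw]
        · exact h1 w hw'
      rw [e1, e2]

open Classical in
-- Intermediate states differ from the input only on `S`, so both sums can be indexed by the
-- assignments to `S` and compared term by term.
theorem ActsOn.mul {S : Set W} {A B : Matrix (W → Bool) (W → Bool) ℂ}
    (hA : ActsOn S A) (hB : ActsOn S B) : ActsOn S (A * B) where
  eq_of_ne {y x} hne w hw := by
    rw [Matrix.mul_apply] at hne
    obtain ⟨z, _, hz⟩ := Finset.exists_ne_zero_of_sum_ne_zero hne
    rw [hA.eq_of_ne (left_ne_zero_of_mul hz) w hw, hB.eq_of_ne (right_ne_zero_of_mul hz) w hw]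
  congr {y x y' x'} h h' hy hx := by
    let a : {w // w ∈ S} → W := Subtype.val
    have ha : Function.Injective a := Subtype.val_injective
    have hr : ∀ w, w ∉ Set.range a ↔ w ∉ S := fun w => by simp [a]
    rw [Matrix.mul_apply, Matrix.mul_apply,
      sum_eq_sum_overwrite ha x _ fun z hz => by
        by_contra hne
        exact hz fun w hw => hB.eq_of_ne (right_ne_zero_of_mul hne) w ((hr w).1 hw),
      sum_eq_sum_overwrite ha x' _ fun z hz => by
        by_contra hne
        exact hz fun w hw => hB.eq_of_ne (right_ne_zero_of_mul hne) w ((hr w).1 hw)]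
    refine Finset.sum_congr rfl fun b _ => ?_
    have hb : ∀ u, ∀ w, w ∉ S → overwrite a u b w = u w :=
      fun u w hw => overwrite_of_notMem _ _ ((hr w).2 hw)
    have hbb : ∀ w ∈ S, overwrite a x b w = overwrite a x' b w := fun w hw => by
      rw [show w = a ⟨w, hw⟩ from rfl, overwrite_apply ha, overwrite_apply ha]
    congr 1
    · exact hA.congr (fun w hw => by rw [hb x w hw, h w hw])
        (fun w hw => by rw [hb x' w hw, h' w hw]) hy hbb
    · exact hB.congr (hb x) (hb x') hbb hx

theorem ActsOn.parallelOp {κ : Type} [Fintype κ] (a : κ → W) (u : κ → Matrix Bool Bool ℂ) :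
    ActsOn (Set.range a) (parallelOp a fun _ => u) where
  eq_of_ne {y x} hne w hw := by
    by_contra hc
    exact hne (parallelOp_apply_of_not fun h => hc (h w hw))
  congr {y x y' x'} h h' hy hx := by
    rw [parallelOp_apply_of h, parallelOp_apply_of h']
    refine Finset.prod_congr rfl fun ν _ => ?_
    rw [hy _ ⟨ν, rfl⟩, hx _ ⟨ν, rfl⟩]

theorem ActsOn.basisOp {S : Set W} {f : (W → Bool) → (W → Bool)}
    (h1 : ∀ x w, w ∉ S → f x w = x w)
    (h2 : ∀ x x', (∀ w ∈ S, x w = x' w) → ∀ w ∈ S, f x w = f x' w) :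
    ActsOn S (basisOp f) where
  eq_of_ne {y x} hne w hw := by
    simp only [StatePrep.basisOp, Matrix.of_apply, ne_eq, ite_eq_right_iff, one_ne_zero, imp_false,
      not_not] at hne
    rw [hne, h1 x w hw]
  congr {y x y' x'} h h' hy hx := by
    have key : ∀ {y x y' x' : W → Bool}, (∀ w, w ∉ S → y' w = x' w) → (∀ w ∈ S, y w = y' w) →
        (∀ w ∈ S, x w = x' w) → y = f x → y' = f x' := by
      intro y x y' x' h' hy hx e
      ext w
      by_cases hw : w ∈ S
      · rw [← hy w hw, e, h2 x x' hx w hw]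
      · rw [h' w hw, h1 x' w hw]
    simp only [StatePrep.basisOp, Matrix.of_apply]
    refine if_congr ⟨key h' hy hx, key h (fun w hw => (hy w hw).symm) fun w hw => (hx w hw).symm⟩
      rfl rfl

end Local

/-! ### Calculus of circuits -/

section CircuitCalculus

variable {W : Type} [Fintype W] [DecidableEq W]

/-- The operator of a list of gates, the head being applied first. -/
def gatesOp (L : List (Gate W)) : Matrix (W → Bool) (W → Bool) ℂ :=
  L.foldl (fun T g => g.op * T) 1

theorem foldl_gate_op (L : List (Gate W)) (T : Matrix (W → Bool) (W → Bool) ℂ) :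
    L.foldl (fun T g => g.op * T) T = gatesOp L * T := by
  induction L generalizing T with
  | nil => simp [gatesOp]
  | cons g L ih =>
    have h1 : gatesOp (g :: L) = gatesOp L * g.op := by
      rw [gatesOp, List.foldl_cons, ih (g.op * 1), Matrix.mul_one]
    rw [List.foldl_cons, ih, h1, Matrix.mul_assoc]

theorem gatesOp_append (L L' : List (Gate W)) : gatesOp (L ++ L') = gatesOp L' * gatesOp L := by
  rw [gatesOp, List.foldl_append, foldl_gate_op]
  rfl

@[simp] theorem gatesOp_nil : gatesOp ([] : List (Gate W)) = 1 := rfl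

theorem gatesOp_singleton (g : Gate W) : gatesOp [g] = g.op := by simp [gatesOp]

theorem gatesOp_cons (g : Gate W) (L : List (Gate W)) : gatesOp (g :: L) = gatesOp L * g.op := by
  rw [← List.singleton_append, gatesOp_append, gatesOp_singleton]

theorem Circuit.op_eq (C : Circuit W) : C.op = gatesOp C.flatten := rfl

theorem Circuit.op_append (C C' : Circuit W) :
    Circuit.op (C ++ C' : Circuit W) = C'.op * C.op := by
  simp [Circuit.op_eq, gatesOp_append]

theorem Circuit.op_nil : Circuit.op ([] : Circuit W) = 1 := rfl

theorem Circuit.op_singleton (L : List (Gate W)) : Circuit.op [L] = gatesOp L := by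
  simp [Circuit.op_eq]

/-! ### Gates -/

theorem Gate.op_actsOn (g : Gate W) : ActsOn g.wires g.op := by
  cases g with
  | single w u =>
    refine (ActsOn.parallelOp (fun _ : Unit => w) fun _ => (u : Matrix Bool Bool ℂ)).mono ?_
    simp [Gate.wires]
  | cnot c t h =>
    refine ActsOn.basisOp (fun x w hw => ?_) fun x x' hx w hw => ?_
    · rw [Function.update_of_ne]
      rintro rfl
      exact hw (by simp [Gate.wires])
    · by_cases hwt : w = t
      · subst hwt
        simp [hx w hw, hx c (by simp [Gate.wires])]
      · simp [Function.update_of_ne hwt, hx w hw]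

theorem basisOp_conjTranspose_of_leftInverse {f g : (W → Bool) → (W → Bool)}
    (h : ∀ x, g (f x) = x) (h' : ∀ x, f (g x) = x) : (basisOp f)ᴴ = basisOp g := by
  ext y x
  have : x = f y ↔ y = g x := ⟨fun e => by rw [e, h], fun e => by rw [e, h']⟩
  simp [basisOp, Matrix.conjTranspose_apply, this, apply_ite]

theorem Gate.dagger_op (g : Gate W) : g.dagger.op = g.opᴴ := by
  cases g with
  | single w u =>
    simp only [Gate.dagger, Gate.op]
    rw [parallelOp_conjTranspose _ fun _ _ _ => rfl]
    rfl
  | cnot c t h =>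
    refine (basisOp_conjTranspose_of_leftInverse ?_ ?_).symm <;>
    · intro x
      ext w
      by_cases hw : w = t
      · subst hw
        simp [Function.update_of_ne h]
      · simp [Function.update_of_ne hw]

theorem Gate.dagger_wires (g : Gate W) : g.dagger.wires = g.wires := by
  cases g <;> rfl

theorem Gate.op_conjTranspose_mul (g : Gate W) : g.opᴴ * g.op = 1 := by
  cases g with
  | single w u =>
    simp only [Gate.op]
    have hinj : Function.Injective fun _ : Unit => w := fun _ _ _ => rfl
    rw [parallelOp_conjTranspose _ fun _ _ _ => rfl, parallelOp_mul hinj _ _ fun _ _ _ => rfl]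
    have : (u : Matrix Bool Bool ℂ)ᴴ * (u : Matrix Bool Bool ℂ) = 1 :=
      Matrix.mem_unitaryGroup_iff'.1 u.2
    simp only [this]
    exact parallelOp_one hinj
  | cnot c t h =>
    rw [← Gate.dagger_op]
    simp only [Gate.dagger, Gate.op]
    rw [basisOp_comp]
    refine matrix_ext_ket fun x => ?_
    rw [basisOp_mulVec_ket, Matrix.one_mulVec]
    congr 1
    ext w
    by_cases hw : w = t
    · subst hw
      simp [Function.update_of_ne h]
    · simp [Function.update_of_ne hw]

theorem gatesOp_conjTranspose_mul (L : List (Gate W)) : (gatesOp L)ᴴ * gatesOp L = 1 := by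
  induction L with
  | nil => simp
  | cons g L ih =>
    rw [gatesOp_cons, Matrix.conjTranspose_mul, Matrix.mul_assoc, ← Matrix.mul_assoc _ (gatesOp L),
      ih, Matrix.one_mul, Gate.op_conjTranspose_mul]

theorem Circuit.conjTranspose_op_mul_op (C : Circuit W) : C.opᴴ * C.op = 1 :=
  gatesOp_conjTranspose_mul _

theorem gatesOp_dagger (L : List (Gate W)) : gatesOp (L.map Gate.dagger).reverse = (gatesOp L)ᴴ := by
  induction L with
  | nil => simp
  | cons g L ih =>
    rw [List.map_cons, List.reverse_cons, gatesOp_append, ih, gatesOp_cons g, gatesOp_singleton,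
      Gate.dagger_op, Matrix.conjTranspose_mul]

theorem Circuit.dagger_cons (L : List (Gate W)) (C : Circuit W) :
    Circuit.dagger (L :: C : Circuit W) = C.dagger ++ [(L.map Gate.dagger).reverse] := by
  simp [Circuit.dagger]

theorem Circuit.dagger_append (C C' : Circuit W) :
    Circuit.dagger (C ++ C' : Circuit W) = C'.dagger ++ C.dagger := by
  simp [Circuit.dagger]

theorem Circuit.op_dagger (C : Circuit W) : C.dagger.op = C.opᴴ := by
  induction C with
  | nil => simp [Circuit.dagger, Circuit.op_nil]
  | cons L C ih =>
    rw [Circuit.dagger_cons, Circuit.op_append, ih, Circuit.op_singleton, gatesOp_dagger,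
      ← List.singleton_append, Circuit.op_append, Circuit.op_singleton,
      Matrix.conjTranspose_mul]

@[simp] theorem Circuit.length_dagger (C : Circuit W) : C.dagger.length = C.length := by
  simp [Circuit.dagger]

theorem Gate.dagger_dagger (g : Gate W) : g.dagger.dagger = g := by
  cases g <;> simp [Gate.dagger]

theorem Circuit.dagger_dagger (C : Circuit W) : C.dagger.dagger = C := by
  have : (Gate.dagger ∘ Gate.dagger : Gate W → Gate W) = id := funext Gate.dagger_dagger
  simp [Circuit.dagger, Function.comp_def, Gate.dagger_dagger]

theorem Circuit.Valid.dagger {C : Circuit W} (h : C.Valid) : C.dagger.Valid := by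
  intro L hL
  simp only [Circuit.dagger, List.mem_reverse, List.mem_map] at hL
  obtain ⟨L', hL', rfl⟩ := hL
  rw [List.pairwise_reverse, List.pairwise_map]
  refine (h L' hL').imp fun hd => ?_
  simpa [Gate.dagger_wires] using hd.symm

theorem Circuit.Valid.append {C C' : Circuit W} (h : C.Valid) (h' : C'.Valid) :
    Circuit.Valid (C ++ C' : Circuit W) := by
  intro L hL
  rcases List.mem_append.1 hL with hL | hL
  exacts [h L hL, h' L hL]

theorem Circuit.valid_nil : Circuit.Valid ([] : Circuit W) := by
  intro L hL
  simp at hL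

/-! ### Wires touched by a circuit -/

/-- All gates act on wires in `S`. -/
def Circuit.Within (S : Set W) (C : Circuit W) : Prop := ∀ L ∈ C, ∀ g ∈ L, g.wires ⊆ S

/-- A gate of layer `t` acts on `w`. -/
def Circuit.Touches (C : Circuit W) (t : ℕ) (w : W) : Prop :=
  ∃ L, C[t]? = some L ∧ ∃ g ∈ L, w ∈ g.wires

theorem Circuit.Within.mono {S S' : Set W} {C : Circuit W} (h : C.Within S) (hS : S ⊆ S') :
    C.Within S' := fun L hL g hg => (h L hL g hg).trans hS

theorem Circuit.Within.append {S : Set W} {C C' : Circuit W} (h : C.Within S) (h' : C'.Within S) :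
    Circuit.Within S (C ++ C' : Circuit W) := by
  intro L hL
  rcases List.mem_append.1 hL with hL | hL
  exacts [h L hL, h' L hL]

theorem Circuit.Within.touches {S : Set W} {C : Circuit W} (h : C.Within S) {t : ℕ} {w : W}
    (ht : C.Touches t w) : w ∈ S := by
  obtain ⟨L, hL, g, hg, hw⟩ := ht
  exact h L (List.mem_of_getElem? hL) g hg hw

theorem Circuit.Within.dagger {S : Set W} {C : Circuit W} (h : C.Within S) :
    C.dagger.Within S := by
  intro L hL g hg
  simp only [Circuit.dagger, List.mem_reverse, List.mem_map] at hL
  obtain ⟨L', hL', rfl⟩ := hL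
  simp only [List.mem_reverse, List.mem_map] at hg
  obtain ⟨g', hg', rfl⟩ := hg
  rw [Gate.dagger_wires]
  exact h L' hL' g' hg'

theorem Circuit.within_of_touches {S : Set W} {C : Circuit W}
    (h : ∀ t w, C.Touches t w → w ∈ S) : C.Within S := by
  intro L hL g hg w hw
  obtain ⟨t, ht⟩ := List.getElem?_of_mem hL
  exact h t w ⟨L, ht, g, hg, hw⟩

theorem Circuit.Touches.lt_length {C : Circuit W} {t : ℕ} {w : W} (h : C.Touches t w) :
    t < C.length := by
  obtain ⟨L, hL, -⟩ := h
  exact (List.getElem?_eq_some_iff.1 hL).1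

theorem Circuit.touches_append {C C' : Circuit W} {t : ℕ} {w : W}
    (h : Circuit.Touches (C ++ C' : Circuit W) t w) :
    C.Touches t w ∨ C.length ≤ t ∧ C'.Touches (t - C.length) w := by
  obtain ⟨L, hL, hg⟩ := h
  by_cases ht : t < C.length
  · rw [List.getElem?_append_left ht] at hL
    exact Or.inl ⟨L, hL, hg⟩
  · rw [List.getElem?_append_right (not_lt.1 ht)] at hL
    exact Or.inr ⟨not_lt.1 ht, L, hL, hg⟩

theorem Circuit.touches_dagger {C : Circuit W} {t : ℕ} {w : W} (h : C.dagger.Touches t w) :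
    C.Touches (C.length - 1 - t) w := by
  have hlt := h.lt_length
  obtain ⟨L, hL, g, hg, hw⟩ := h
  rw [Circuit.length_dagger] at hlt
  rw [Circuit.dagger, List.getElem?_reverse (by simpa using hlt), List.getElem?_map,
    Option.map_eq_some_iff] at hL
  obtain ⟨L', hL', rfl⟩ := hL
  simp only [List.mem_reverse, List.mem_map] at hg
  obtain ⟨g', hg', rfl⟩ := hg
  rw [Gate.dagger_wires] at hw
  exact ⟨L', by simpa using hL', g', hg', hw⟩

theorem gatesOp_actsOn {S : Set W} {L : List (Gate W)} (h : ∀ g ∈ L, g.wires ⊆ S) :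
    ActsOn S (gatesOp L) := by
  induction L with
  | nil => exact ActsOn.one S
  | cons g L ih =>
    rw [gatesOp_cons]
    exact (ih fun g' hg' => h g' (List.mem_cons_of_mem _ hg')).mul
      (g.op_actsOn.mono (h g List.mem_cons_self))

theorem Circuit.Within.actsOn {S : Set W} {C : Circuit W} (h : C.Within S) : ActsOn S C.op := by
  refine gatesOp_actsOn fun g hg => ?_
  obtain ⟨L, hL, hg⟩ := List.mem_flatten.1 hg
  exact h L hL g hg

theorem ActsOn.mulVec_eq_zero {S : Set W} {T : Matrix (W → Bool) (W → Bool) ℂ} (hT : ActsOn S T)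
    {w : W} (hw : w ∉ S) {φ : (W → Bool) → ℂ} (hφ : ∀ y, y w = true → φ y = 0)
    {y : W → Bool} (hy : y w = true) : (T *ᵥ φ) y = 0 := by
  rw [Matrix.mulVec, dotProduct]
  refine Finset.sum_eq_zero fun z _ => ?_
  by_contra hne
  have h1 := hT.eq_of_ne (left_ne_zero_of_mul hne) w hw
  exact right_ne_zero_of_mul hne (hφ z (by rw [← h1, hy]))

/-! ### Parallel composition -/

/-- The circuits of a list run in parallel, in `D` layers. -/
def parCirc (D : ℕ) (Cs : List (Circuit W)) : Circuit W :=
  (List.range D).map fun t => Cs.flatMap fun C => C.getD t []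

@[simp] theorem length_parCirc (D : ℕ) (Cs : List (Circuit W)) : (parCirc D Cs).length = D := by
  simp [parCirc]

theorem mem_getD_of_within {S : Set W} {C : Circuit W} (h : C.Within S) {t : ℕ} {g : Gate W}
    (hg : g ∈ C.getD t []) : g.wires ⊆ S := by
  rw [List.getD_eq_getElem?_getD] at hg
  cases hC : C[t]? with
  | none => simp [hC] at hg
  | some L =>
    rw [hC] at hg
    exact h L (List.mem_of_getElem? hC) g hg

/-- Layerwise interleaving becomes sequential composition, because layer `D` of `A` commutes past
all earlier layers of `B`, which live on disjoint wires. -/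
theorem op_range_append {S S' : Set W} (hd : Disjoint S S') (A B : ℕ → List (Gate W))
    (hA : ∀ t, ∀ g ∈ A t, g.wires ⊆ S) (hB : ∀ t, ∀ g ∈ B t, g.wires ⊆ S') (D : ℕ) :
    Circuit.op ((List.range D).map fun t => A t ++ B t) =
      Circuit.op ((List.range D).map B) * Circuit.op ((List.range D).map A) := by
  induction D with
  | zero => simp [Circuit.op_nil]
  | succ D ih =>
    simp only [List.range_succ, List.map_append, List.map_cons, List.map_nil]
    rw [Circuit.op_append, ih, Circuit.op_append, Circuit.op_append, Circuit.op_singleton,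
      Circuit.op_singleton, Circuit.op_singleton, gatesOp_append]
    have hcomm : gatesOp (A D) * Circuit.op ((List.range D).map B) =
        Circuit.op ((List.range D).map B) * gatesOp (A D) := by
      refine (gatesOp_actsOn (hA D)).commute (Circuit.Within.actsOn ?_) hd
      intro L hL
      obtain ⟨t, -, rfl⟩ := List.mem_map.1 hL
      exact hB t
    simp only [Matrix.mul_assoc]
    rw [← Matrix.mul_assoc (gatesOp (A D)), hcomm, Matrix.mul_assoc]

theorem flatten_range_getD (C : Circuit W) (D : ℕ) (h : C.length ≤ D) :
    ((List.range D).map fun t => C.getD t []).flatten = C.flatten := by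
  induction C generalizing D with
  | nil => simp
  | cons L C ih =>
    cases D with
    | zero => simp at h
    | succ D =>
      rw [List.range_succ_eq_map]
      simp only [List.map_cons, List.flatten_cons, List.map_map]
      congr 1
      exact ih D (by simpa using h)

theorem op_parCirc_cons {S : Set W} {D : ℕ} {C : Circuit W} {Cs : List (Circuit W)}
    (hC : C.Within S) (hD : C.length ≤ D) (hCs : ∀ C' ∈ Cs, C'.Within Sᶜ) :
    (parCirc D (C :: Cs)).op = (parCirc D Cs).op * C.op := by
  have := op_range_append (S := S) (S' := Sᶜ) disjoint_compl_right (fun t => C.getD t [])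
    (fun t => Cs.flatMap fun C => C.getD t []) (fun t g hg => mem_getD_of_within hC hg)
    (fun t g hg => by
      obtain ⟨C', hC', hg⟩ := List.mem_flatMap.1 hg
      exact mem_getD_of_within (hCs C' hC') hg) D
  simp only [parCirc, List.flatMap_cons]
  rw [this, Circuit.op_eq ((List.range D).map fun t => C.getD t []), flatten_range_getD C D hD]
  rfl

theorem op_parCirc_nil (D : ℕ) : (parCirc D ([] : List (Circuit W))).op = 1 := by
  have : (parCirc D ([] : List (Circuit W))).flatten = [] := by
    simp [parCirc]
  rw [Circuit.op_eq, this, gatesOp_nil]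

theorem within_parCirc {ι : Type} {S : ι → Set W} {D : ℕ} {l : List ι} {C : ι → Circuit W}
    (h : ∀ i ∈ l, (C i).Within (S i)) :
    (parCirc D (l.map C)).Within {w | ∃ i ∈ l, w ∈ S i} := by
  intro L hL g hg
  obtain ⟨t, -, rfl⟩ := List.mem_map.1 hL
  obtain ⟨C', hC', hg⟩ := List.mem_flatMap.1 hg
  obtain ⟨i, hi, rfl⟩ := List.mem_map.1 hC'
  exact fun w hw => ⟨i, hi, mem_getD_of_within (h i hi) hg hw⟩

theorem valid_parCirc {ι : Type} {S : ι → Set W} {D : ℕ} {l : List ι} {C : ι → Circuit W}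
    (h : ∀ i ∈ l, (C i).Within (S i)) (hv : ∀ i ∈ l, (C i).Valid)
    (hd : l.Pairwise fun i j => Disjoint (S i) (S j)) : (parCirc D (l.map C)).Valid := by
  intro L hL
  obtain ⟨t, -, rfl⟩ := List.mem_map.1 hL
  rw [List.flatMap_map, List.pairwise_flatMap]
  constructor
  · intro i hi
    rw [List.getD_eq_getElem?_getD]
    cases hC : (C i)[t]? with
    | none => simp
    | some L => exact hv i hi L (List.mem_of_getElem? hC)
  · refine List.Pairwise.imp_of_mem ?_ hd
    intro i j hi hj hij g hg g' hg'
    exact Set.disjoint_of_subset (mem_getD_of_within (h i hi) hg)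
      (mem_getD_of_within (h j hj) hg') hij

end CircuitCalculus

/-! ### Circuits with clean auxiliary wires and their cost -/

section Cost

variable {V A : Type} [Fintype V] [DecidableEq V] [Fintype A] [DecidableEq A]

theorem ActsOn.conjTranspose {W : Type} [Fintype W] [DecidableEq W] {S : Set W}
    {T : Matrix (W → Bool) (W → Bool) ℂ} (h : ActsOn S T) : ActsOn S Tᴴ where
  eq_of_ne {y x} hne w hw := by
    refine (h.eq_of_ne (y := x) (x := y) (fun h0 => hne ?_) w hw).symm
    rw [Matrix.conjTranspose_apply, h0, star_zero]
  congr {y x y' x'} h1 h2 hy hx := by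
    rw [Matrix.conjTranspose_apply, Matrix.conjTranspose_apply,
      h.congr (fun w hw => (h1 w hw).symm) (fun w hw => (h2 w hw).symm) hx hy]

/-- `C` acts as `T` on the wires `V` when the wires `A` are in `|0⟩`, and leaves the latter
in `|0⟩`. -/
def Clean (C : Circuit (V ⊕ A)) (T : Matrix (V → Bool) (V → Bool) ℂ) : Prop :=
  C.op * injectOp (Sum.inl : V → V ⊕ A) = injectOp (Sum.inl : V → V ⊕ A) * T

/-- The circuit is unitary and the embedding isometric, so the induced `T` is an isometry. Unitarity
of the protocol is obtained in this way from its circuit. -/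
theorem Clean.conjTranspose_mul {C : Circuit (V ⊕ A)} {T : Matrix (V → Bool) (V → Bool) ℂ}
    (h : Clean C T) : Tᴴ * T = 1 := by
  have hE := injectOp_isometry (Sum.inl_injective : Function.Injective (Sum.inl : V → V ⊕ A))
  have h' : C.op * injectOp (Sum.inl : V → V ⊕ A) = injectOp (Sum.inl : V → V ⊕ A) * T := h
  set E : Matrix (V ⊕ A → Bool) (V → Bool) ℂ := injectOp Sum.inl
  calc Tᴴ * T = Tᴴ * (Eᴴ * E) * T := by rw [hE, Matrix.mul_one]
    _ = (E * T)ᴴ * (E * T) := by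
        rw [Matrix.conjTranspose_mul]
        simp only [Matrix.mul_assoc]
    _ = Eᴴ * ((C.opᴴ * C.op) * E) := by
        rw [← h', Matrix.conjTranspose_mul]
        simp only [Matrix.mul_assoc]
    _ = 1 := by rw [C.conjTranspose_op_mul_op, Matrix.one_mul, hE]

theorem Clean.dagger {C : Circuit (V ⊕ A)} {T : Matrix (V → Bool) (V → Bool) ℂ}
    (h : Clean C T) : Clean C.dagger Tᴴ := by
  -- A square isometry is unitary.
  have hT : T * Tᴴ = 1 := mul_eq_one_comm.1 h.conjTranspose_mul
  rw [Clean, Circuit.op_dagger]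
  calc C.opᴴ * injectOp (Sum.inl : V → V ⊕ A)
      = C.opᴴ * (injectOp (Sum.inl : V → V ⊕ A) * T) * Tᴴ := by
        rw [Matrix.mul_assoc, Matrix.mul_assoc, hT, Matrix.mul_one]
    _ = injectOp (Sum.inl : V → V ⊕ A) * Tᴴ := by
        rw [← h, ← Matrix.mul_assoc C.opᴴ, C.conjTranspose_op_mul_op, Matrix.one_mul]

theorem Clean.append {C C' : Circuit (V ⊕ A)} {T T' : Matrix (V → Bool) (V → Bool) ℂ}
    (h : Clean C T) (h' : Clean C' T') : Clean (C ++ C' : Circuit (V ⊕ A)) (T' * T) := by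
  rw [Clean, Circuit.op_append, Matrix.mul_assoc, h, ← Matrix.mul_assoc, h', Matrix.mul_assoc]

theorem clean_of_ket {C : Circuit (V ⊕ A)} {T : Matrix (V → Bool) (V → Bool) ℂ}
    (h : ∀ x : V → Bool, C.op *ᵥ ket (Sum.elim x fun _ => false) =
      injectOp (Sum.inl : V → V ⊕ A) *ᵥ (T *ᵥ ket x)) : Clean C T := by
  refine matrix_ext_ket fun x => ?_
  rw [← Matrix.mulVec_mulVec, ← Matrix.mulVec_mulVec, injectOp_mulVec_ket, embed_inl, h]

theorem clean_of_maps {C : Circuit (V ⊕ A)} {f : (V → Bool) → (V → Bool)}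
    (h : ∀ x : V → Bool, C.op *ᵥ ket (Sum.elim x fun _ => false) =
      ket (Sum.elim (f x) fun _ => false)) : Clean C (basisOp f) :=
  clean_of_ket fun x => by rw [h, basisOp_mulVec_ket, injectOp_mulVec_ket, embed_inl]

theorem Clean.mulVec_inject {C : Circuit (V ⊕ A)} {T : Matrix (V → Bool) (V → Bool) ℂ}
    (h : Clean C T) (φ : (V → Bool) → ℂ) :
    C.op *ᵥ inject Sum.inl φ = inject Sum.inl (T *ᵥ φ) := by
  rw [← injectOp_mulVec Sum.inl_injective, ← injectOp_mulVec Sum.inl_injective,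
    Matrix.mulVec_mulVec, h, Matrix.mulVec_mulVec]

/-- The number of active auxiliary wires summed over the layers, for arbitrary states of the other
wires. -/
def auxCost (C : Circuit (V ⊕ A)) : ℕ := by
  classical exact
  ∑ t ∈ Finset.range C.length,
    (Finset.univ.filter fun j : A => C.Active (Sum.inl : V → V ⊕ A) t (Sum.inr j)).card

theorem inject_inl_apply_of_true (φ : (V → Bool) → ℂ) {y : V ⊕ A → Bool} {j : A}
    (hy : y (Sum.inr j) = true) : inject (Sum.inl : V → V ⊕ A) φ y = 0 := by
  rw [inject, if_neg]
  intro h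
  rw [h (Sum.inr j) (by simp)] at hy
  cases hy

/-- A wire not touched so far is still in `|0⟩`. A wire not touched any more must already be in
`|0⟩`: this is the first statement for the reversed circuit, started from an output whose auxiliary
wires are clean. -/
theorem touches_of_active {C : Circuit (V ⊕ A)} {T : Matrix (V → Bool) (V → Bool) ℂ}
    (hC : Clean C T) {t : ℕ} {j : A}
    (h : C.Active (Sum.inl : V → V ⊕ A) t (Sum.inr j)) :
    (∃ s ≤ t, C.Touches s (Sum.inr j)) ∧ ∃ s, t ≤ s ∧ C.Touches s (Sum.inr j) := by
  constructor
  · by_contra hc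
    push Not at hc
    rcases h with h | ⟨φ, y, hy, hne⟩
    · exact hc t le_rfl h
    · refine hne (ActsOn.mulVec_eq_zero (S := {(Sum.inr j : V ⊕ A)}ᶜ) (Circuit.Within.actsOn ?_)
        (by simp) (fun z hz => inject_inl_apply_of_true φ hz) hy)
      refine Circuit.within_of_touches fun s w hw => ?_
      rintro rfl
      have hs := hw.lt_length
      rw [List.length_take] at hs
      obtain ⟨L, hL, hg⟩ := hw
      rw [List.getElem?_take_of_lt (by omega)] at hL
      exact hc s (by omega) ⟨L, hL, hg⟩
  · by_contra hc
    push Not at hc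
    rcases h with h | ⟨φ, y, hy, hne⟩
    · exact hc t le_rfl h
    · have hsplit : C.op = Circuit.op (C.drop t) * Circuit.op (C.take t) := by
        rw [← Circuit.op_append, List.take_append_drop]
      have hback : Circuit.op (C.take t) *ᵥ inject Sum.inl φ =
          (Circuit.op (C.drop t))ᴴ *ᵥ inject Sum.inl (T *ᵥ φ) := by
        rw [← hC.mulVec_inject, hsplit, Matrix.mulVec_mulVec, ← Matrix.mul_assoc,
          Circuit.conjTranspose_op_mul_op, Matrix.one_mul]
      rw [hback] at hne
      refine hne (ActsOn.mulVec_eq_zero (S := {(Sum.inr j : V ⊕ A)}ᶜ)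
        (Circuit.Within.actsOn ?_).conjTranspose
        (by simp) (fun z hz => inject_inl_apply_of_true _ hz) hy)
      refine Circuit.within_of_touches fun s w hw => ?_
      rintro rfl
      obtain ⟨L, hL, hg⟩ := hw
      rw [List.getElem?_drop] at hL
      exact hc (t + s) (by omega) ⟨L, hL, hg⟩

/-- By `touches_of_active`, wire `j` can be active only in the layers from `lo j` up to `length - lo
j`. -/
theorem auxCost_le {C : Circuit (V ⊕ A)} {T : Matrix (V → Bool) (V → Bool) ℂ}
    (hC : Clean C T) (lo : A → ℕ)
    (h : ∀ t j, C.Touches t (Sum.inr j) → lo j ≤ t ∧ t + lo j < C.length) :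
    auxCost C ≤ ∑ j, (C.length - 2 * lo j) := by
  classical
  rw [auxCost]
  simp only [Finset.card_filter]
  rw [Finset.sum_comm]
  refine Finset.sum_le_sum fun j _ => ?_
  rw [← Finset.card_filter]
  calc _ ≤ (Finset.Ico (lo j) (C.length - lo j)).card := by
        refine Finset.card_le_card fun t ht => ?_
        rw [Finset.mem_filter] at ht
        obtain ⟨⟨s, hs, h1⟩, ⟨s', hs', h2⟩⟩ := touches_of_active hC ht.2
        have := h s j h1
        have := h s' j h2
        rw [Finset.mem_Ico]
        omega
    _ ≤ _ := by
        rw [Nat.card_Ico]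
        omega

/-- Cleanness lets the second circuit start from `T *ᵥ φ` with clean auxiliary wires. This is
covered by its own cost, since activity allows arbitrary states on `V`. -/
theorem auxCost_append {C C' : Circuit (V ⊕ A)} {T : Matrix (V → Bool) (V → Bool) ℂ}
    (hC : Clean C T) :
    auxCost (C ++ C' : Circuit (V ⊕ A)) ≤ auxCost C + auxCost C' := by
  classical
  rw [auxCost, List.length_append, Finset.sum_range_add]
  refine Nat.add_le_add (Finset.sum_le_sum fun t ht => ?_) (Finset.sum_le_sum fun t ht => ?_)
  · rw [Finset.mem_range] at ht
    refine Finset.card_le_card fun j hj => ?_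
    rw [Finset.mem_filter] at hj ⊢
    refine ⟨hj.1, ?_⟩
    have h2 := hj.2
    simp only [Circuit.Active] at h2 ⊢
    rwa [List.getElem?_append_left ht, List.take_append_of_le_length ht.le] at h2
  · refine Finset.card_le_card fun j hj => ?_
    rw [Finset.mem_filter] at hj ⊢
    refine ⟨hj.1, ?_⟩
    have h2 := hj.2
    simp only [Circuit.Active] at h2 ⊢
    rw [List.getElem?_append_right (by omega), Nat.add_sub_cancel_left, List.take_append,
      List.take_of_length_le (by omega), Nat.add_sub_cancel_left] at h2
    refine h2.imp_right ?_
    rintro ⟨φ, y, hy, hne⟩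
    refine ⟨T *ᵥ φ, y, hy, ?_⟩
    rwa [Circuit.op_append, ← Matrix.mulVec_mulVec, hC.mulVec_inject] at hne

/-- Protocol wires are counted in every layer. -/
theorem spacetimeAllocation_le {ι : Type} [Fintype ι] [DecidableEq ι] {d : ι → V}
    (hd : Function.Injective d) (C : Circuit (V ⊕ A)) :
    C.spacetimeAllocation (Sum.inl ∘ d) ≤ C.length * Fintype.card V + auxCost C := by
  classical
  rw [Circuit.spacetimeAllocation, auxCost, Circuit.depth]
  calc _ ≤ ∑ t ∈ Finset.range C.length, (Fintype.card V +
        (Finset.univ.filter fun j : A => C.Active (Sum.inl : V → V ⊕ A) t (Sum.inr j)).card) := by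
        refine Finset.sum_le_sum fun t _ => ?_
        rw [← Finset.card_univ, ← Finset.card_map (f := (Function.Embedding.inl : V ↪ V ⊕ A)),
          ← Finset.card_map (f := (Function.Embedding.inr : A ↪ V ⊕ A))]
        refine le_trans (Finset.card_le_card fun w hw => ?_) (Finset.card_union_le _ _)
        rw [Finset.mem_filter] at hw
        rw [Finset.mem_union]
        rcases w with v | j
        · exact Or.inl (by simp)
        · right
          simp only [Finset.mem_map, Finset.mem_filter, Finset.mem_univ, true_and,
            Function.Embedding.inr_apply, Sum.inr.injEq, exists_eq_right]
          refine hw.2.imp_right ?_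
          rintro ⟨φ, y, hy, hne⟩
          -- An input supported on `d` is a particular state of `V`, hence among those allowed in
          -- `auxCost`.
          refine ⟨inject d φ, y, hy, ?_⟩
          rwa [inject_inject hd]
    _ = _ := by
        rw [Finset.sum_add_distrib, Finset.sum_const, Finset.card_range, smul_eq_mul]

/-- A valid circuit acting as `T`, of depth at most `D`, such that the auxiliary cost of the circuit
and of its inverse is at most `K`. -/
structure Block (C : Circuit (V ⊕ A)) (T : Matrix (V → Bool) (V → Bool) ℂ) (D K : ℕ) : Prop where
  valid : C.Valid
  clean : Clean C T
  length_le : C.length ≤ D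
  cost_le : auxCost C ≤ K
  cost_dagger_le : auxCost C.dagger ≤ K

theorem Block.append {C C' : Circuit (V ⊕ A)} {T T' : Matrix (V → Bool) (V → Bool) ℂ}
    {D K D' K' : ℕ} (h : Block C T D K) (h' : Block C' T' D' K') :
    Block (C ++ C' : Circuit (V ⊕ A)) (T' * T) (D + D') (K + K') where
  valid := h.valid.append h'.valid
  clean := h.clean.append h'.clean
  length_le := by
    rw [List.length_append]
    exact Nat.add_le_add h.length_le h'.length_le
  cost_le := (auxCost_append h.clean).trans (Nat.add_le_add h.cost_le h'.cost_le)
  cost_dagger_le := by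
    rw [Circuit.dagger_append, add_comm]
    exact (auxCost_append h'.clean.dagger).trans
      (Nat.add_le_add h'.cost_dagger_le h.cost_dagger_le)

theorem Block.dagger {C : Circuit (V ⊕ A)} {T : Matrix (V → Bool) (V → Bool) ℂ}
    {D K : ℕ} (h : Block C T D K) : Block C.dagger Tᴴ D K where
  valid := h.valid.dagger
  clean := h.clean.dagger
  length_le := by simpa using h.length_le
  cost_le := h.cost_dagger_le
  cost_dagger_le := by
    rw [Circuit.dagger_dagger]
    exact h.cost_le

theorem Block.mono {C : Circuit (V ⊕ A)} {T : Matrix (V → Bool) (V → Bool) ℂ}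
    {D K D' K' : ℕ} (h : Block C T D K) (hD : D ≤ D') (hK : K ≤ K') : Block C T D' K' :=
  ⟨h.valid, h.clean, h.length_le.trans hD, h.cost_le.trans hK, h.cost_dagger_le.trans hK⟩

/-- Cost of a block from a lower bound `lo j` on the distance of every use of the auxiliary wire `j`
from both ends of the circuit. -/
theorem Block.of_touches {C : Circuit (V ⊕ A)} {T : Matrix (V → Bool) (V → Bool) ℂ} {D K : ℕ}
    (hv : C.Valid) (hC : Clean C T) (hD : C.length ≤ D) (lo : A → ℕ)
    (h : ∀ t j, C.Touches t (Sum.inr j) → lo j ≤ t ∧ t + lo j < C.length)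
    (hK : ∑ j, (C.length - 2 * lo j) ≤ K) : Block C T D K where
  valid := hv
  clean := hC
  length_le := hD
  cost_le := (auxCost_le hC lo h).trans hK
  cost_dagger_le := by
    -- Reversal sends layer `t` to `length - 1 - t`, and the condition on `lo` is symmetric under
    -- this.
    refine (auxCost_le hC.dagger lo fun t j ht => ?_).trans (by simpa using hK)
    have h1 := ht.lt_length
    have := h _ j (Circuit.touches_dagger ht)
    rw [Circuit.length_dagger] at *
    omega

open Classical in
/-- Cost of a block all of whose auxiliary wires are counted in every layer. -/
theorem Block.of_within {C : Circuit (V ⊕ A)} {T : Matrix (V → Bool) (V → Bool) ℂ} {D : ℕ}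
    (hv : C.Valid) (hC : Clean C T) (hD : C.length ≤ D) {S : Set (V ⊕ A)} (hS : C.Within S)
    {k : ℕ} (hk : (Finset.univ.filter fun j : A => (Sum.inr j : V ⊕ A) ∈ S).card ≤ k) :
    Block C T D (k * D) := by
  refine Block.of_touches hv hC hD
    -- The value `0` charges a wire of `S` for every layer; the value `C.length` makes every other
    -- wire free.
    (fun j => if (Sum.inr j : V ⊕ A) ∈ S then 0 else C.length) (fun t j ht => ?_) ?_
  · rw [if_pos (hS.touches ht)]
    exact ⟨Nat.zero_le _, ht.lt_length⟩
  · calc _ ≤ ∑ j : A, if (Sum.inr j : V ⊕ A) ∈ S then D else 0 := by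
          refine Finset.sum_le_sum fun j _ => ?_
          split_ifs <;> omega
      _ ≤ _ := by
          rw [← Finset.sum_filter, Finset.sum_const, smul_eq_mul]
          exact Nat.mul_le_mul_right _ hk

end Cost

/-! ### One-qubit gates on basis states -/

section SingleGates

variable {W : Type} [Fintype W] [DecidableEq W]

theorem single_op_mulVec_ket (w : W) (u : Matrix.unitaryGroup Bool ℂ) (x : W → Bool) :
    (Gate.single w u).op *ᵥ ket x =
      (u : Matrix Bool Bool ℂ) false (x w) • ket (Function.update x w false) +
        (u : Matrix Bool Bool ℂ) true (x w) • ket (Function.update x w true) := by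
  ext y
  rw [mulVec_ket]
  simp only [Gate.op, Pi.add_apply, Pi.smul_apply, smul_eq_mul, ket_apply]
  by_cases h : ∀ v, v ∉ Set.range (fun _ : Unit => w) → y v = x v
  · rw [parallelOp_apply_of h]
    have hy : ∀ b, y = Function.update x w b ↔ y w = b := by
      intro b
      constructor
      · intro e
        rw [e, Function.update_self]
      · rintro rfl
        ext v
        by_cases hv : v = w
        · subst hv
          simp
        · rw [Function.update_of_ne hv]
          exact h v (by simpa using hv)
    simp only [hy]
    cases hyw : y w <;> simp
  · rw [parallelOp_apply_of_not h]
    have hy : ∀ b, y ≠ Function.update x w b := by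
      rintro b rfl
      refine h fun v hv => Function.update_of_ne ?_ _ _
      rintro rfl
      exact hv ⟨(), rfl⟩
    simp [hy]

/-- The unitary `diag(c false, c true)`. -/
def diagU (c : Bool → ℂ) (hc : ∀ b, ‖c b‖ = 1) : Matrix.unitaryGroup Bool ℂ :=
  ⟨Matrix.diagonal c, by
    rw [Matrix.mem_unitaryGroup_iff, Matrix.star_eq_conjTranspose, Matrix.diagonal_conjTranspose,
      Matrix.diagonal_mul_diagonal, ← Matrix.diagonal_one]
    congr 1
    ext b
    simp [Complex.mul_conj, Complex.normSq_eq_norm_sq, hc b]⟩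

theorem diagU_op_mulVec_ket (w : W) (c : Bool → ℂ) (hc : ∀ b, ‖c b‖ = 1) (x : W → Bool) :
    (Gate.single w (diagU c hc)).op *ᵥ ket x = c (x w) • ket x := by
  rw [single_op_mulVec_ket]
  cases hx : x w <;> simp [diagU, Matrix.diagonal, ← hx]

/-- The Pauli matrix `X`. -/
def pauliX : Matrix.unitaryGroup Bool ℂ :=
  ⟨Matrix.of fun i j => if i = j then 0 else 1, by
    rw [Matrix.mem_unitaryGroup_iff]
    ext i j
    fin_cases i <;> fin_cases j <;> simp [Matrix.mul_apply]⟩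

theorem pauliX_op_mulVec_ket (w : W) (x : W → Bool) :
    (Gate.single w pauliX).op *ᵥ ket x = ket (Function.update x w (!x w)) := by
  rw [single_op_mulVec_ket]
  cases hx : x w <;> simp [pauliX]

theorem cnot_op_mulVec_ket (c t : W) (h : c ≠ t) (x : W → Bool) :
    (Gate.cnot c t h).op *ᵥ ket x = ket (Function.update x t (xor (x t) (x c))) :=
  basisOp_mulVec_ket _ _

theorem inv_sqrt_two_sq : ((√2 : ℝ) : ℂ)⁻¹ * ((√2 : ℝ) : ℂ)⁻¹ = 1 / 2 := by
  rw [← mul_inv, ← Complex.ofReal_mul, Real.mul_self_sqrt (by norm_num)]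
  norm_num

/-- The Hadamard matrix. -/
def hadamard : Matrix.unitaryGroup Bool ℂ :=
  ⟨Matrix.of fun i j => ((√2 : ℝ) : ℂ)⁻¹ * if i && j then -1 else 1, by
    have h := inv_sqrt_two_sq
    rw [Matrix.mem_unitaryGroup_iff]
    ext i j
    fin_cases i <;> fin_cases j <;> simp [Matrix.mul_apply] <;> rw [h] <;> norm_num⟩

/-! ### The Toffoli gate -/

/-- `x` with three wires overwritten. -/
def setThree (a b t : W) (x : W → Bool) (p q r : Bool) : W → Bool :=
  Function.update (Function.update (Function.update x a p) b q) t r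

section Three

variable {a b t : W} (hab : a ≠ b) (hat : a ≠ t) (hbt : b ≠ t) (x : W → Bool) (p q r : Bool)
include hab hat hbt

theorem setThree_a : setThree a b t x p q r a = p := by
  simp [setThree, Function.update_of_ne hat, Function.update_of_ne hab]

theorem setThree_b : setThree a b t x p q r b = q := by
  simp [setThree, Function.update_of_ne hbt]

theorem setThree_t : setThree a b t x p q r t = r := by
  simp [setThree]

theorem update_setThree_b (q' : Bool) :
    Function.update (setThree a b t x p q r) b q' = setThree a b t x p q' r := by
  rw [setThree, Function.update_comm hbt.symm, Function.update_idem]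
  rfl

theorem update_setThree_t (r' : Bool) :
    Function.update (setThree a b t x p q r) t r' = setThree a b t x p q r' := by
  simp [setThree]

theorem setThree_self : setThree a b t x (x a) (x b) (x t) = x := by
  ext w
  simp only [setThree, Function.update_apply]
  split_ifs with h1 h2 h3 <;> simp [*]

end Three

/-- A primitive eighth root of unity. -/
def rootEight : ℂ := Complex.exp ((Real.pi / 4 : ℝ) * Complex.I)

theorem norm_rootEight : ‖rootEight‖ = 1 := Complex.norm_exp_ofReal_mul_I _

theorem rootEight_pow : rootEight * rootEight * rootEight * rootEight = -1 := by
  rw [rootEight, ← Complex.exp_add, ← Complex.exp_add, ← Complex.exp_add,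
    show ((Real.pi / 4 : ℝ) * Complex.I + (Real.pi / 4 : ℝ) * Complex.I +
      (Real.pi / 4 : ℝ) * Complex.I + (Real.pi / 4 : ℝ) * Complex.I : ℂ) = Real.pi * Complex.I by
        push_cast; ring]
  exact Complex.exp_pi_mul_I

theorem rootEight_ne_zero : rootEight ≠ 0 := Complex.exp_ne_zero _

/-- The gates `diag(1, ω)` and `diag(1, ω⁻¹)`. -/
def tGate : Matrix.unitaryGroup Bool ℂ :=
  diagU (fun b => if b then rootEight else 1) (by intro b; cases b <;> simp [norm_rootEight])

def tGateInv : Matrix.unitaryGroup Bool ℂ :=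
  diagU (fun b => if b then rootEight⁻¹ else 1) (by intro b; cases b <;> simp [norm_rootEight])

/-- Gates implementing the doubly controlled `Z`. -/
def cczGates (a b t : W) (hab : a ≠ b) (hat : a ≠ t) (hbt : b ≠ t) : List (Gate W) :=
  [.single a tGate, .single b tGate, .single t tGate, .cnot a b hab, .single b tGateInv,
    .cnot b t hbt, .single t tGate, .cnot a b hab, .cnot a t hat, .single t tGateInv,
    .cnot b t hbt, .cnot a t hat, .single t tGateInv, .cnot a t hat]

/-- The CNOTs expose all parities of the three bits, and the phases add up to `p + q + r - (p ⊕ q) -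
(q ⊕ r) - (p ⊕ r) + (p ⊕ q ⊕ r) = 4pqr` eighths of a turn. The fourth power of `rootEight` is `-1`.
-/
theorem cczGates_mulVec_ket (a b t : W) (hab : a ≠ b) (hat : a ≠ t) (hbt : b ≠ t)
    (x : W → Bool) (p q r : Bool) :
    gatesOp (cczGates a b t hab hat hbt) *ᵥ ket (setThree a b t x p q r) =
      (if p && q && r then -1 else 1 : ℂ) • ket (setThree a b t x p q r) := by
  have e1 := rootEight_pow
  have e2 := rootEight_ne_zero
  have ea := setThree_a hab hat hbt x
  have eb := setThree_b hab hat hbt x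
  have et := setThree_t hab hat hbt x
  have ub := update_setThree_b hab hat hbt x
  have ut := update_setThree_t hab hat hbt x
  simp only [cczGates, gatesOp_cons, gatesOp_nil, Matrix.one_mul, ← Matrix.mulVec_mulVec, tGate,
    tGateInv, diagU_op_mulVec_ket, cnot_op_mulVec_ket, Matrix.mulVec_smul, ea, eb, et, ub, ut,
    smul_smul]
  cases p <;> cases q <;> cases r <;> simp [e2]
  rw [← mul_assoc, ← mul_assoc, e1, neg_one_smul]

theorem hadamard_op_mulVec_ket (a b t : W) (hab : a ≠ b) (hat : a ≠ t) (hbt : b ≠ t)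
    (x : W → Bool) (p q r : Bool) :
    (Gate.single t hadamard).op *ᵥ ket (setThree a b t x p q r) =
      (((√2 : ℝ) : ℂ)⁻¹) • ket (setThree a b t x p q false) +
        (((√2 : ℝ) : ℂ)⁻¹ * if r then -1 else 1) • ket (setThree a b t x p q true) := by
  rw [single_op_mulVec_ket, setThree_t hab hat hbt, update_setThree_t hab hat hbt,
    update_setThree_t hab hat hbt]
  simp [hadamard]

/-- Gates implementing the Toffoli gate with controls `a`, `b` and target `t`. -/
def toffoliGates (a b t : W) (hab : a ≠ b) (hat : a ≠ t) (hbt : b ≠ t) : List (Gate W) :=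
  [.single t hadamard] ++ cczGates a b t hab hat hbt ++ [.single t hadamard]

/-- Conjugation by a Hadamard gate turns `Z` on the target into `X`. Only three wires matter, so
eight assignments are checked. -/
theorem toffoliGates_mulVec_ket (a b t : W) (hab : a ≠ b) (hat : a ≠ t) (hbt : b ≠ t)
    (x : W → Bool) :
    gatesOp (toffoliGates a b t hab hat hbt) *ᵥ ket x =
      ket (Function.update x t (xor (x t) (x a && x b))) := by
  have hs := inv_sqrt_two_sq
  have key : ∀ p q r, gatesOp (toffoliGates a b t hab hat hbt) *ᵥ ket (setThree a b t x p q r) =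
      ket (setThree a b t x p q (xor r (p && q))) := by
    intro p q r
    simp only [toffoliGates, gatesOp_append, gatesOp_singleton, ← Matrix.mulVec_mulVec,
      hadamard_op_mulVec_ket a b t hab hat hbt, Matrix.mulVec_add, Matrix.mulVec_smul,
      cczGates_mulVec_ket, smul_smul, smul_add]
    ext y
    simp only [Pi.add_apply, Pi.smul_apply, smul_eq_mul]
    obtain ⟨k, hk⟩ : ∃ k : Bool → ℂ, ∀ r, ket (setThree a b t x p q r) y = k r :=
      ⟨_, fun _ => rfl⟩
    simp only [hk]
    cases p <;> cases q <;> cases r <;> simp <;>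
      first
        | linear_combination (2 * k false) * hs
        | linear_combination (2 * k true) * hs
  have h := key (x a) (x b) (x t)
  rw [setThree_self hab hat hbt] at h
  rw [h, ← update_setThree_t hab hat hbt x (x a) (x b) (x t), setThree_self hab hat hbt]

end SingleGates

/-! ### Circuits computing maps of basis states -/

section Computes

variable {W : Type} [Fintype W] [DecidableEq W]

/-- The map `f` of basis states is computed by a valid circuit of depth at most `D` on the wires
in `S`. -/
def Computes (D : ℕ) (S : Set W) (f : (W → Bool) → (W → Bool)) : Prop :=
  ∃ C : Circuit W, C.Valid ∧ C.length ≤ D ∧ C.Within S ∧ ∀ x, C.op *ᵥ ket x = ket (f x)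

theorem Computes.mono {D D' : ℕ} {S S' : Set W} {f : (W → Bool) → (W → Bool)}
    (h : Computes D S f) (hD : D ≤ D') (hS : S ⊆ S') : Computes D' S' f := by
  obtain ⟨C, h1, h2, h3, h4⟩ := h
  exact ⟨C, h1, h2.trans hD, h3.mono hS, h4⟩

theorem Computes.id (S : Set W) : Computes 0 S fun x => x :=
  ⟨[], Circuit.valid_nil, le_rfl, fun L hL => by simp at hL, fun x => by
    rw [Circuit.op_nil, Matrix.one_mulVec]⟩

theorem Computes.comp {D D' : ℕ} {S : Set W} {f g : (W → Bool) → (W → Bool)}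
    (hf : Computes D S f) (hg : Computes D' S g) : Computes (D + D') S fun x => g (f x) := by
  obtain ⟨C, h1, h2, h3, h4⟩ := hf
  obtain ⟨C', h1', h2', h3', h4'⟩ := hg
  refine ⟨C ++ C', h1.append h1', ?_, h3.append h3', fun x => ?_⟩
  · rw [List.length_append]
    omega
  · rw [Circuit.op_append, ← Matrix.mulVec_mulVec, h4, h4']

theorem Computes.congr {D : ℕ} {S : Set W} {f g : (W → Bool) → (W → Bool)}
    (h : Computes D S f) (hfg : ∀ x, f x = g x) : Computes D S g := by
  rwa [show g = f from funext fun x => (hfg x).symm]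

theorem computes_of_gates {S : Set W} {L : List (Gate W)} {f : (W → Bool) → (W → Bool)}
    (hS : ∀ g ∈ L, g.wires ⊆ S) (h : ∀ x, gatesOp L *ᵥ ket x = ket (f x)) :
    Computes L.length S f := by
  refine ⟨L.map fun g => [g], ?_, by simp, ?_, fun x => ?_⟩
  · intro L' hL'
    obtain ⟨g, -, rfl⟩ := List.mem_map.1 hL'
    simp
  · intro L' hL' g hg
    obtain ⟨g', hg', rfl⟩ := List.mem_map.1 hL'
    rw [List.mem_singleton] at hg
    subst hg
    exact hS g hg'
  · rw [Circuit.op_eq, ← h]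
    congr 2
    induction L with
    | nil => rfl
    | cons g L ih =>
      rw [List.map_cons, List.flatten_cons, List.singleton_append, List.cons.injEq]
      refine ⟨rfl, ?_⟩
      clear ih h hS
      induction L with
      | nil => rfl
      | cons g L ih => rw [List.map_cons, List.flatten_cons, List.singleton_append, ih]

theorem computes_x (w : W) : Computes 1 {w} (xMap w) := by
  refine computes_of_gates (L := [.single w pauliX]) ?_ fun x => ?_
  · simp [Gate.wires]
  · rw [gatesOp_singleton, pauliX_op_mulVec_ket]
    rfl

theorem computes_cnot {c t : W} (h : c ≠ t) :
    Computes 1 {c, t} fun x => Function.update x t (xor (x t) (x c)) := by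
  refine computes_of_gates (L := [.cnot c t h]) ?_ fun x => ?_
  · simp [Gate.wires]
  · rw [gatesOp_singleton, cnot_op_mulVec_ket]

/-- The depth is 14 gates for the doubly controlled `Z` plus two Hadamard gates, one gate per layer.
-/
theorem computes_toffoli {a b t : W} (hab : a ≠ b) (hat : a ≠ t) (hbt : b ≠ t) :
    Computes 16 {a, b, t} fun x => Function.update x t (xor (x t) (x a && x b)) := by
  refine computes_of_gates (L := toffoliGates a b t hab hat hbt) ?_ fun x =>
    toffoliGates_mulVec_ket a b t hab hat hbt x
  simp [toffoliGates, cczGates, Gate.wires, Set.insert_subset_iff]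

theorem computes_swap {a b : W} (h : a ≠ b) : Computes 3 {a, b} (swapMap a b) := by
  have h1 := computes_cnot h.symm
  have h2 := computes_cnot h
  rw [Set.pair_comm] at h1
  refine ((h1.comp h2).comp h1).congr fun x => ?_
  ext w
  simp only [swapMap, Function.comp_apply, Function.update_apply, Equiv.swap_apply_def]
  by_cases hwa : w = a
  · subst hwa
    simp [h, h.symm]
  · by_cases hwb : w = b
    · subst hwb
      simp [h.symm]
      cases x w <;> simp
    · simp [hwa, hwb]

/-- A swap consists of three CNOTs. It is enough to control the middle one, because without it the
outer two cancel; this gives depth `1 + 16 + 1`. -/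
theorem computes_cswap {c a b : W} (hab : a ≠ b) (hca : c ≠ a) (hcb : c ≠ b) :
    Computes 18 {c, a, b} (cswapMap c a b) := by
  have h1 : Computes 1 {c, a, b} _ :=
    (computes_cnot hab.symm).mono le_rfl (by simp [Set.insert_subset_iff])
  refine ((h1.comp (computes_toffoli hca hcb hab)).comp h1).congr fun x => ?_
  ext w
  simp only [cswapMap]
  cases hc : x c
  · by_cases hwa : w = a
    · subst hwa
      simp [hab, hab.symm, hca, hc]
    · by_cases hwb : w = b
      · subst hwb
        simp [hab, hab.symm, hca, hc]
      · simp [Function.update_apply, hwa, hwb]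
  · simp only [if_true, swapMap, Function.comp_apply, Equiv.swap_apply_def]
    by_cases hwa : w = a
    · subst hwa
      simp [hab, hab.symm, hca, hc]
    · by_cases hwb : w = b
      · subst hwb
        simp [hab, hab.symm, hca, hc]
        cases x w <;> simp
      · simp [Function.update_apply, hwa, hwb]

theorem runMaps_append (l l' : List ((W → Bool) → (W → Bool))) (x : W → Bool) :
    runMaps (l ++ l') x = runMaps l' (runMaps l x) := by
  simp [runMaps]

theorem runMaps_cons (f : (W → Bool) → (W → Bool)) (l : List ((W → Bool) → (W → Bool)))
    (x : W → Bool) : runMaps (f :: l) x = runMaps l (f x) := rfl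

theorem runMaps_flatMap {ι : Type} (l : List ι) (f : ι → List ((W → Bool) → (W → Bool)))
    (x : W → Bool) : runMaps (l.flatMap f) x = runMaps (l.map fun i => runMaps (f i)) x := by
  induction l generalizing x with
  | nil => rfl
  | cons i l ih => rw [List.flatMap_cons, runMaps_append, List.map_cons, runMaps_cons, ih]

theorem Computes.seq {ι : Type} {D : ℕ} {S : Set W} (l : List ι)
    {f : ι → (W → Bool) → (W → Bool)} (h : ∀ i ∈ l, Computes D S (f i)) :
    Computes (l.length * D) S (runMaps (l.map f)) := by
  induction l with
  | nil => exact ((Computes.id S).mono (Nat.zero_le _) subset_rfl).congr fun x => rfl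
  | cons i l ih =>
    refine ((h i List.mem_cons_self).comp
      (ih fun j hj => h j (List.mem_cons_of_mem _ hj))).mono ?_ subset_rfl
    rw [List.length_cons]
    linarith

/-- Maps with disjoint supports are computed in parallel. -/
theorem exists_par {ι : Type} {D : ℕ} (l : List ι) {S : ι → Set W}
    {f : ι → (W → Bool) → (W → Bool)} (h : ∀ i, Computes D (S i) (f i))
    (hd : l.Pairwise fun i j => Disjoint (S i) (S j)) :
    ∃ C : Circuit W, C.Valid ∧ C.length = D ∧ C.Within {w | ∃ i ∈ l, w ∈ S i} ∧
      ∀ x, C.op *ᵥ ket x = ket (runMaps (l.map f) x) := by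
  choose C hv hl hw hf using h
  refine ⟨parCirc D (l.map C), valid_parCirc (fun i _ => hw i) (fun i _ => hv i) hd, by simp,
    within_parCirc fun i _ => hw i, fun x => ?_⟩
  induction l generalizing x with
  | nil => simp [op_parCirc_nil, runMaps]
  | cons i l ih =>
    rw [List.pairwise_cons] at hd
    rw [List.map_cons, op_parCirc_cons (hw i) (hl i), ← Matrix.mulVec_mulVec, hf, ih hd.2,
      List.map_cons, runMaps_cons]
    intro C' hC'
    obtain ⟨j, hj, rfl⟩ := List.mem_map.1 hC'
    exact (hw j).mono fun w hw hw' => Set.disjoint_left.1 (hd.1 j hj) hw' hw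

theorem Computes.par {ι : Type} {D : ℕ} (l : List ι) {S : ι → Set W}
    {f : ι → (W → Bool) → (W → Bool)} (h : ∀ i, Computes D (S i) (f i))
    (hd : l.Pairwise fun i j => Disjoint (S i) (S j)) {S' : Set W} (hS : ∀ i ∈ l, S i ⊆ S') :
    Computes D S' (runMaps (l.map f)) := by
  obtain ⟨C, h1, h2, h3, h4⟩ := exists_par l h hd
  exact ⟨C, h1, h2.le, h3.mono fun w ⟨i, hi, hw⟩ => hS i hi hw, h4⟩

/-- Running maps `f i` that modify only `S i` and there depend only on `E i`, when no map
modifies what a later one depends on. -/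
theorem runMaps_apply {ι : Type} (l : List ι) {f : ι → (W → Bool) → (W → Bool)} {S E : ι → Set W}
    (hS : ∀ i x w, w ∉ S i → f i x w = x w)
    (hE : ∀ i x y, (∀ w ∈ E i, x w = y w) → ∀ w ∈ S i, f i x w = f i y w)
    (hd : l.Pairwise fun i j => Disjoint (S i) (S j) ∧ Disjoint (S i) (E j)) (x : W → Bool) :
    (∀ i ∈ l, ∀ w ∈ S i, runMaps (l.map f) x w = f i x w) ∧
      ∀ w, (∀ i ∈ l, w ∉ S i) → runMaps (l.map f) x w = x w := by
  induction l generalizing x with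
  | nil => simp [runMaps]
  | cons i l ih =>
    rw [List.pairwise_cons] at hd
    obtain ⟨ih1, ih2⟩ := ih hd.2 (f i x)
    simp only [List.map_cons, runMaps_cons]
    constructor
    · intro j hj w hw
      rcases List.mem_cons.1 hj with rfl | hj
      · rw [ih2]
        exact fun j' hj' hw' => Set.disjoint_left.1 (hd.1 j' hj').1 hw hw'
      · rw [ih1 j hj w hw]
        exact hE j _ _ (fun v hv => hS i x v fun hv' =>
          Set.disjoint_left.1 (hd.1 j hj).2 hv' hv) w hw
    · intro w hw
      rw [ih2 w fun j hj => hw j (List.mem_cons_of_mem _ hj), hS i x w (hw i List.mem_cons_self)]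

end Computes

/-! ### Levelled programs -/

section Programs

variable {W : Type} [Fintype W] [DecidableEq W]

/-- A Boolean function of at most two wires. -/
inductive Instr (W : Type) : Type
  | one : Instr W
  | copy (s : W) : Instr W
  | bin (s s' : W) (G : Bool → Bool → Bool) : Instr W

def Instr.reads : Instr W → Set W
  | .one => ∅
  | .copy s => {s}
  | .bin s s' _ => {s, s'}

def Instr.eval : Instr W → (W → Bool) → Bool
  | .one, _ => true
  | .copy s, x => x s
  | .bin s s' G, x => G (x s) (x s')

def Instr.WF : Instr W → Prop
  | .bin s s' _ => s ≠ s'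
  | _ => True

theorem Instr.eval_congr (i : Instr W) {x y : W → Bool} (h : ∀ w ∈ i.reads, x w = y w) :
    i.eval x = i.eval y := by
  cases i with
  | one => rfl
  | copy s => exact h s rfl
  | bin s s' G =>
    simp only [Instr.eval]
    rw [h s (by simp [Instr.reads]), h s' (by simp [Instr.reads])]

/-- The depth in which an instruction is carried out. -/
def instrDepth : ℕ := 19

theorem Computes.cond {D : ℕ} {S : Set W} {f : (W → Bool) → (W → Bool)} (h : Computes D S f)
    (b : Bool) : Computes D S fun x => if b then f x else x := by
  cases b
  · exact ((Computes.id S).mono (Nat.zero_le _) subset_rfl).congr fun x => by simp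
  · exact h.congr fun x => by simp

theorem computes_instr (i : Instr W) (hi : i.WF) {t : W} (ht : t ∉ i.reads) :
    Computes instrDepth (insert t i.reads) fun x =>
      Function.update x t (xor (x t) (i.eval x)) := by
  cases i with
  | one =>
    refine ((computes_x t).mono (by simp [instrDepth]) (by simp [Instr.reads])).congr fun x => ?_
    simp [xMap, Instr.eval]
  | copy s =>
    simp only [Instr.reads, Set.mem_singleton_iff] at ht
    refine ((computes_cnot (Ne.symm ht)).mono (by simp [instrDepth]) ?_).congr fun x => rfl
    simp [Instr.reads, Set.insert_subset_iff]
  | bin s s' G =>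
    simp only [Instr.reads, Set.mem_insert_iff, Set.mem_singleton_iff, not_or] at ht
    have hss : s ≠ s' := hi
    -- Algebraic normal form: over the field with two elements `G` is a constant plus multiples of
    -- `p`, of `q` and of `p q`. The four terms are an X, two CNOTs and a Toffoli gate, whose depths
    -- add up to `instrDepth = 1 + 1 + 1 + 16`.
    have h0 := (computes_x t).cond (G false false)
    have h1 := (computes_cnot (Ne.symm ht.1)).cond (xor (G true false) (G false false))
    have h2 := (computes_cnot (Ne.symm ht.2)).cond (xor (G false true) (G false false))
    have h3 := (computes_toffoli hss (Ne.symm ht.1) (Ne.symm ht.2)).cond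
      (xor (xor (G true true) (G true false)) (xor (G false true) (G false false)))
    have hS : ∀ {D : ℕ} {S : Set W} {f}, Computes D S f → S ⊆ {t, s, s'} →
        Computes D {t, s, s'} f := fun h hS => h.mono le_rfl hS
    refine ((((hS h0 (by simp)).comp (hS h1 ?_)).comp (hS h2 ?_)).comp
      (hS h3 ?_)).congr fun x => ?_
    · simp [Set.insert_subset_iff]
    · simp [Set.insert_subset_iff]
    · simp [Set.insert_subset_iff]
    · have hst : s ≠ t := Ne.symm ht.1
      have hst' : s' ≠ t := Ne.symm ht.2
      ext w
      by_cases hw : w = t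
      · subst hw
        simp only [Instr.eval, xMap, Function.update_self]
        cases hs : x s <;> cases hs' : x s' <;> cases G false false <;> cases G false true <;>
          cases G true false <;> cases G true true <;> simp [hs, hs', hst, hst']
      · have key : ∀ (b : Bool) (y : W → Bool) (v : Bool),
            (if b then Function.update y t v else y) w = y w := by
          intro b y v
          split_ifs
          · exact Function.update_of_ne hw _ _
          · rfl
        simp only [xMap]
        rw [key, key, key, key, Function.update_of_ne hw]

/-- Instructions with targets `tgt`, sorted into levels. -/
structure Prog (W I : Type) where
  tgt : I → W
  ins : I → Instr W
  lev : I → ℕ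

variable {I : Type} [Fintype I]

/-- These conditions make execution level by level meaningful: reads refer to finished levels, and
the instructions of a level use disjoint wires, so that they run in parallel. -/
structure Prog.WF (P : Prog W I) (D : ℕ) : Prop where
  tgt_inj : Function.Injective P.tgt
  lev_lt : ∀ i, P.lev i < D
  ins_wf : ∀ i, (P.ins i).WF
  reads_lt : ∀ i j, P.tgt j ∈ (P.ins i).reads → P.lev j < P.lev i
  disj : ∀ i j, i ≠ j → P.lev i = P.lev j → Disjoint (P.ins i).reads (P.ins j).reads

theorem Prog.WF.exists_level {P : Prog W I} {D : ℕ} (h : P.WF D) (l : ℕ) :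
    ∃ C : Circuit W, C.Valid ∧ C.length = instrDepth ∧
      (∀ t w, C.Touches t w → ∃ i, P.lev i = l ∧ w ∈ insert (P.tgt i) (P.ins i).reads) ∧
      ∀ x X : W → Bool,
        (∀ i, P.lev i = l → X (P.tgt i) = xor (x (P.tgt i)) ((P.ins i).eval x)) →
        (∀ w, (∀ i, P.lev i = l → w ≠ P.tgt i) → X w = x w) →
        C.op *ᵥ ket x = ket X := by
  classical
  set L : List I := (Finset.univ.filter fun i => P.lev i = l).toList with hL
  have hmem : ∀ i, i ∈ L ↔ P.lev i = l := by simp [hL]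
  have hnot : ∀ i, P.tgt i ∉ (P.ins i).reads := fun i hi => lt_irrefl _ (h.reads_lt i i hi)
  have hne : ∀ i j, P.lev i = P.lev j → P.tgt i ∉ (P.ins j).reads := fun i j hij hi =>
    (h.reads_lt j i hi).ne hij
  have hd : L.Pairwise fun i j => i ≠ j := Finset.nodup_toList _
  obtain ⟨C, h1, h2, h3, h4⟩ := exists_par L (D := instrDepth)
    (S := fun i => insert (P.tgt i) (P.ins i).reads)
    (fun i => computes_instr (P.ins i) (h.ins_wf i) (hnot i)) (by
      refine List.Pairwise.imp_of_mem ?_ hd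
      intro i j hi hj hij
      have hl : P.lev i = P.lev j := by rw [(hmem i).1 hi, (hmem j).1 hj]
      rw [Set.disjoint_insert_left, Set.disjoint_insert_right]
      refine ⟨?_, hne j i hl.symm, h.disj i j hij hl⟩
      rw [Set.mem_insert_iff, not_or]
      exact ⟨fun e => hij (h.tgt_inj e), hne i j hl⟩)
  refine ⟨C, h1, h2, fun t w ht => ?_, fun x X hX1 hX2 => ?_⟩
  · obtain ⟨i, hi, hw⟩ := h3.touches ht
    exact ⟨i, (hmem i).1 hi, hw⟩
  · rw [h4]
    obtain ⟨r1, r2⟩ := runMaps_apply L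
      (f := fun i x => Function.update x (P.tgt i) (xor (x (P.tgt i)) ((P.ins i).eval x)))
      (S := fun i => {P.tgt i}) (E := fun i => insert (P.tgt i) (P.ins i).reads)
      (fun i x w hw => Function.update_of_ne hw _ _)
      (fun i x y hxy w hw => by
        rw [Set.mem_singleton_iff] at hw
        subst hw
        rw [Function.update_self, Function.update_self, hxy _ (Set.mem_insert _ _),
          (P.ins i).eval_congr fun v hv => hxy v (Set.mem_insert_of_mem _ hv)])
      (by
        refine List.Pairwise.imp_of_mem ?_ hd
        intro i j hi hj hij
        have hl : P.lev i = P.lev j := by rw [(hmem i).1 hi, (hmem j).1 hj]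
        have ht : P.tgt i ≠ P.tgt j := fun e => hij (h.tgt_inj e)
        rw [Set.disjoint_singleton_left, Set.disjoint_singleton_left, Set.mem_insert_iff, not_or,
          Set.mem_singleton_iff]
        exact ⟨ht, ht, hne i j hl⟩) x
    congr 1
    ext w
    by_cases hw : ∃ i, P.lev i = l ∧ w = P.tgt i
    · obtain ⟨i, hi, rfl⟩ := hw
      rw [r1 i ((hmem i).2 hi) _ rfl, Function.update_self, hX1 i hi]
    · push Not at hw
      rw [r2 w fun i hi => hw i ((hmem i).1 hi), hX2 w hw]

/-- A levelled program started with all targets in `false` computes the solution `X` of its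
equations. -/
theorem Prog.WF.exists_circuit {P : Prog W I} {D : ℕ} (h : P.WF D) :
    ∃ C : Circuit W, C.Valid ∧ C.length = D * instrDepth ∧
      C.Within {w | ∃ i, w ∈ insert (P.tgt i) (P.ins i).reads} ∧
      (∀ t i, C.Touches t (P.tgt i) → P.lev i * instrDepth ≤ t) ∧
      ∀ x X : W → Bool, (∀ i, x (P.tgt i) = false) →
        (∀ w, w ∉ Set.range P.tgt → X w = x w) →
        (∀ i, X (P.tgt i) = (P.ins i).eval X) → C.op *ᵥ ket x = ket X := by
  classical
  choose B hv hl ht hB using fun l => h.exists_level l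
  have hlen : ∀ n, ((List.range n).flatMap B).length = n * instrDepth := by
    intro n
    induction n with
    | zero => simp
    | succ n ih =>
      rw [List.range_succ, List.flatMap_append, List.length_append, ih]
      simp [hl, add_mul]
  have htouch : ∀ n t w, Circuit.Touches ((List.range n).flatMap B) t w →
      ∃ i, P.lev i * instrDepth ≤ t ∧ t < (P.lev i + 1) * instrDepth ∧
        w ∈ insert (P.tgt i) (P.ins i).reads := by
    intro n
    induction n with
    | zero =>
      intro t w h
      simpa using h.lt_length
    | succ n ih =>
      intro t w h
      rw [List.range_succ, List.flatMap_append] at h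
      rcases Circuit.touches_append h with h | ⟨h1, h2⟩
      · exact ih t w h
      · simp only [List.flatMap_cons, List.flatMap_nil, List.append_nil] at h2
        have h3 := h2.lt_length
        rw [hl] at h3
        obtain ⟨i, hi, hw⟩ := ht _ _ _ h2
        rw [hlen] at h1 h3
        refine ⟨i, by rw [hi]; exact h1, ?_, hw⟩
        rw [hi, add_mul]
        omega
  refine ⟨(List.range D).flatMap B, ?_, hlen D, ?_, ?_, ?_⟩
  · intro L hL
    obtain ⟨l, -, hL⟩ := List.mem_flatMap.1 hL
    exact hv l L hL
  · refine Circuit.within_of_touches fun t w hw => ?_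
    obtain ⟨i, -, -, hi⟩ := htouch D t w hw
    exact ⟨i, hi⟩
  · intro t i hi
    obtain ⟨j, hj, -, hij⟩ := htouch D t _ hi
    -- A target is touched by its own instruction or by a reader, and readers have higher levels.
    refine le_trans (Nat.mul_le_mul_right _ ?_) hj
    rcases Set.mem_insert_iff.1 hij with e | e
    · rw [h.tgt_inj e]
    · exact (h.reads_lt j i e).le
  · intro x X hx hX1 hX2
    -- After `n` levels exactly the targets of levels below `n` carry their final values. The reads
    -- of level `n` go to these targets or to wires that are no targets at all, and there the
    -- current state agrees with `X`.
    have key : ∀ n, Circuit.op ((List.range n).flatMap B) *ᵥ ket x =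
        ket fun w => if ∃ i, w = P.tgt i ∧ P.lev i < n then X w else x w := by
      intro n
      induction n with
      | zero => simp [Circuit.op_nil]
      | succ n ih =>
        rw [List.range_succ, List.flatMap_append, Circuit.op_append, ← Matrix.mulVec_mulVec, ih]
        simp only [List.flatMap_cons, List.flatMap_nil, List.append_nil]
        apply hB
        · intro i hi
          rw [if_pos ⟨i, rfl, by omega⟩, if_neg, hx, Bool.false_xor, hX2]
          · refine (P.ins i).eval_congr fun w hw => ?_
            by_cases hw' : w ∈ Set.range P.tgt
            · obtain ⟨j, rfl⟩ := hw'
              rw [if_pos ⟨j, rfl, by have := h.reads_lt i j hw; omega⟩]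
            · rw [if_neg, hX1 w hw']
              rintro ⟨j, rfl, -⟩
              exact hw' ⟨j, rfl⟩
          · rintro ⟨j, e, hj⟩
            rw [← h.tgt_inj e] at hj
            omega
        · intro w hw
          refine if_congr ⟨?_, ?_⟩ rfl rfl
          · rintro ⟨i, rfl, hi⟩
            exact ⟨i, rfl, by have : P.lev i ≠ n := fun e => hw i e rfl; omega⟩
          · rintro ⟨i, rfl, hi⟩
            exact ⟨i, rfl, by omega⟩
    rw [key D]
    congr 1
    ext w
    split_ifs with hw
    · rfl
    · rw [hX1 w]
      rintro ⟨i, rfl⟩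
      exact hw ⟨i, rfl, h.lev_lt i⟩

end Programs

/-! ### Paths in the binary tree -/

section Paths

variable {k : ℕ}

/-- The number with binary digits `β 0, …, β (s - 1)`, most significant first. -/
def path (β : Fin k → Bool) : ℕ → ℕ
  | 0 => 0
  | s + 1 => 2 * path β s + if h : s < k then (β ⟨s, h⟩).toNat else 0

theorem path_lt (β : Fin k → Bool) (s : ℕ) : path β s < 2 ^ s := by
  induction s with
  | zero => simp [path]
  | succ s ih =>
    rw [path, pow_succ]
    split_ifs with h
    · have := Bool.toNat_le (β ⟨s, h⟩)
      omega
    · omega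

theorem path_succ (β : Fin k → Bool) (s : Fin k) :
    path β (s + 1) = 2 * path β s + (β s).toNat := by
  rw [path, dif_pos s.2]

/-- The node of the part `s` of the tree selected by the bits `β`. -/
def pathFin (β : Fin k → Bool) (s : ℕ) : Fin (2 ^ s) := ⟨path β s, path_lt β s⟩

theorem path_eq_sum (β : Fin k → Bool) (s : ℕ) (hs : s ≤ k) :
    path β s = ∑ q : Fin s, (β ⟨q, q.2.trans_le hs⟩).toNat * 2 ^ (s - 1 - (q : ℕ)) := by
  induction s with
  | zero => simp [path]
  | succ s ih =>
    rw [path, dif_pos (by omega), ih (by omega), Fin.sum_univ_castSucc, Finset.mul_sum]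
    congr 1
    · refine Finset.sum_congr rfl fun q _ => ?_
      have : s + 1 - 1 - (q : ℕ) = (s - 1 - (q : ℕ)) + 1 := by omega
      simp only [Fin.val_castSucc, this, pow_succ]
      ring
    · simp

/-- Exchanging `[0, 2 ^ t)` and `[2 ^ t, 2 ^ (t + 1))`. -/
def shiftFun (t j : ℕ) : ℕ :=
  if j < 2 ^ t then j + 2 ^ t else if j < 2 ^ (t + 1) then j - 2 ^ t else j

theorem shiftFun_shiftFun (t j : ℕ) : shiftFun t (shiftFun t j) = j := by
  have : 2 ^ (t + 1) = 2 * 2 ^ t := by rw [pow_succ]; ring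
  unfold shiftFun
  split_ifs <;> omega

theorem shiftFun_lt {s t j : ℕ} (ht : t < s) (hj : j < 2 ^ s) : shiftFun t j < 2 ^ s := by
  have h1 : 2 ^ (t + 1) ≤ 2 ^ s := Nat.pow_le_pow_right (by norm_num) ht
  have h2 : 2 ^ (t + 1) = 2 * 2 ^ t := by rw [pow_succ]; ring
  unfold shiftFun
  split_ifs <;> omega

/-- The permutation of the part `s` of a tree register effected by the swaps for the data
wire `q`. -/
def shiftPerm (s : ℕ) (q : Fin s) : Equiv.Perm (Fin (2 ^ s)) :=
  Function.Involutive.toPerm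
    (fun j => ⟨shiftFun (s - 1 - q) j, shiftFun_lt (by have := q.2; omega) j.2⟩)
    fun j => Fin.ext (shiftFun_shiftFun _ _)

def layerPerm (s : ℕ) (q : Fin s) (b : Bool) : Equiv.Perm (Fin (2 ^ s)) :=
  if b then shiftPerm s q else 1

theorem layerPerm_inv (s : ℕ) (q : Fin s) (b : Bool) : (layerPerm s q b)⁻¹ = layerPerm s q b := by
  cases b
  · simp [layerPerm]
  · simp only [layerPerm, if_true]
    rfl

/-- The permutation effected by all layers of swaps on the part `s`. -/
def netPerm (s : ℕ) (β : Fin s → Bool) : Equiv.Perm (Fin (2 ^ s)) :=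
  ((List.finRange s).map fun q => layerPerm s q (β q)).prod

theorem netPerm_inv (s : ℕ) (β : Fin s → Bool) :
    (netPerm s β)⁻¹ = ((List.finRange s).reverse.map fun q => layerPerm s q (β q)).prod := by
  rw [netPerm, List.prod_inv_reverse, List.map_map, List.map_reverse]
  simp only [Function.comp_def, layerPerm_inv]

/-- The product applies the last factor first, that is, the smallest shift. The second conjunct
keeps the partial sum inside the lower half of the next shift, so that each shift merely adds its
power of two. -/
theorem layers_prod_zero {s : ℕ} (β : Fin s → Bool) (l : List (Fin s)) (hl : l.Pairwise (· < ·)) :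
    (((l.map fun q => layerPerm s q (β q)).prod ⟨0, by positivity⟩ : Fin (2 ^ s)) : ℕ) =
      (l.map fun q => (β q).toNat * 2 ^ (s - 1 - (q : ℕ))).sum ∧
    ∀ q' : ℕ, (∀ q ∈ l, q' < (q : ℕ)) → q' < s →
      (l.map fun q => (β q).toNat * 2 ^ (s - 1 - (q : ℕ))).sum < 2 ^ (s - 1 - q') := by
  induction l with
  | nil => simp
  | cons q l ih =>
    rw [List.pairwise_cons] at hl
    obtain ⟨ih1, ih2⟩ := ih hl.2
    have hb := ih2 q (fun q' hq' => hl.1 q' hq') q.2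
    simp only [List.map_cons, List.prod_cons, List.sum_cons, Equiv.Perm.mul_apply]
    constructor
    · cases hq : β q
      · rw [show layerPerm s q false = 1 from rfl, Equiv.Perm.one_apply, ih1]
        simp
      · rw [layerPerm, if_pos rfl]
        change shiftFun _ _ = _
        rw [ih1, shiftFun, if_pos hb]
        simp [add_comm]
    · intro q' hq' hq's
      have h1 := hq' q List.mem_cons_self
      have h2 : 2 ^ (s - 1 - (q : ℕ) + 1) ≤ 2 ^ (s - 1 - q') :=
        Nat.pow_le_pow_right (by norm_num) (by have := q.2; omega)
      rw [pow_succ] at h2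
      have h3 := Nat.mul_le_mul_right (2 ^ (s - 1 - (q : ℕ))) (Bool.toNat_le (β q))
      omega

/-- This is why the swaps select a node: once they are done, position `0` holds the former content
of the node on the path. -/
theorem netPerm_zero (β : Fin k → Bool) (s : ℕ) (hs : s ≤ k) :
    netPerm s (fun q => β ⟨q, q.2.trans_le hs⟩) ⟨0, by positivity⟩ = pathFin β s := by
  apply Fin.ext
  rw [netPerm, (layers_prod_zero _ _ (List.pairwise_lt_finRange s)).1]
  change _ = path β s
  rw [path_eq_sum β s hs, Fin.sum_univ_def]

end Paths

/-! ### The subroutines SPF and FLAG in closed form -/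

section ClosedForms

variable {W : Type} [Fintype W] [DecidableEq W] {k : ℕ}

open Classical in
/-- Rearrange the part `s` of the register `a`. -/
def partMap (a : Node k → W) (s : Fin k) (π : Fin (2 ^ (s : ℕ)) → Fin (2 ^ (s : ℕ)))
    (x : W → Bool) : W → Bool :=
  fun w => if h : ∃ j, a ⟨s, j⟩ = w then x (a ⟨s, π h.choose⟩) else x w

variable {a : Node k → W}

theorem node_snd_injective (ha : Function.Injective a) {s : Fin k} {j j' : Fin (2 ^ (s : ℕ))}
    (h : a ⟨s, j⟩ = a ⟨s, j'⟩) : j = j' := by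
  simpa using ha h

theorem partMap_apply (ha : Function.Injective a) (s : Fin k) (π) (x : W → Bool)
    (j : Fin (2 ^ (s : ℕ))) : partMap a s π x (a ⟨s, j⟩) = x (a ⟨s, π j⟩) := by
  have h : ∃ j', a ⟨s, j'⟩ = a ⟨s, j⟩ := ⟨j, rfl⟩
  rw [partMap, dif_pos h, node_snd_injective ha h.choose_spec]

theorem partMap_of_ne (s : Fin k) (π) (x : W → Bool) {w : W} (hw : ∀ j, a ⟨s, j⟩ ≠ w) :
    partMap a s π x w = x w := by
  rw [partMap, dif_neg]
  push Not
  exact hw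

theorem eq_partMap (ha : Function.Injective a) {s : Fin k} {π} {x X : W → Bool}
    (h1 : ∀ j, X (a ⟨s, j⟩) = x (a ⟨s, π j⟩)) (h2 : ∀ w, (∀ j, a ⟨s, j⟩ ≠ w) → X w = x w) :
    X = partMap a s π x := by
  ext w
  by_cases hw : ∃ j, a ⟨s, j⟩ = w
  · obtain ⟨j, rfl⟩ := hw
    rw [h1, partMap_apply ha]
  · push Not at hw
    rw [h2 w hw, partMap_of_ne s π x hw]

/-- The wires exchanged by the `i`-th swap of the layer for `s` and `q`. -/
def swapLo (a : Node k → W) (s : Fin k) (q : Fin (s : ℕ))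
    (i : Fin (2 ^ ((s : ℕ) - 1 - (q : ℕ)))) : W :=
  a ⟨s, ⟨i, (Nat.le_add_right _ _).trans_lt (add_two_pow_lt q.2 i.2)⟩⟩

def swapHi (a : Node k → W) (s : Fin k) (q : Fin (s : ℕ))
    (i : Fin (2 ^ ((s : ℕ) - 1 - (q : ℕ)))) : W :=
  a ⟨s, ⟨i + 2 ^ ((s : ℕ) - 1 - q), add_two_pow_lt q.2 i.2⟩⟩

theorem swapLo_ne_swapHi (ha : Function.Injective a) {s : Fin k} {q : Fin (s : ℕ)} (i i') :
    swapLo a s q i ≠ swapHi a s q i' := by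
  intro h
  have h1 := congrArg Fin.val (node_snd_injective ha h)
  have := i.2
  simp only at h1
  omega

theorem swapLo_inj (ha : Function.Injective a) {s : Fin k} {q : Fin (s : ℕ)} {i i'}
    (h : swapLo a s q i = swapLo a s q i') : i = i' := by
  have h1 := congrArg Fin.val (node_snd_injective ha h)
  exact Fin.ext (by simpa using h1)

theorem swapHi_inj (ha : Function.Injective a) {s : Fin k} {q : Fin (s : ℕ)} {i i'}
    (h : swapHi a s q i = swapHi a s q i') : i = i' := by
  have h1 := congrArg Fin.val (node_snd_injective ha h)
  exact Fin.ext (by simpa using h1)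

/-- A layer of swaps with controls `c i`. -/
def swapLayer (a : Node k → W) (s : Fin k) (q : Fin (s : ℕ))
    (c : Fin (2 ^ ((s : ℕ) - 1 - (q : ℕ))) → W) : List ((W → Bool) → (W → Bool)) :=
  (List.finRange _).map fun i => cswapMap (c i) (swapLo a s q i) (swapHi a s q i)

theorem run_swapLayer (ha : Function.Injective a) (s : Fin k) (q : Fin (s : ℕ))
    (c : Fin (2 ^ ((s : ℕ) - 1 - (q : ℕ))) → W) (hc : ∀ i ν, c i ≠ a ν) (b : Bool)
    (x : W → Bool) (hb : ∀ i, x (c i) = b) :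
    runMaps (swapLayer a s q c) x = partMap a s (layerPerm s q b) x := by
  obtain ⟨r1, r2⟩ := runMaps_apply (List.finRange _)
    (f := fun i => cswapMap (c i) (swapLo a s q i) (swapHi a s q i))
    (S := fun i => {swapLo a s q i, swapHi a s q i})
    (E := fun i => {c i, swapLo a s q i, swapHi a s q i})
    (fun i x w hw => by
      simp only [Set.mem_insert_iff, Set.mem_singleton_iff, not_or] at hw
      simp only [cswapMap]
      split_ifs
      · simp [swapMap, Equiv.swap_apply_of_ne_of_ne hw.1 hw.2]
      · rfl)
    (fun i x y hxy w hw => by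
      simp only [Set.mem_insert_iff, Set.mem_singleton_iff, forall_eq_or_imp, forall_eq] at hxy hw
      simp only [cswapMap, hxy.1]
      rcases hw with rfl | rfl <;> split_ifs <;> simp [swapMap, hxy])
    (by
      refine List.Pairwise.imp ?_ (List.nodup_finRange _)
      intro i j hij
      have e1 : swapLo a s q i ≠ swapLo a s q j := fun h => hij (swapLo_inj ha h)
      have e2 : swapHi a s q i ≠ swapHi a s q j := fun h => hij (swapHi_inj ha h)
      have e3 := swapLo_ne_swapHi ha (s := s) (q := q) i j
      have e4 := (swapLo_ne_swapHi ha (s := s) (q := q) j i).symm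
      have e5 : c j ≠ swapLo a s q i := hc j _
      have e6 : c j ≠ swapHi a s q i := hc j _
      simp [Set.disjoint_left, *, Ne.symm e5, Ne.symm e6]) x
  refine eq_partMap ha (fun j => ?_) fun w hw => ?_
  · have hq : (s : ℕ) - 1 - (q : ℕ) < s := by have := q.2; omega
    have h2 : 2 ^ ((s : ℕ) - 1 - (q : ℕ) + 1) = 2 * 2 ^ ((s : ℕ) - 1 - (q : ℕ)) := by
      rw [pow_succ]; ring
    -- Positions below `2 ^ t` are the lower ends of swaps, those from there up to `2 ^ (t + 1)` the
    -- upper ends; the remaining positions are untouched.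
    by_cases hj : (j : ℕ) < 2 ^ ((s : ℕ) - 1 - (q : ℕ))
    · have e : a ⟨s, j⟩ = swapLo a s q ⟨j, hj⟩ := rfl
      rw [e, swapLayer, r1 ⟨j, hj⟩ (List.mem_finRange _) _ (by simp), cswapMap, hb]
      cases b
      · rfl
      · simp only [if_true, swapMap, Function.comp_apply, Equiv.swap_apply_left, layerPerm]
        have : shiftPerm s q j = ⟨j + 2 ^ ((s : ℕ) - 1 - (q : ℕ)), add_two_pow_lt q.2 hj⟩ := by
          apply Fin.ext
          change shiftFun _ _ = _
          rw [shiftFun, if_pos hj]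
        rw [this]
        rfl
    · by_cases hj2 : (j : ℕ) < 2 ^ ((s : ℕ) - 1 - (q : ℕ) + 1)
      · have hj3 : (j : ℕ) - 2 ^ ((s : ℕ) - 1 - (q : ℕ)) < 2 ^ ((s : ℕ) - 1 - (q : ℕ)) := by omega
        have e : a ⟨s, j⟩ = swapHi a s q ⟨j - 2 ^ ((s : ℕ) - 1 - (q : ℕ)), hj3⟩ := by
          rw [swapHi]
          congr 2
          apply Fin.ext
          simp only
          omega
        have hlo : a ⟨s, shiftPerm s q j⟩ =
            swapLo a s q ⟨j - 2 ^ ((s : ℕ) - 1 - (q : ℕ)), hj3⟩ := by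
          rw [swapLo]
          congr 2
          apply Fin.ext
          change shiftFun _ _ = _
          rw [shiftFun, if_neg hj, if_pos hj2]
        rw [e, swapLayer, r1 ⟨j - 2 ^ ((s : ℕ) - 1 - (q : ℕ)), hj3⟩ (List.mem_finRange _) _ (by simp),
          cswapMap, hb]
        cases b
        · rw [← e]
          rfl
        · simp only [if_true, swapMap, Function.comp_apply, Equiv.swap_apply_right, layerPerm]
          rw [hlo]
      · rw [swapLayer, r2]
        · cases b
          · rfl
          · simp only [if_true, layerPerm]
            congr 3
            apply Fin.ext
            change _ = shiftFun _ _
            rw [shiftFun, if_neg hj, if_neg hj2]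
        · intro i _
          have := i.2
          simp only [Set.mem_insert_iff, Set.mem_singleton_iff, not_or]
          constructor
          · intro h
            have h1 := congrArg Fin.val (node_snd_injective ha h)
            simp only at h1
            omega
          · intro h
            have h1 := congrArg Fin.val (node_snd_injective ha h)
            simp only at h1
            omega
  · rw [swapLayer, r2]
    intro i _
    simp only [Set.mem_insert_iff, Set.mem_singleton_iff, not_or]
    exact ⟨fun h => hw _ h.symm, fun h => hw _ h.symm⟩

/-- Since `partMap` reads the old state at the permuted position, the layer run first becomes the
leftmost factor. The layers alter only part `s`, so control values are preserved throughout. -/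
theorem run_layers (ha : Function.Injective a) (s : Fin k) (l : List (Fin (s : ℕ)))
    (L : Fin (s : ℕ) → (W → Bool) → (W → Bool)) (β : Fin (s : ℕ) → Bool) (x : W → Bool)
    (hL : ∀ q z, (∀ w, (∀ j, a ⟨s, j⟩ ≠ w) → z w = x w) →
      L q z = partMap a s (layerPerm s q (β q)) z) :
    runMaps (l.map L) x = partMap a s ((l.map fun q => layerPerm s q (β q)).prod) x := by
  have key : ∀ z, (∀ w, (∀ j, a ⟨s, j⟩ ≠ w) → z w = x w) → runMaps (l.map L) z =
      partMap a s ((l.map fun q => layerPerm s q (β q)).prod) z := by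
    induction l with
    | nil =>
      intro z hz
      exact eq_partMap ha (fun j => rfl) fun w _ => rfl
    | cons q l ih =>
      intro z hz
      rw [List.map_cons, runMaps_cons, hL q z hz, ih]
      · refine eq_partMap ha (fun j => ?_) fun w hw => ?_
        · rw [partMap_apply ha, partMap_apply ha, List.map_cons, List.prod_cons,
            Equiv.Perm.mul_apply]
        · rw [partMap_of_ne s _ _ hw, partMap_of_ne s _ _ hw]
      · intro w hw
        rw [partMap_of_ne s _ _ hw, hz w hw]
  exact key x fun w _ => rfl

/-- The data and tree wires are all distinct. -/
structure Layout (d : Fin k → W) (a : Node k → W) : Prop where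
  d_inj : Function.Injective d
  a_inj : Function.Injective a
  disj : ∀ i ν, d i ≠ a ν

variable {d : Fin k → W}

/-- The permutation of the part `s` effected by the controlled swaps. -/
def netOf (β : Fin k → Bool) (s : Fin k) : Equiv.Perm (Fin (2 ^ (s : ℕ))) :=
  netPerm s fun q => β ⟨q, q.2.trans s.2⟩

theorem netOf_zero (β : Fin k → Bool) (s : Fin k) :
    netOf β s ⟨0, by positivity⟩ = pathFin β s := netPerm_zero β s s.2.le

theorem netOf_congr {β β' : Fin k → Bool} {s : Fin k} (h : ∀ q : Fin k, q < s → β q = β' q) :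
    netOf β s = netOf β' s := by
  unfold netOf
  congr 1
  ext q
  exact h _ q.2

theorem run_csLayers (h : Layout d a) (s : Fin k) (x : W → Bool) :
    runMaps ((List.finRange (s : ℕ)).flatMap fun q => csLayer d a s q) x =
      partMap a s (netOf (fun i => x (d i)) s) x := by
  rw [runMaps_flatMap]
  refine run_layers h.a_inj s _ _ (fun q => x (d ⟨q, q.2.trans s.2⟩)) x fun q z hz => ?_
  refine run_swapLayer h.a_inj s q (fun _ => d ⟨q, q.2.trans s.2⟩) (fun _ ν => h.disj _ ν) _ z
    fun _ => hz _ fun j => (h.disj _ _).symm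

theorem run_csLayers_reverse (h : Layout d a) (s : Fin k) (x : W → Bool) :
    runMaps ((List.finRange (s : ℕ)).reverse.flatMap fun q => csLayer d a s q) x =
      partMap a s ((netOf (fun i => x (d i)) s)⁻¹ : Equiv.Perm _) x := by
  rw [runMaps_flatMap, netOf, netPerm_inv]
  refine run_layers h.a_inj s _ _ (fun q => x (d ⟨q, q.2.trans s.2⟩)) x fun q z hz => ?_
  refine run_swapLayer h.a_inj s q (fun _ => d ⟨q, q.2.trans s.2⟩) (fun _ ν => h.disj _ ν) _ z
    fun _ => hz _ fun j => (h.disj _ _).symm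

/-- Rearranging all parts one after the other. -/
theorem run_parts (ha : Function.Injective a) (l : List (Fin k)) (hl : l.Nodup)
    (hmem : ∀ s, s ∈ l) {f : Fin k → (W → Bool) → (W → Bool)}
    {π : ∀ s : Fin k, Equiv.Perm (Fin (2 ^ (s : ℕ)))} {x : W → Bool}
    (hf : ∀ s z, (∀ w, w ∉ Set.range a → z w = x w) → f s z = partMap a s (π s) z) :
    (∀ s j, runMaps (l.map f) x (a ⟨s, j⟩) = x (a ⟨s, π s j⟩)) ∧
      ∀ w, w ∉ Set.range a → runMaps (l.map f) x w = x w := by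
  have key : ∀ z, (∀ w, w ∉ Set.range a → z w = x w) →
      (∀ s j, runMaps (l.map f) z (a ⟨s, j⟩) = if s ∈ l then z (a ⟨s, π s j⟩) else z (a ⟨s, j⟩)) ∧
      ∀ w, w ∉ Set.range a → runMaps (l.map f) z w = z w := by
    clear hmem
    induction l with
    | nil => simp [runMaps]
    | cons s₀ l ih =>
      intro z hz
      rw [List.nodup_cons] at hl
      have hoff : ∀ w, w ∉ Set.range a → partMap a s₀ (π s₀) z w = z w := fun w hw =>
        partMap_of_ne s₀ _ _ fun j e => hw ⟨_, e⟩
      obtain ⟨h1, h2⟩ := ih hl.2 (partMap a s₀ (π s₀) z) fun w hw => by rw [hoff w hw, hz w hw]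
      rw [List.map_cons]
      simp only [runMaps_cons, hf s₀ z hz]
      refine ⟨fun s j => ?_, fun w hw => by rw [h2 w hw, hoff w hw]⟩
      rw [h1]
      by_cases hs : s = s₀
      · subst hs
        rw [if_neg hl.1, if_pos List.mem_cons_self, partMap_apply ha]
      · have hne : ∀ j j', a ⟨s₀, j'⟩ ≠ a ⟨s, j⟩ := fun j j' e =>
          hs (congrArg Sigma.fst (ha e)).symm
        rw [partMap_of_ne _ _ _ (hne _), partMap_of_ne _ _ _ (hne _)]
        simp [hs]
  obtain ⟨h1, h2⟩ := key x fun _ _ => rfl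
  exact ⟨fun s j => by rw [h1, if_pos (hmem s)], h2⟩

theorem notMem_range_tree (h : Layout d a) (i : Fin k) : d i ∉ Set.range a := by
  rintro ⟨ν, hν⟩
  exact h.disj i ν hν.symm

/-- The reversed controlled swaps of all parts. -/
theorem run_undo (h : Layout d a) (l : List (Fin k)) (hl : l.Nodup) (hmem : ∀ s, s ∈ l)
    (X : W → Bool) :
    (∀ s j, runMaps (l.map fun s : Fin k =>
        runMaps ((List.finRange (s : ℕ)).reverse.flatMap fun q => csLayer d a s q)) X (a ⟨s, j⟩) =
      X (a ⟨s, (netOf (fun i => X (d i)) s)⁻¹ j⟩)) ∧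
    ∀ w, w ∉ Set.range a → runMaps (l.map fun s : Fin k =>
        runMaps ((List.finRange (s : ℕ)).reverse.flatMap fun q => csLayer d a s q)) X w = X w := by
  refine run_parts h.a_inj l hl hmem (π := fun s => (netOf (fun i => X (d i)) s)⁻¹)
    fun s z hz => ?_
  rw [run_csLayers_reverse h]
  have e : netOf (fun i => z (d i)) s = netOf (fun i => X (d i)) s :=
    netOf_congr fun q _ => hz _ (notMem_range_tree h q)
  rw [e]

theorem run_xMaps (ha : Function.Injective a) (x : W → Bool) :
    (∀ s j, runMaps ((List.finRange k).map fun s : Fin k => xMap (a ⟨s, ⟨0, by positivity⟩⟩)) x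
        (a ⟨s, j⟩) = xor (x (a ⟨s, j⟩)) (decide ((j : ℕ) = 0))) ∧
      ∀ w, w ∉ Set.range a →
        runMaps ((List.finRange k).map fun s : Fin k => xMap (a ⟨s, ⟨0, by positivity⟩⟩)) x w =
          x w := by
  obtain ⟨r1, r2⟩ := runMaps_apply (List.finRange k)
    (f := fun s : Fin k => xMap (a ⟨s, ⟨0, by positivity⟩⟩))
    (S := fun s => {a ⟨s, ⟨0, by positivity⟩⟩}) (E := fun s => {a ⟨s, ⟨0, by positivity⟩⟩})
    (fun s x w hw => Function.update_of_ne hw _ _)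
    (fun s x y hxy w hw => by
      rw [Set.mem_singleton_iff] at hw
      subst hw
      simp only [xMap, Function.update_self]
      rw [hxy _ rfl])
    (by
      refine List.Pairwise.imp ?_ (List.nodup_finRange k)
      intro s s' hs
      have : a ⟨s, ⟨0, by positivity⟩⟩ ≠ a ⟨s', ⟨0, by positivity⟩⟩ := fun e =>
        hs (congrArg Sigma.fst (ha e))
      exact ⟨Set.disjoint_singleton.2 this, Set.disjoint_singleton.2 this⟩) x
  constructor
  · intro s j
    by_cases hj : (j : ℕ) = 0
    · have e : j = ⟨0, by positivity⟩ := Fin.ext hj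
      subst e
      rw [r1 s (List.mem_finRange s) _ rfl]
      simp [xMap]
    · rw [r2]
      · simp [hj]
      · intro s' _ e
        have e := ha e
        obtain ⟨rfl, e⟩ := Sigma.mk.inj_iff.1 e
        rw [heq_iff_eq] at e
        exact hj (by rw [e])
  · intro w hw
    refine r2 w fun s _ e => hw ⟨_, e.symm⟩

theorem flagMap_eq (d f : _) (x : W → Bool) : flagMap (k := k) d f x =
    runMaps ((List.finRange k).map fun s : Fin k =>
      runMaps ((List.finRange (s : ℕ)).reverse.flatMap fun q => csLayer d f s q))
      (runMaps ((List.finRange k).map fun s : Fin k => xMap (f ⟨s, ⟨0, by positivity⟩⟩)) x) := by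
  rw [flagMap, runMaps_append, runMaps_flatMap]

theorem flagMap_of_notMem (h : Layout d a) (x : W → Bool) {w : W} (hw : w ∉ Set.range a) :
    flagMap d a x w = x w := by
  have hr := run_undo h (List.finRange k) (List.nodup_finRange k) List.mem_finRange
  rw [flagMap_eq, (hr _).2 w hw, (run_xMaps h.a_inj x).2 w hw]

/-- The flip happens at position `0`, and the reversed layers carry it to the image of `0` under
`netOf`, which is the path. Flags already present are permuted along with it. -/
theorem flagMap_apply (h : Layout d a) (x : W → Bool) (s : Fin k) (j : Fin (2 ^ (s : ℕ))) :
    flagMap d a x (a ⟨s, j⟩) = xor (x (a ⟨s, (netOf (fun i => x (d i)) s)⁻¹ j⟩))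
      (decide (j = pathFin (fun i => x (d i)) s)) := by
  have hr := run_undo h (List.finRange k) (List.nodup_finRange k) List.mem_finRange
  have hd : ∀ i, runMaps ((List.finRange k).map fun s : Fin k => xMap (a ⟨s, ⟨0, by positivity⟩⟩)) x
      (d i) = x (d i) := fun i => (run_xMaps h.a_inj x).2 _ (notMem_range_tree h i)
  rw [flagMap_eq, (hr _).1]
  simp only [hd]
  rw [(run_xMaps h.a_inj x).1]
  congr 1
  rw [decide_eq_decide, ← netOf_zero, Equiv.Perm.inv_def, ← Equiv.symm_apply_eq, Fin.ext_iff]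

/-- `x` is obtained from `y` by exchanging each data wire `s` with the node of the part `s`
selected by the data wires of `y`. -/
structure Routed (d : Fin k → W) (a : Node k → W) (x y : W → Bool) : Prop where
  data : ∀ s : Fin k, x (d s) = y (a ⟨s, pathFin (fun i => y (d i)) s⟩)
  tree : ∀ (s : Fin k) (p : Fin (2 ^ (s : ℕ))),
    x (a ⟨s, p⟩) = if p = pathFin (fun i => y (d i)) s then y (d s) else y (a ⟨s, p⟩)
  off : ∀ w, w ∉ Set.range d → w ∉ Set.range a → x w = y w

open Classical in
theorem exists_routed (h : Layout d a) (y : W → Bool) : ∃ x, Routed d a x y := by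
  refine ⟨fun w => if hd : ∃ s, d s = w then
      y (a ⟨hd.choose, pathFin (fun i => y (d i)) hd.choose⟩)
    else if ha : ∃ ν, a ν = w then
      (if ha.choose.2 = pathFin (fun i => y (d i)) ha.choose.1 then y (d ha.choose.1) else y w)
    else y w, ?_, ?_, ?_⟩
  · intro s
    have hd : ∃ s', d s' = d s := ⟨s, rfl⟩
    simp only [dif_pos hd]
    rw [h.d_inj hd.choose_spec]
  · intro s p
    have hd : ¬ ∃ s', d s' = a ⟨s, p⟩ := fun ⟨s', e⟩ => h.disj _ _ e
    have ha : ∃ ν, a ν = a ⟨s, p⟩ := ⟨_, rfl⟩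
    simp only [dif_neg hd, dif_pos ha]
    rw [h.a_inj ha.choose_spec]
  · intro w hd ha
    simp only [Set.mem_range] at hd ha
    simp only [dif_neg hd, dif_neg ha]

theorem runMaps_finRange_induction {f : Fin k → (W → Bool) → (W → Bool)} {P : ℕ → (W → Bool) → Prop}
    {x : W → Bool} (h0 : P 0 x) (hs : ∀ (s : Fin k) z, P s z → P (s + 1) (f s z)) :
    P k (runMaps ((List.finRange k).map f) x) := by
  have key : ∀ n ≤ k, P n (runMaps (((List.finRange k).take n).map f) x) := by
    intro n
    induction n with
    | zero => exact fun _ => h0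
    | succ n ih =>
      intro hn
      have hn' : n < (List.finRange k).length := by simpa using hn
      rw [List.take_succ_eq_append_getElem hn', List.map_append, runMaps_append]
      have := hs ⟨n, hn⟩ _ (ih (by omega))
      simpa [runMaps] using this
  have := key k le_rfl
  rwa [List.take_of_length_le (by simp)] at this

theorem spfMap_eq (d a) (x : W → Bool) : spfMap (k := k) d a x =
    runMaps ((List.finRange k).reverse.map fun s : Fin k =>
      runMaps ((List.finRange (s : ℕ)).reverse.flatMap fun q => csLayer d a s q))
      (runMaps ((List.finRange k).map fun s : Fin k =>
        runMaps (((List.finRange (s : ℕ)).flatMap fun q => csLayer d a s q) ++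
          [swapMap (d s) (a ⟨s, ⟨0, by positivity⟩⟩)])) x) := by
  rw [spfMap, runMaps_append, runMaps_flatMap, runMaps_flatMap]

/-- SPF is best analysed from its output. Stage `s` is controlled by the data wires `q < s`, which
already hold their final values, so every permutation involved is determined by the data bits of
`y`. -/
theorem spfMap_of_routed (h : Layout d a) {x y : W → Bool} (hxy : Routed d a x y) :
    spfMap d a x = y := by
  set β : Fin k → Bool := fun i => y (d i) with hβ
  have hfwd := runMaps_finRange_induction (k := k) (x := x)
    (f := fun s : Fin k => runMaps (((List.finRange (s : ℕ)).flatMap fun q => csLayer d a s q) ++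
          [swapMap (d s) (a ⟨s, ⟨0, by positivity⟩⟩)]))
    -- Invariant: the stages below `n` have installed the final data bits, and their tree parts
    -- equal those of `y` up to the permutation that the closing swaps undo.
    (P := fun n z => (∀ s : Fin k, z (d s) = if (s : ℕ) < n then y (d s) else x (d s)) ∧
      (∀ (s : Fin k) j, z (a ⟨s, j⟩) =
        if (s : ℕ) < n then y (a ⟨s, netOf β s j⟩) else x (a ⟨s, j⟩)) ∧
      ∀ w, w ∉ Set.range d → w ∉ Set.range a → z w = x w)
    (by simp) (by
      rintro s z ⟨hz1, hz2, hz3⟩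
      have hnet : netOf (fun i => z (d i)) s = netOf β s := netOf_congr fun q hq => by
        rw [hz1, if_pos (show (q : ℕ) < s from hq)]
      rw [runMaps_append, run_csLayers h, hnet]
      simp only [runMaps, List.foldl_cons, List.foldl_nil, swapMap]
      have hd : ∀ i, partMap a s (netOf β s) z (d i) = z (d i) := fun i =>
        partMap_of_ne s _ _ fun j => (h.disj _ _).symm
      have hne : ∀ (i : Fin k) ν, ν ≠ (⟨s, ⟨0, by positivity⟩⟩ : Node k) →
          Equiv.swap (d s) (a ⟨s, ⟨0, by positivity⟩⟩) (a ν) = a ν := fun i ν hν =>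
        Equiv.swap_apply_of_ne_of_ne (h.disj _ _).symm fun e => hν (h.a_inj e)
      refine ⟨fun i => ?_, fun i j => ?_, fun w hw1 hw2 => ?_⟩
      · by_cases hi : i = s
        · subst hi
          rw [Function.comp_apply, Equiv.swap_apply_left, partMap_apply h.a_inj, netOf_zero, hz2,
            if_neg (lt_irrefl _), if_pos (Nat.lt_succ_self _), hxy.tree, if_pos rfl]
        · rw [Function.comp_apply, Equiv.swap_apply_of_ne_of_ne (fun e => hi (h.d_inj e))
            (h.disj _ _), hd, hz1]
          have : (i : ℕ) ≠ s := fun e => hi (Fin.ext e)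
          refine if_congr ?_ rfl rfl
          omega
      · rw [Function.comp_apply]
        by_cases hi : i = s
        · subst hi
          rw [if_pos (Nat.lt_succ_self _)]
          by_cases hj : j = ⟨0, by positivity⟩
          · subst hj
            rw [Equiv.swap_apply_right, hd, hz1, if_neg (lt_irrefl _), hxy.data, netOf_zero]
          · rw [hne i ⟨i, j⟩ (fun e => hj (by simpa using e)), partMap_apply h.a_inj, hz2,
              if_neg (lt_irrefl _), hxy.tree, if_neg]
            rw [← hβ, ← netOf_zero]
            exact fun e => hj ((netOf β i).injective e)
        · rw [hne s ⟨i, j⟩ (fun e => hi (congrArg Sigma.fst e)), partMap_of_ne, hz2]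
          · have : (i : ℕ) ≠ s := fun e => hi (Fin.ext e)
            refine if_congr ?_ rfl rfl
            omega
          · exact fun j' e => hi (congrArg Sigma.fst (h.a_inj e)).symm
      · rw [Function.comp_apply, Equiv.swap_apply_of_ne_of_ne (fun e => hw1 ⟨_, e.symm⟩)
          (fun e => hw2 ⟨_, e.symm⟩), partMap_of_ne, hz3 w hw1 hw2]
        exact fun j e => hw2 ⟨_, e⟩)
  obtain ⟨hz1, hz2, hz3⟩ := hfwd
  rw [spfMap_eq]
  set z := runMaps ((List.finRange k).map fun s : Fin k =>
        runMaps (((List.finRange (s : ℕ)).flatMap fun q => csLayer d a s q) ++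
          [swapMap (d s) (a ⟨s, ⟨0, by positivity⟩⟩)])) x
  obtain ⟨r1, r2⟩ := run_undo h (List.finRange k).reverse
    (List.nodup_reverse.2 (List.nodup_finRange k)) (fun s => by simp) z
  have hzβ : (fun i => z (d i)) = β := funext fun i => by rw [hz1, if_pos i.2]
  ext w
  by_cases hd : w ∈ Set.range d
  · obtain ⟨i, rfl⟩ := hd
    rw [r2 _ (notMem_range_tree h i), hz1, if_pos i.2]
  · by_cases ha : w ∈ Set.range a
    · obtain ⟨⟨s, p⟩, rfl⟩ := ha
      rw [r1]
      simp only [hzβ]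
      rw [hz2, if_pos s.2, Equiv.Perm.inv_def, Equiv.apply_symm_apply]
    · rw [r2 w ha, hz3 w hd ha, hxy.off w hd ha]

theorem spfMap_surjective (h : Layout d a) : Function.Surjective (spfMap d a) := fun y => by
  obtain ⟨x, hx⟩ := exists_routed h y
  exact ⟨x, spfMap_of_routed h hx⟩

theorem spfMap_injective (h : Layout d a) : Function.Injective (spfMap d a) :=
  Finite.injective_iff_surjective.2 (spfMap_surjective h)

/-- Every output has a routed preimage, so SPF is onto; on a finite set it is then bijective, and
the routed preimage is the given input. -/
theorem routed_spfMap (h : Layout d a) (x : W → Bool) : Routed d a x (spfMap d a x) := by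
  obtain ⟨x', hx'⟩ := exists_routed h (spfMap d a x)
  have e := spfMap_injective h (spfMap_of_routed h hx')
  subst e
  exact hx'

end ClosedForms

/-! ### Copying bits along binary trees -/

/-- `i` without its leading binary digit. -/
def dropTop (i : ℕ) : ℕ := i - 2 ^ (i.size - 1)

theorem dropTop_le (i : ℕ) : dropTop i ≤ i := Nat.sub_le _ _

theorem two_pow_size_le {i : ℕ} (hi : i ≠ 0) : 2 ^ (i.size - 1) ≤ i := by
  have h : 0 < i.size := Nat.size_pos.2 (Nat.pos_of_ne_zero hi)
  exact Nat.lt_size.1 (by omega)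

theorem size_dropTop_lt {i : ℕ} (hi : i ≠ 0) : (dropTop i).size < i.size := by
  have h : 0 < i.size := Nat.size_pos.2 (Nat.pos_of_ne_zero hi)
  have h1 := Nat.lt_size_self i
  have h2 : 2 ^ i.size = 2 * 2 ^ (i.size - 1) := by
    rw [← pow_succ', Nat.sub_add_cancel h]
  have h3 : (dropTop i).size ≤ i.size - 1 := Nat.size_le.2 (by unfold dropTop; omega)
  omega

/-- Copy `i` is made from copy `dropTop i` at the level given by the binary length of `i`.
Injectivity within one length means that no wire is read twice in a level, so the number of copies
doubles with every level. -/
theorem dropTop_inj {i j : ℕ} (hi : i ≠ 0) (hj : j ≠ 0) (hs : i.size = j.size)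
    (h : dropTop i = dropTop j) : i = j := by
  have h1 := two_pow_size_le hi
  have h2 := two_pow_size_le hj
  unfold dropTop at h
  rw [← hs] at h h2
  omega

/-! ### Circuits for SPF and FLAG -/

section TreeCircuits

variable {W : Type} [Fintype W] [DecidableEq W] {k : ℕ}

/-- The map `f` is computed on all basis states in which the wires in `Z` are `false`. -/
def ComputesFrom (D : ℕ) (S Z : Set W) (f : (W → Bool) → (W → Bool)) : Prop :=
  ∃ C : Circuit W, C.Valid ∧ C.length ≤ D ∧ C.Within S ∧
    ∀ x, (∀ w ∈ Z, x w = false) → C.op *ᵥ ket x = ket (f x)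

theorem Circuit.dagger_mulVec_of_mulVec {C : Circuit W} {φ χ : (W → Bool) → ℂ}
    (h : C.op *ᵥ φ = χ) : C.dagger.op *ᵥ χ = φ := by
  rw [← h, Circuit.op_dagger, Matrix.mulVec_mulVec, Circuit.conjTranspose_op_mul_op,
    Matrix.one_mulVec]

/-- A layer of instructions with distinct wires. -/
theorem exists_instrLayer {I : Type} [Fintype I] {tgt : I → W} {ins : I → Instr W}
    (hinj : Function.Injective tgt) (hwf : ∀ i, (ins i).WF) (hr : ∀ i j, tgt j ∉ (ins i).reads)
    (hd : ∀ i j, i ≠ j → Disjoint (ins i).reads (ins j).reads) :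
    ∃ C : Circuit W, C.Valid ∧ C.length = instrDepth ∧
      C.Within {w | ∃ i, w ∈ insert (tgt i) (ins i).reads} ∧
      ∀ x X : W → Bool, (∀ i, X (tgt i) = xor (x (tgt i)) ((ins i).eval x)) →
        (∀ w, w ∉ Set.range tgt → X w = x w) → C.op *ᵥ ket x = ket X := by
  have h : Prog.WF ⟨tgt, ins, fun _ => 0⟩ 1 :=
    ⟨hinj, fun _ => one_pos, hwf, fun i j hij => absurd hij (hr i j), fun i j hij _ => hd i j hij⟩
  obtain ⟨C, h1, h2, h3, h4⟩ := h.exists_level 0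
  refine ⟨C, h1, h2, Circuit.within_of_touches fun t w ht => ?_, fun x X hX1 hX2 => ?_⟩
  · obtain ⟨i, -, hi⟩ := h3 t w ht
    exact ⟨i, hi⟩
  · exact h4 x X (fun i _ => hX1 i) fun w hw => hX2 w fun ⟨i, hi⟩ => hw i rfl hi.symm

theorem exists_cnotLayer {I : Type} [Fintype I] {src tgt : I → W}
    (hs : Function.Injective src) (ht : Function.Injective tgt) (hst : ∀ i j, src i ≠ tgt j) :
    ∃ C : Circuit W, C.Valid ∧ C.length = instrDepth ∧
      C.Within (Set.range src ∪ Set.range tgt) ∧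
      ∀ x X : W → Bool, (∀ i, X (tgt i) = xor (x (tgt i)) (x (src i))) →
        (∀ w, w ∉ Set.range tgt → X w = x w) → C.op *ᵥ ket x = ket X := by
  obtain ⟨C, h1, h2, h3, h4⟩ := exists_instrLayer (tgt := tgt) (ins := fun i => .copy (src i)) ht
    (fun _ => trivial) (fun i j h => hst i j (by simpa [Instr.reads] using h.symm))
    (fun i j hij => by simpa [Instr.reads] using fun e => hij (hs e))
  refine ⟨C, h1, h2, h3.mono ?_, h4⟩
  rintro w ⟨i, hi⟩
  rcases hi with rfl | hi
  · exact Or.inr ⟨i, rfl⟩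
  · exact Or.inl ⟨i, hi.symm⟩

/-- The index set of the copies of data bits used as controls: for each `s` and `t < s` there are
`2 ^ t` copies of the bit `s - 1 - t`. -/
abbrev CopyIdx (k : ℕ) : Type := Σ s : Fin k, Node (s : ℕ)

def CopyIdx.bit (c : CopyIdx k) : Fin k :=
  ⟨(c.1 : ℕ) - 1 - (c.2.1 : ℕ), by have := c.1.2; omega⟩

/-- The copy of index `0` for part `s` is taken from the data wire at level `s`, so that different
parts never read a data wire simultaneously. The other copies follow after level `k` by repeated
doubling. -/
def copyProg (src : Fin k → W) (cp : CopyIdx k → W) : Prog W (CopyIdx k) where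
  tgt := cp
  ins c := if (c.2.2 : ℕ) = 0 then .copy (src c.bit) else
    .copy (cp ⟨c.1, ⟨c.2.1, ⟨dropTop c.2.2, (dropTop_le _).trans_lt c.2.2.2⟩⟩⟩)
  lev c := if (c.2.2 : ℕ) = 0 then c.1 else k + (c.2.2 : ℕ).size

theorem CopyIdx.ext_iff {c c' : CopyIdx k} : c = c' ↔
    (c.1 : ℕ) = c'.1 ∧ (c.2.1 : ℕ) = c'.2.1 ∧ (c.2.2 : ℕ) = c'.2.2 := by
  constructor
  · rintro rfl
    simp
  · obtain ⟨s, t, i⟩ := c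
    obtain ⟨s', t', i'⟩ := c'
    rintro ⟨h1, h2, h3⟩
    obtain rfl : s = s' := Fin.ext h1
    obtain rfl : t = t' := Fin.ext h2
    obtain rfl : i = i' := Fin.ext h3
    rfl

theorem copyProg_wf {src : Fin k → W} {cp : CopyIdx k → W} (hs : Function.Injective src)
    (hc : Function.Injective cp) (hsc : ∀ i c, src i ≠ cp c) :
    (copyProg src cp).WF (2 * k) where
  tgt_inj := hc
  lev_lt c := by
    have h1 := c.1.2
    have h2 := c.2.1.2
    have h3 : (c.2.2 : ℕ).size ≤ c.2.1 := Nat.size_le.2 c.2.2.2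
    simp only [copyProg]
    split_ifs <;> omega
  ins_wf c := by
    simp only [copyProg]
    split_ifs <;> trivial
  reads_lt c c' h := by
    simp only [copyProg] at h ⊢
    by_cases h0 : (c.2.2 : ℕ) = 0
    · rw [if_pos h0] at h
      exact absurd h.symm (hsc _ _)
    · rw [if_neg h0] at h
      have e := CopyIdx.ext_iff.1 (hc h)
      simp only at e
      have h1 := size_dropTop_lt h0
      rw [if_neg h0]
      rw [← e.2.2] at h1
      have h1 := c'.1.2
      split_ifs <;> omega
  disj c c' hne hl := by
    simp only [copyProg] at hl ⊢
    have b1 := c.1.2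
    have b2 := c'.1.2
    have b3 := c.2.1.2
    have b4 := c'.2.1.2
    by_cases h0 : (c.2.2 : ℕ) = 0 <;> by_cases h0' : (c'.2.2 : ℕ) = 0
    · rw [if_pos h0, if_pos h0'] at hl ⊢
      simp only [Instr.reads, Set.disjoint_singleton]
      intro e
      have e := congrArg Fin.val (hs e)
      simp only [CopyIdx.bit] at e
      refine hne (CopyIdx.ext_iff.2 ⟨hl, ?_, by rw [h0, h0']⟩)
      omega
    · rw [if_pos h0, if_neg h0'] at hl
      omega
    · rw [if_neg h0, if_pos h0'] at hl
      omega
    · rw [if_neg h0, if_neg h0'] at hl ⊢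
      simp only [Instr.reads, Set.disjoint_singleton]
      intro e
      have e := CopyIdx.ext_iff.1 (hc e)
      simp only at e
      exact hne (CopyIdx.ext_iff.2 ⟨e.1, e.2.1, dropTop_inj h0 h0' (by omega) e.2.2⟩)

theorem exists_copies {src : Fin k → W} {cp : CopyIdx k → W} (hs : Function.Injective src)
    (hc : Function.Injective cp) (hsc : ∀ i c, src i ≠ cp c) :
    ∃ C : Circuit W, C.Valid ∧ C.length = 2 * k * instrDepth ∧
      C.Within (Set.range src ∪ Set.range cp) ∧
      ∀ x, (∀ c, x (cp c) = false) →
        C.op *ᵥ ket x = ket (overwrite cp x fun c => x (src c.bit)) := by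
  obtain ⟨C, h1, h2, h3, -, h4⟩ := (copyProg_wf hs hc hsc).exists_circuit
  refine ⟨C, h1, h2, h3.mono ?_, fun x hx => h4 x _ hx (fun w hw => overwrite_of_notMem _ _ hw) ?_⟩
  · rintro w ⟨c, hw⟩
    simp only [copyProg] at hw
    rcases hw with rfl | hw
    · exact Or.inr ⟨c, rfl⟩
    · split_ifs at hw
      · exact Or.inl ⟨_, hw.symm⟩
      · exact Or.inr ⟨_, hw.symm⟩
  · intro c
    simp only [copyProg]
    rw [overwrite_apply hc]
    split_ifs
    · rw [Instr.eval, overwrite_of_notMem]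
      rintro ⟨c', h⟩
      exact hsc _ _ h.symm
    · rw [Instr.eval, overwrite_apply hc]
      rfl

/-- The layers of swaps of all parts in parallel, controlled by copies of the data bits. -/
def netMaps (a : Node k → W) (cp : CopyIdx k → W) (l : ∀ s : Fin k, List (Fin (s : ℕ))) :
    (W → Bool) → (W → Bool) :=
  runMaps ((List.finRange k).map fun s => runMaps ((l s).map fun q => runMaps
    (swapLayer a s q fun i => cp ⟨s, ⟨⟨(s : ℕ) - 1 - q, by have := q.2; omega⟩, i⟩⟩)))

theorem computes_netMaps {a : Node k → W} {cp : CopyIdx k → W} (ha : Function.Injective a)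
    (hc : Function.Injective cp) (hca : ∀ c ν, cp c ≠ a ν) (l : ∀ s : Fin k, List (Fin (s : ℕ)))
    (hl : ∀ s, (l s).length ≤ k) :
    Computes (k * 18) (Set.range a ∪ Set.range cp) (netMaps a cp l) := by
  refine Computes.par _ (S := fun s => (Set.range fun j => a ⟨s, j⟩) ∪ Set.range fun j => cp ⟨s, j⟩)
    (fun s => ?_) ?_ fun s _ => ?_
  · refine Computes.mono (Computes.seq (D := 18) (l s) fun q _ => ?_)
      (Nat.mul_le_mul_right _ (hl s)) subset_rfl
    refine Computes.par _ (S := fun i => {cp ⟨s, ⟨⟨(s : ℕ) - 1 - q, by have := q.2; omega⟩, i⟩⟩,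
      swapLo a s q i, swapHi a s q i}) (fun i => ?_) ?_ fun i _ => ?_
    · exact computes_cswap (swapLo_ne_swapHi ha i i) (hca _ _) (hca _ _)
    · refine List.Pairwise.imp ?_ (List.nodup_finRange _)
      intro i j hij
      have e1 : swapLo a s q i ≠ swapLo a s q j := fun h => hij (swapLo_inj ha h)
      have e2 : swapHi a s q i ≠ swapHi a s q j := fun h => hij (swapHi_inj ha h)
      have e3 := swapLo_ne_swapHi ha (s := s) (q := q) i j
      have e4 := (swapLo_ne_swapHi ha (s := s) (q := q) j i).symm
      have e5 : ∀ c i, cp c ≠ swapLo a s q i := fun _ _ => hca _ _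
      have e6 : ∀ c i, cp c ≠ swapHi a s q i := fun _ _ => hca _ _
      have e5' : ∀ c i, swapLo a s q i ≠ cp c := fun _ _ => (hca _ _).symm
      have e6' : ∀ c i, swapHi a s q i ≠ cp c := fun _ _ => (hca _ _).symm
      simp [Set.disjoint_left, e1, e2, e3, e4, e5, e6, e5', e6', hc.eq_iff, hij]
    · simp only [Set.insert_subset_iff, Set.singleton_subset_iff]
      exact ⟨Or.inr ⟨_, rfl⟩, Or.inl ⟨_, rfl⟩, Or.inl ⟨_, rfl⟩⟩
  · refine List.Pairwise.imp ?_ (List.nodup_finRange _)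
    intro s s' hs
    rw [Set.disjoint_left]
    rintro _ (⟨j, rfl⟩ | ⟨j, rfl⟩) (⟨j', h⟩ | ⟨j', h⟩)
    · exact hs (congrArg Sigma.fst (ha h)).symm
    · exact hca _ _ h
    · exact hca _ _ h.symm
    · exact hs (congrArg Sigma.fst (hc h)).symm
  · rintro _ (⟨j, rfl⟩ | ⟨j, rfl⟩)
    · exact Or.inl ⟨_, rfl⟩
    · exact Or.inr ⟨_, rfl⟩

theorem netMaps_apply {a : Node k → W} {cp : CopyIdx k → W} (ha : Function.Injective a)
    (hca : ∀ c ν, cp c ≠ a ν) (l : ∀ s : Fin k, List (Fin (s : ℕ))) (β : Fin k → Bool)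
    (x : W → Bool) (hx : ∀ c, x (cp c) = β c.bit) :
    (∀ s j, netMaps a cp l x (a ⟨s, j⟩) = x (a ⟨s, ((l s).map fun q =>
      layerPerm s q (β ⟨q, q.2.trans s.2⟩)).prod j⟩)) ∧
      ∀ w, w ∉ Set.range a → netMaps a cp l x w = x w := by
  have hcp : ∀ c, cp c ∉ Set.range a := by
    rintro c ⟨ν, hν⟩
    exact hca _ _ hν.symm
  refine run_parts ha (List.finRange k) (List.nodup_finRange k) List.mem_finRange
    fun s z hz => ?_
  refine run_layers ha s (l s) _ _ z fun q z' hz' => ?_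
  refine run_swapLayer ha s q _ (fun _ _ => hca _ _) _ z' fun i => ?_
  -- The layer for `q` is controlled by the copies with `t = s - 1 - q`, which carry bit `s - 1 - t
  -- = q`.
  rw [hz' _ fun j => (hca _ _).symm, hz _ (hcp _), hx, CopyIdx.bit]
  congr 2
  simp only
  have := q.2
  omega

theorem netMaps_forward {a : Node k → W} {cp : CopyIdx k → W} (ha : Function.Injective a)
    (hca : ∀ c ν, cp c ≠ a ν) (β : Fin k → Bool) (x : W → Bool) (hx : ∀ c, x (cp c) = β c.bit) :
    (∀ s j, netMaps a cp (fun s => List.finRange (s : ℕ)) x (a ⟨s, j⟩) =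
      x (a ⟨s, netOf β s j⟩)) ∧
      ∀ w, w ∉ Set.range a → netMaps a cp (fun s => List.finRange (s : ℕ)) x w = x w :=
  netMaps_apply ha hca _ β x hx

theorem netMaps_backward {a : Node k → W} {cp : CopyIdx k → W} (ha : Function.Injective a)
    (hca : ∀ c ν, cp c ≠ a ν) (β : Fin k → Bool) (x : W → Bool) (hx : ∀ c, x (cp c) = β c.bit) :
    (∀ s j, netMaps a cp (fun s => (List.finRange (s : ℕ)).reverse) x (a ⟨s, j⟩) =
      x (a ⟨s, (netOf β s)⁻¹ j⟩)) ∧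
      ∀ w, w ∉ Set.range a →
        netMaps a cp (fun s => (List.finRange (s : ℕ)).reverse) x w = x w := by
  have h := netMaps_apply ha hca (fun s => (List.finRange (s : ℕ)).reverse) β x hx
  simpa only [netOf, netPerm_inv] using h

theorem pow_pos_two (s : ℕ) : 0 < 2 ^ s := by positivity

/-- FLAG in linear depth. -/
theorem computesFrom_flagMap {d : Fin k → W} {f : Node k → W} (h : Layout d f)
    {cp : CopyIdx k → W} (hc : Function.Injective cp) (hcd : ∀ i c, d i ≠ cp c)
    (hcf : ∀ c ν, cp c ≠ f ν) :
    ComputesFrom (300 * (k + 1)) (Set.range d ∪ Set.range f ∪ Set.range cp) (Set.range cp)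
      (flagMap d f) := by
  obtain ⟨C1, v1, l1, w1, o1⟩ := exists_copies h.d_inj hc hcd
  obtain ⟨C2, v2, l2, w2, o2⟩ := exists_instrLayer (I := Fin k)
    (tgt := fun s => f ⟨s, ⟨0, pow_pos_two _⟩⟩) (ins := fun _ => .one)
    (fun s s' e => congrArg Sigma.fst (h.a_inj e)) (fun _ => trivial) (by simp [Instr.reads])
    (by simp [Instr.reads])
  obtain ⟨C3, v3, l3, w3, o3⟩ := computes_netMaps h.a_inj hc hcf
    (fun s => (List.finRange (s : ℕ)).reverse) (fun s => by simp)
  -- Copy the data bits, flip the top flags, move them in all parts at once, and remove the copies.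
  -- FLAG preserves the data bits, so the same copying circuit serves for the removal.
  refine ⟨C1 ++ (C2 ++ (C3 ++ C1.dagger)), v1.append (v2.append (v3.append v1.dagger)), ?_, ?_,
    fun x hx => ?_⟩
  · simp only [List.length_append, Circuit.length_dagger, l1, l2, instrDepth]
    omega
  · have e1 := w1.mono (S' := Set.range d ∪ Set.range f ∪ Set.range cp) (by
      rintro w (hw | hw)
      · exact Or.inl (Or.inl hw)
      · exact Or.inr hw)
    refine e1.append (Circuit.Within.append (w2.mono ?_) (Circuit.Within.append (w3.mono ?_)
      e1.dagger))
    · rintro w ⟨i, hw⟩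
      rcases hw with rfl | hw
      · exact Or.inl (Or.inr ⟨_, rfl⟩)
      · exact absurd hw (by simp [Instr.reads])
    · rintro w (hw | hw)
      · exact Or.inl (Or.inr hw)
      · exact Or.inr hw
  · have hx : ∀ c, x (cp c) = false := fun c => hx _ ⟨c, rfl⟩
    set β : Fin k → Bool := fun i => x (d i) with hβ
    set X := overwrite cp x fun c => x (d c.bit) with hX
    have hXc : ∀ c, X (cp c) = β c.bit := fun c => overwrite_apply hc _ _ _
    have hXo : ∀ w, w ∉ Set.range cp → X w = x w := fun w hw => overwrite_of_notMem _ _ hw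
    have hfc : ∀ ν, f ν ∉ Set.range cp := by
      rintro ν ⟨c, e⟩
      exact hcf _ _ e
    have hcf' : ∀ c, cp c ∉ Set.range f := by
      rintro c ⟨ν, e⟩
      exact hcf _ _ e.symm
    have hdc : ∀ i, d i ∉ Set.range cp := by
      rintro i ⟨c, e⟩
      exact hcd _ _ e.symm
    set Y := overwrite f X fun ν => xor (X (f ν)) (decide ((ν.2 : ℕ) = 0)) with hY
    have hYo : ∀ w, w ∉ Set.range f → Y w = X w := fun w hw => overwrite_of_notMem _ _ hw
    have hYf : ∀ ν, Y (f ν) = xor (X (f ν)) (decide ((ν.2 : ℕ) = 0)) := fun ν =>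
      overwrite_apply h.a_inj _ _ _
    have hn := netMaps_backward h.a_inj hcf β Y fun c => by rw [hYo _ (hcf' c), hXc]
    -- Removing the copies is justified backwards: copying from the desired final state yields the
    -- state reached after the swaps.
    have hy : C1.op *ᵥ ket (flagMap d f x) =
        ket (netMaps f cp (fun s => (List.finRange (s : ℕ)).reverse) Y) := by
      rw [o1 _ fun c => by rw [flagMap_of_notMem h x (hcf' c), hx]]
      congr 1
      ext w
      by_cases hw : w ∈ Set.range cp
      · obtain ⟨c, rfl⟩ := hw
        rw [overwrite_apply hc, hn.2 _ (hcf' c), hYo _ (hcf' c), hXc,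
          flagMap_of_notMem h x (notMem_range_tree h _)]
      · rw [overwrite_of_notMem _ _ hw]
        by_cases hwf : w ∈ Set.range f
        · obtain ⟨⟨s, j⟩, rfl⟩ := hwf
          rw [hn.1, hYf, hXo _ (hfc _), flagMap_apply h]
          congr 1
          rw [decide_eq_decide, ← netOf_zero, Equiv.Perm.inv_def, ← Equiv.symm_apply_eq,
            Fin.ext_iff]
        · rw [hn.2 w hwf, hYo w hwf, hXo w hw, flagMap_of_notMem h x hwf]
    rw [Circuit.op_append, Circuit.op_append, Circuit.op_append, ← Matrix.mulVec_mulVec,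
      ← Matrix.mulVec_mulVec, ← Matrix.mulVec_mulVec, o1 x hx, o2 X Y, o3]
    · exact Circuit.dagger_mulVec_of_mulVec hy
    · intro s
      rw [hYf]
      simp [Instr.eval]
    · intro w hw
      by_cases hwf : w ∈ Set.range f
      · obtain ⟨⟨s, j⟩, rfl⟩ := hwf
        rw [hYf]
        have : (j : ℕ) ≠ 0 := fun e => hw ⟨s, by
          simp only
          congr 2
          exact Fin.ext e.symm⟩
        simp [this]
      · exact hYo w hwf

end TreeCircuits

/-! ### SPF in linear depth -/

section SpfCircuit

/-- The index set of the parity trees: for each `s`, the nodes of a tree of depth `s`. -/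
abbrev ParIdx (k : ℕ) : Type := Σ s : Fin k, Node ((s : ℕ) + 1)

theorem ParIdx.ext_iff {k : ℕ} {c c' : ParIdx k} : c = c' ↔
    (c.1 : ℕ) = c'.1 ∧ (c.2.1 : ℕ) = c'.2.1 ∧ (c.2.2 : ℕ) = c'.2.2 := by
  constructor
  · rintro rfl
    simp
  · obtain ⟨s, t, i⟩ := c
    obtain ⟨s', t', i'⟩ := c'
    rintro ⟨h1, h2, h3⟩
    obtain rfl : s = s' := Fin.ext h1
    obtain rfl : t = t' := Fin.ext h2
    obtain rfl : i = i' := Fin.ext h3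
    rfl

theorem node_ext_iff {k : ℕ} {c c' : Node k} : c = c' ↔
    (c.1 : ℕ) = c'.1 ∧ (c.2 : ℕ) = c'.2 := by
  constructor
  · rintro rfl
    simp
  · obtain ⟨s, i⟩ := c
    obtain ⟨s', i'⟩ := c'
    rintro ⟨h1, h2⟩
    obtain rfl : s = s' := Fin.ext h1
    obtain rfl : i = i' := Fin.ext h2
    rfl

/-- Auxiliary wires of the circuit for SPF: one-hot encodings of the path, parity trees, the new
data bits and their copies. -/
inductive SpfAnc (k : ℕ) : Type
  | onehot (ν : Node k) : SpfAnc k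
  | par (c : ParIdx k) : SpfAnc k
  | reg (s : Fin k) : SpfAnc k
  | copy (c : CopyIdx k) : SpfAnc k
  deriving Fintype

variable {W : Type} [Fintype W] [DecidableEq W] {k : ℕ}

/-- The parent of a node of the tree. -/
def parent (ν : Node k) (h : (ν.1 : ℕ) ≠ 0) : Node k :=
  ⟨⟨(ν.1 : ℕ) - 1, by have := ν.1.2; omega⟩, ⟨(ν.2 : ℕ) / 2, by
    have h1 := ν.2.2
    have h2 : 2 ^ (ν.1 : ℕ) = 2 * 2 ^ ((ν.1 : ℕ) - 1) := by
      rw [← pow_succ', Nat.sub_add_cancel (Nat.pos_of_ne_zero h)]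
    simp only
    omega⟩⟩

def parChild (c : ParIdx k) (h : (c.2.1 : ℕ) < c.1) (b : Bool) : ParIdx k :=
  ⟨c.1, ⟨⟨(c.2.1 : ℕ) + 1, by omega⟩, ⟨2 * (c.2.2 : ℕ) + b.toNat, by
    have h1 := c.2.2.2
    have h2 := Bool.toNat_le b
    simp only [pow_succ]
    omega⟩⟩⟩

def parLeaf (c : ParIdx k) (h : ¬ (c.2.1 : ℕ) < c.1) : Node k :=
  ⟨c.1, ⟨c.2.2, c.2.2.2.trans_le (Nat.pow_le_pow_right (by norm_num)
    (by have := c.2.1.2; omega))⟩⟩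

/-- The program that follows the path prescribed by the tree register `a` and collects the bits
met on the path. -/
def walkProg (a : Node k → W) (ι : SpfAnc k → W) : Prog W (Node k ⊕ ParIdx k) where
  tgt := Sum.elim (fun ν => ι (.onehot ν)) fun c => ι (.par c)
  ins := Sum.elim
    (fun ν => if h : (ν.1 : ℕ) = 0 then .one else
      .bin (ι (.onehot (parent ν h))) (a (parent ν h))
        fun u v => u && (v == decide ((ν.2 : ℕ) % 2 = 1)))
    (fun c => if h : (c.2.1 : ℕ) < c.1 then
      .bin (ι (.par (parChild c h false))) (ι (.par (parChild c h true))) xor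
      else .bin (ι (.onehot (parLeaf c h))) (a (parLeaf c h)) and)
  -- Siblings read the same parent, so each depth of the walk takes two levels, chosen by the parity
  -- of the index. The parity trees then run from the leaves `t = s` up to the root `t = 0`.
  lev := Sum.elim (fun ν => 2 * (ν.1 : ℕ) + (ν.2 : ℕ) % 2)
    fun c => 2 * k + ((c.1 : ℕ) - (c.2.1 : ℕ))

variable {a : Node k → W} {ι : SpfAnc k → W}

theorem walkProg_wf (ha : Function.Injective a) (hι : Function.Injective ι)
    (hai : ∀ ν c, a ν ≠ ι c) : (walkProg a ι).WF (3 * k) where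
  tgt_inj := by
    rintro (ν | c) (ν' | c') h
    · simpa [walkProg] using hι h
    · simpa using hι h
    · simpa using hι h
    · simpa [walkProg] using hι h
  lev_lt := by
    rintro (ν | c)
    · have := ν.1.2
      simp only [walkProg, Sum.elim_inl]
      omega
    · have := c.1.2
      simp only [walkProg, Sum.elim_inr]
      omega
  ins_wf := by
    rintro (ν | c)
    · simp only [walkProg, Sum.elim_inl]
      split_ifs
      · trivial
      · exact (hai _ _).symm
    · simp only [walkProg, Sum.elim_inr]
      split_ifs
      · intro e
        have e := hι e
        simp [parChild] at e
      · exact (hai _ _).symm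
  reads_lt := by
    rintro (ν | c) (ν' | c') h <;> simp only [walkProg, Sum.elim_inl, Sum.elim_inr] at h ⊢
    · split_ifs at h with h0
      · simp [Instr.reads] at h
      · simp only [Instr.reads, Set.mem_insert_iff, Set.mem_singleton_iff, hι.eq_iff,
          (hai _ _).symm, or_false, SpfAnc.onehot.injEq] at h
        rw [h]
        simp only [parent]
        omega
    · split_ifs at h with h0
      · simp [Instr.reads] at h
      · simp [Instr.reads, hι.eq_iff, (hai _ _).symm] at h
    · have := ν'.1.2
      omega
    · split_ifs at h with h0
      · simp only [Instr.reads, Set.mem_insert_iff, Set.mem_singleton_iff, hι.eq_iff,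
          SpfAnc.par.injEq] at h
        rcases h with rfl | rfl <;> simp only [parChild] <;> omega
      · simp [Instr.reads, hι.eq_iff, (hai _ _).symm] at h
  disj := by
    rintro (ν | c) (ν' | c') hne hl <;> simp only [walkProg, Sum.elim_inl, Sum.elim_inr] at hl ⊢
    · have hne : ν ≠ ν' := fun e => hne (by rw [e])
      by_cases h0 : (ν.1 : ℕ) = 0
      · simp [h0, Instr.reads]
      by_cases h0' : (ν'.1 : ℕ) = 0
      · simp [h0', Instr.reads]
      · rw [dif_neg h0, dif_neg h0']
        have hp : parent ν h0 ≠ parent ν' h0' := by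
          intro e
          have e := node_ext_iff.1 e
          simp only [parent] at e
          exact hne (node_ext_iff.2 ⟨by omega, by omega⟩)
        simp [Instr.reads, hι.eq_iff, ha.eq_iff, hai, (hai _ _).symm, Ne.symm hp]
    · have := ν.1.2
      omega
    · have := ν'.1.2
      omega
    · have hne : c ≠ c' := fun e => hne (by rw [e])
      have hb := c.2.1.2
      have hb' := c'.2.1.2
      split_ifs with h0 h0'
      · have hp : ∀ b b', parChild c h0 b ≠ parChild c' h0' b' := by
          intro b b' e
          have e := ParIdx.ext_iff.1 e
          have := Bool.toNat_le b
          have := Bool.toNat_le b'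
          simp only [parChild] at e
          exact hne (ParIdx.ext_iff.2 ⟨by omega, by omega, by omega⟩)
        simp [Instr.reads, hι.eq_iff, Ne.symm (hp _ _)]
      · omega
      · omega
      · have hp : parLeaf c h0 ≠ parLeaf c' ‹_› := by
          intro e
          have e := node_ext_iff.1 e
          simp only [parLeaf] at e
          exact hne (ParIdx.ext_iff.2 ⟨by omega, by omega, by omega⟩)
        simp [Instr.reads, hι.eq_iff, ha.eq_iff, hai, (hai _ _).symm, Ne.symm hp]

/-- The values computed by `walkProg` when the path is `β`. -/
def walkVal (β : Fin k → Bool) : Node k ⊕ ParIdx k → Bool :=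
  Sum.elim (fun ν => decide ((ν.2 : ℕ) = path β ν.1))
    fun c => decide (path β c.1 / 2 ^ ((c.1 : ℕ) - (c.2.1 : ℕ)) = c.2.2) && β c.1

/-- The path is prescribed by the tree register alone: a node lies on it if and only if its parent
does and the bit at the parent selects it. In the parity tree for `s` only the leaf on the path can
be set, so every xor transports the single bit `β s` towards the root. -/
theorem exists_walk (ha : Function.Injective a) (hι : Function.Injective ι)
    (hai : ∀ ν c, a ν ≠ ι c) :
    ∃ C : Circuit W, C.Valid ∧ C.length = 3 * k * instrDepth ∧
      C.Within (Set.range a ∪ Set.range ι) ∧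
      ∀ (x : W → Bool) (β : Fin k → Bool), (∀ c, x ((walkProg a ι).tgt c) = false) →
        (∀ s : Fin k, x (a ⟨s, pathFin β s⟩) = β s) →
        C.op *ᵥ ket x = ket (overwrite (walkProg a ι).tgt x (walkVal β)) := by
  have hwf := walkProg_wf ha hι hai
  have hinj := hwf.tgt_inj
  obtain ⟨C, h1, h2, h3, -, h4⟩ := hwf.exists_circuit
  refine ⟨C, h1, h2, h3.mono ?_, fun x β hx hβ => h4 x _ hx
    (fun w hw => overwrite_of_notMem _ _ hw) ?_⟩
  · rintro w ⟨ν | c, hw⟩ <;> simp only [walkProg, Sum.elim_inl, Sum.elim_inr] at hw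
    · rcases hw with rfl | hw
      · exact Or.inr ⟨_, rfl⟩
      · split_ifs at hw
        · simp [Instr.reads] at hw
        · rcases hw with rfl | rfl
          · exact Or.inr ⟨_, rfl⟩
          · exact Or.inl ⟨_, rfl⟩
    · rcases hw with rfl | hw
      · exact Or.inr ⟨_, rfl⟩
      · split_ifs at hw
        · rcases hw with rfl | rfl <;> exact Or.inr ⟨_, rfl⟩
        · rcases hw with rfl | rfl
          · exact Or.inr ⟨_, rfl⟩
          · exact Or.inl ⟨_, rfl⟩
  · have va : ∀ ν, overwrite (walkProg a ι).tgt x (walkVal β) (a ν) = x (a ν) := fun ν => by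
      refine overwrite_of_notMem _ _ ?_
      rintro ⟨ν' | c, e⟩
      · exact hai _ _ e.symm
      · exact hai _ _ e.symm
    have ve : ∀ ν, overwrite (walkProg a ι).tgt x (walkVal β) (ι (.onehot ν)) =
        walkVal β (Sum.inl ν) := fun ν => overwrite_apply hinj x (walkVal β) (Sum.inl ν)
    have vp : ∀ c, overwrite (walkProg a ι).tgt x (walkVal β) (ι (.par c)) =
        walkVal β (Sum.inr c) := fun c => overwrite_apply hinj x (walkVal β) (Sum.inr c)
    rintro (ν | c)
    · rw [overwrite_apply hinj]
      simp only [walkProg, Sum.elim_inl]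
      split_ifs with h0
      · have h1 := ν.2.2
        have h2 : 2 ^ (ν.1 : ℕ) = 1 := by rw [h0, pow_zero]
        have h3 : path β ν.1 < 2 ^ (ν.1 : ℕ) := path_lt β ν.1
        simp only [walkVal, Sum.elim_inl, Instr.eval, decide_eq_true_eq]
        omega
      · simp only [Instr.eval]
        have e1 := ve (parent ν h0)
        have e2 := va (parent ν h0)
        simp only [walkProg] at e1 e2
        rw [e1, e2]
        simp only [walkVal, Sum.elim_inl]
        have hs : path β ν.1 = 2 * path β ((ν.1 : ℕ) - 1) +
            (β ⟨(ν.1 : ℕ) - 1, by have := ν.1.2; omega⟩).toNat := by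
          have h := path_succ β ⟨(ν.1 : ℕ) - 1, by have := ν.1.2; omega⟩
          simp only at h
          rw [← h, Nat.sub_add_cancel (Nat.pos_of_ne_zero h0)]
        by_cases hp : (ν.2 : ℕ) / 2 = path β ((ν.1 : ℕ) - 1)
        · have e3 : x (a (parent ν h0)) = β ⟨(ν.1 : ℕ) - 1, by have := ν.1.2; omega⟩ := by
            rw [← hβ]
            congr 2
            exact node_ext_iff.2 ⟨rfl, hp⟩
          rw [e3]
          have e4 : (((parent ν h0).2 : ℕ) = path β (parent ν h0).1) := hp
          rw [hs]
          simp only [e4, decide_true, Bool.true_and]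
          cases hb : β ⟨(ν.1 : ℕ) - 1, by have := ν.1.2; omega⟩ <;>
            by_cases hm : (ν.2 : ℕ) % 2 = 1 <;> simp [hm] <;> omega
        · have e4 : ¬ (((parent ν h0).2 : ℕ) = path β (parent ν h0).1) := hp
          rw [hs]
          simp only [e4, decide_false, Bool.false_and, decide_eq_false_iff_not]
          have := Bool.toNat_le (β ⟨(ν.1 : ℕ) - 1, by have := ν.1.2; omega⟩)
          omega
    · rw [overwrite_apply hinj]
      simp only [walkProg, Sum.elim_inr]
      split_ifs with h0
      · simp only [Instr.eval]
        have e1 := vp (parChild c h0 false)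
        have e2 := vp (parChild c h0 true)
        simp only [walkProg] at e1 e2
        rw [e1, e2]
        simp only [walkVal, Sum.elim_inr, parChild]
        -- A subtree contains the selected leaf if and only if exactly one of its two halves does.
        have hs : (c.1 : ℕ) - (c.2.1 : ℕ) = (c.1 : ℕ) - ((c.2.1 : ℕ) + 1) + 1 := by omega
        rw [hs, pow_succ, ← Nat.div_div_eq_div_mul]
        set u := path β c.1 / 2 ^ ((c.1 : ℕ) - ((c.2.1 : ℕ) + 1))
        cases β c.1
        · simp
        · simp only [Bool.and_true, Bool.toNat_false, Bool.toNat_true, add_zero]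
          by_cases h1 : u = 2 * (c.2.2 : ℕ)
          · have h2 : u / 2 = c.2.2 := by omega
            have h3 : u ≠ 2 * (c.2.2 : ℕ) + 1 := by omega
            simp [h1]
          · by_cases h2 : u = 2 * (c.2.2 : ℕ) + 1
            · have h3 : u / 2 = c.2.2 := by omega
              rw [h3]
              simp [h2]
            · have h3 : u / 2 ≠ c.2.2 := by omega
              simp [h1, h2, h3]
      · simp only [Instr.eval]
        have e1 := ve (parLeaf c h0)
        have e2 := va (parLeaf c h0)
        simp only [walkProg] at e1 e2
        rw [e1, e2]
        have hc := c.2.1.2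
        have hs : (c.1 : ℕ) - (c.2.1 : ℕ) = 0 := by omega
        simp only [walkVal, Sum.elim_inr, Sum.elim_inl, parLeaf, hs, pow_zero, Nat.div_one]
        by_cases hp : path β c.1 = c.2.2
        · have e3 : x (a ⟨c.1, ⟨c.2.2, (parLeaf c h0).2.2⟩⟩) = β c.1 := by
            rw [← hβ]
            congr 2
            exact node_ext_iff.2 ⟨rfl, hp.symm⟩
          rw [e3]
          simp [hp]
        · have hp' : ¬ (c.2.2 : ℕ) = path β c.1 := fun e => hp e.symm
          simp [hp, hp']

/-- The root of the parity tree for `s`. -/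
def parRoot (s : Fin k) : ParIdx k := ⟨s, ⟨⟨0, by omega⟩, ⟨0, pow_pos_two _⟩⟩⟩

theorem walkVal_root (β : Fin k → Bool) (s : Fin k) : walkVal β (Sum.inr (parRoot s)) = β s := by
  change (decide (path β s / 2 ^ ((s : ℕ) - 0) = 0) && β s) = β s
  simp [path_lt β s]

/-- A circuit that computes the new data bits into a register. -/
theorem exists_pathBits (ha : Function.Injective a) (hι : Function.Injective ι)
    (hai : ∀ ν c, a ν ≠ ι c) :
    ∃ C : Circuit W, C.Valid ∧ C.length ≤ 114 * k + 19 ∧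
      C.Within (Set.range a ∪ Set.range ι) ∧
      ∀ (x : W → Bool) (β : Fin k → Bool), (∀ c, x (ι c) = false) →
        (∀ s : Fin k, x (a ⟨s, pathFin β s⟩) = β s) →
        C.op *ᵥ ket x = ket (overwrite (fun s => ι (.reg s)) x β) := by
  have hwf := walkProg_wf ha hι hai
  have hinj := hwf.tgt_inj
  obtain ⟨C1, v1, l1, w1, o1⟩ := exists_walk ha hι hai
  have hreg : Function.Injective fun s : Fin k => ι (.reg s) := fun s s' e => by
    simpa using hι e
  obtain ⟨C2, v2, l2, w2, o2⟩ := exists_cnotLayer (src := fun s => ι (.par (parRoot s)))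
    (tgt := fun s : Fin k => ι (.reg s))
    (fun s s' e => by
      have e := hι e
      simp only [SpfAnc.par.injEq] at e
      exact congrArg Sigma.fst e) hreg (fun s s' e => by simpa using hι e)
  -- Compute, copy the roots, uncompute. The walk does not involve the result register, so its
  -- inverse still clears the work wires.
  refine ⟨C1 ++ (C2 ++ C1.dagger), v1.append (v2.append v1.dagger), ?_,
    w1.append (Circuit.Within.append (w2.mono ?_) w1.dagger), fun x β hx hβ => ?_⟩
  · simp only [List.length_append, Circuit.length_dagger, l1, l2, instrDepth]
    omega
  · rintro w (⟨s, rfl⟩ | ⟨s, rfl⟩) <;> exact Or.inr ⟨_, rfl⟩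
  · have hrt : ∀ s : Fin k, ι (.reg s) ∉ Set.range (walkProg a ι).tgt := by
      rintro s ⟨ν | c, e⟩
      · simpa using hι e
      · simpa using hι e
    have htr : ∀ i, (walkProg a ι).tgt i ∉ Set.range fun s : Fin k => ι (.reg s) := by
      rintro i ⟨s, e⟩
      exact hrt s ⟨i, e.symm⟩
    have hai' : ∀ ν, a ν ∉ Set.range fun s : Fin k => ι (.reg s) := by
      rintro ν ⟨s, e⟩
      exact hai _ _ e.symm
    have ht0 : ∀ c, x ((walkProg a ι).tgt c) = false := by
      rintro (ν | c) <;> exact hx _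
    have hback := o1 (overwrite (fun s => ι (.reg s)) x β) β
      (fun c => by rw [overwrite_of_notMem _ _ (htr c), ht0])
      (fun s => by rw [overwrite_of_notMem _ _ (hai' _), hβ])
    rw [Circuit.op_append, Circuit.op_append, ← Matrix.mulVec_mulVec, ← Matrix.mulVec_mulVec,
      o1 x β ht0 hβ, o2 _ (overwrite (walkProg a ι).tgt (overwrite (fun s => ι (.reg s)) x β)
        (walkVal β))]
    · exact Circuit.dagger_mulVec_of_mulVec hback
    · intro s
      rw [overwrite_of_notMem _ _ (hrt s), overwrite_apply hreg, overwrite_of_notMem _ _ (hrt s),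
        hx, Bool.false_xor]
      exact ((overwrite_apply hinj x (walkVal β) (Sum.inr (parRoot s))).trans
        (walkVal_root β s)).symm
    · intro w hw
      by_cases hwt : w ∈ Set.range (walkProg a ι).tgt
      · obtain ⟨i, rfl⟩ := hwt
        rw [overwrite_apply hinj, overwrite_apply hinj]
      · rw [overwrite_of_notMem _ _ hwt, overwrite_of_notMem _ _ hwt, overwrite_of_notMem _ _ hw]

theorem computes_swaps {d : Fin k → W} (h : Layout d a) :
    Computes 3 (Set.range d ∪ Set.range a)
      (runMaps ((List.finRange k).map fun s => swapMap (d s) (a ⟨s, ⟨0, pow_pos_two _⟩⟩))) := by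
  refine Computes.par _ (S := fun s => {d s, a ⟨s, ⟨0, pow_pos_two _⟩⟩})
    (fun s => computes_swap (h.disj _ _)) ?_ fun s _ => ?_
  · refine List.Pairwise.imp ?_ (List.nodup_finRange _)
    intro s s' hs
    have e1 : a ⟨s, ⟨0, pow_pos_two _⟩⟩ ≠ a ⟨s', ⟨0, pow_pos_two _⟩⟩ := fun e =>
      hs (congrArg Sigma.fst (h.a_inj e))
    rw [Set.disjoint_left]
    rintro w (rfl | rfl) (e | e)
    · exact hs (h.d_inj e)
    · exact h.disj _ _ e
    · exact h.disj _ _ e.symm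
    · exact e1 e
  · rintro w (rfl | rfl)
    · exact Or.inl ⟨_, rfl⟩
    · exact Or.inr ⟨_, rfl⟩

theorem run_swaps {d : Fin k → W} (h : Layout d a) (x : W → Bool) :
    (∀ s, runMaps ((List.finRange k).map fun s => swapMap (d s) (a ⟨s, ⟨0, pow_pos_two _⟩⟩)) x
        (d s) = x (a ⟨s, ⟨0, pow_pos_two _⟩⟩)) ∧
      (∀ s j, runMaps ((List.finRange k).map fun s => swapMap (d s) (a ⟨s, ⟨0, pow_pos_two _⟩⟩)) x
        (a ⟨s, j⟩) = if (j : ℕ) = 0 then x (d s) else x (a ⟨s, j⟩)) ∧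
      ∀ w, w ∉ Set.range d → w ∉ Set.range a →
        runMaps ((List.finRange k).map fun s => swapMap (d s) (a ⟨s, ⟨0, pow_pos_two _⟩⟩)) x w =
          x w := by
  obtain ⟨r1, r2⟩ := runMaps_apply (List.finRange k)
    (f := fun s => swapMap (d s) (a ⟨s, ⟨0, pow_pos_two _⟩⟩))
    (S := fun s => {d s, a ⟨s, ⟨0, pow_pos_two _⟩⟩})
    (E := fun s => {d s, a ⟨s, ⟨0, pow_pos_two _⟩⟩})
    (fun s x w hw => by
      simp only [Set.mem_insert_iff, Set.mem_singleton_iff, not_or] at hw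
      rw [swapMap, Function.comp_apply, Equiv.swap_apply_of_ne_of_ne hw.1 hw.2])
    (fun s x y hxy w hw => by
      simp only [Set.mem_insert_iff, Set.mem_singleton_iff, forall_eq_or_imp, forall_eq] at hxy hw
      rcases hw with rfl | rfl
      · simp only [swapMap, Function.comp_apply, Equiv.swap_apply_left, hxy.2]
      · simp only [swapMap, Function.comp_apply, Equiv.swap_apply_right, hxy.1])
    (by
      refine List.Pairwise.imp ?_ (List.nodup_finRange _)
      intro s s' hs
      have e1 : a ⟨s, ⟨0, pow_pos_two _⟩⟩ ≠ a ⟨s', ⟨0, pow_pos_two _⟩⟩ := fun e =>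
        hs (congrArg Sigma.fst (h.a_inj e))
      have e : Disjoint ({d s, a ⟨s, ⟨0, pow_pos_two _⟩⟩} : Set W)
          {d s', a ⟨s', ⟨0, pow_pos_two _⟩⟩} := by
        rw [Set.disjoint_left]
        rintro w (rfl | rfl) (e | e)
        · exact hs (h.d_inj e)
        · exact h.disj _ _ e
        · exact h.disj _ _ e.symm
        · exact e1 e
      exact ⟨e, e⟩) x
  refine ⟨fun s => ?_, fun s j => ?_, fun w hw1 hw2 => ?_⟩
  · rw [r1 s (List.mem_finRange s) _ (by simp)]
    simp only [swapMap, Function.comp_apply, Equiv.swap_apply_left]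
  · split_ifs with hj
    · obtain rfl : j = ⟨0, pow_pos_two _⟩ := Fin.ext hj
      rw [r1 s (List.mem_finRange s) _ (by simp)]
      simp only [swapMap, Function.comp_apply, Equiv.swap_apply_right]
    · refine r2 _ fun s' _ => ?_
      rintro (e | e)
      · exact h.disj _ _ e.symm
      · obtain ⟨e1, e2⟩ := node_ext_iff.1 (h.a_inj e)
        exact hj e2
  · refine r2 _ fun s' _ => ?_
    rintro (e | e)
    · exact hw1 ⟨_, e.symm⟩
    · exact hw2 ⟨_, e.symm⟩

/-- SPF in linear depth. -/
theorem computesFrom_spfMap {d : Fin k → W} (h : Layout d a) (hι : Function.Injective ι)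
    (hdi : ∀ i c, d i ≠ ι c) (hai : ∀ ν c, a ν ≠ ι c) :
    ComputesFrom (300 * (k + 1)) (Set.range d ∪ Set.range a ∪ Set.range ι) (Set.range ι)
      (spfMap d a) := by
  have hreg : Function.Injective fun s : Fin k => ι (.reg s) := fun s s' e => by
    simpa using hι e
  have hcp : Function.Injective fun c : CopyIdx k => ι (.copy c) := fun s s' e => by
    simpa using hι e
  have hcr : ∀ (s : Fin k) (c : CopyIdx k), ι (.reg s) ≠ ι (.copy c) := fun s c e => by
    simpa using hι e
  obtain ⟨C1, v1, l1, w1, o1⟩ := exists_pathBits h.a_inj hι hai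
  obtain ⟨C2, v2, l2, w2, o2⟩ := exists_copies hreg hcp hcr
  obtain ⟨C3, v3, l3, w3, o3⟩ := computes_netMaps h.a_inj hcp (fun c ν => (hai ν _).symm)
    (fun s => List.finRange (s : ℕ)) (fun s => by simp)
  obtain ⟨C4, v4, l4, w4, o4⟩ := computes_swaps h
  obtain ⟨C5, v5, l5, w5, o5⟩ := computes_netMaps h.a_inj hcp (fun c ν => (hai ν _).symm)
    (fun s => (List.finRange (s : ℕ)).reverse) (fun s => by simp)
  obtain ⟨C6, v6, l6, w6, o6⟩ := exists_cnotLayer h.d_inj hreg (fun i j => hdi i _)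
  -- The final data bits are first computed from the tree register. Controlled by copies of them,
  -- the swaps of all parts run in parallel, followed by the exchange with the data wires and the
  -- reversed swaps. After that the data wires themselves hold these bits, so one layer of CNOTs
  -- clears the register.
  refine ⟨C1 ++ (C2 ++ (C3 ++ (C4 ++ (C5 ++ (C2.dagger ++ C6))))),
    v1.append (v2.append (v3.append (v4.append (v5.append (v2.dagger.append v6))))), ?_, ?_,
    fun x hx => ?_⟩
  · simp only [List.length_append, Circuit.length_dagger, l2, l6, instrDepth]
    omega
  · have e1 : C2.Within (Set.range d ∪ Set.range a ∪ Set.range ι) := w2.mono (by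
      rintro w (⟨s, rfl⟩ | ⟨s, rfl⟩) <;> exact Or.inr ⟨_, rfl⟩)
    have e2 : Set.range a ∪ Set.range (fun c : CopyIdx k => ι (.copy c)) ⊆
        Set.range d ∪ Set.range a ∪ Set.range ι := by
      rintro w (hw | ⟨s, rfl⟩)
      · exact Or.inl (Or.inr hw)
      · exact Or.inr ⟨_, rfl⟩
    refine Circuit.Within.append (w1.mono ?_) (e1.append ((w3.mono e2).append
      ((w4.mono ?_).append ((w5.mono e2).append (e1.dagger.append (w6.mono ?_))))))
    · rintro w (hw | hw)
      · exact Or.inl (Or.inr hw)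
      · exact Or.inr hw
    · exact fun w hw => Or.inl hw
    · rintro w (hw | ⟨s, rfl⟩)
      · exact Or.inl (Or.inl hw)
      · exact Or.inr ⟨_, rfl⟩
  · have hx : ∀ c, x (ι c) = false := fun c => hx _ ⟨c, rfl⟩
    set y := spfMap d a x with hy
    have hr : Routed d a x y := routed_spfMap h x
    set β : Fin k → Bool := fun i => y (d i) with hβ
    set reg : Fin k → W := fun s => ι (.reg s) with hreg'
    set cp : CopyIdx k → W := fun c => ι (.copy c) with hcp'
    have hιd : ∀ c, ι c ∉ Set.range d := by
      rintro c ⟨i, e⟩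
      exact hdi _ _ e
    have hιa : ∀ c, ι c ∉ Set.range a := by
      rintro c ⟨i, e⟩
      exact hai _ _ e
    have hdr : ∀ i, d i ∉ Set.range reg := by
      rintro i ⟨c, e⟩
      exact hdi _ _ e.symm
    have har : ∀ ν, a ν ∉ Set.range reg := by
      rintro ν ⟨c, e⟩
      exact hai _ _ e.symm
    have hdc : ∀ i, d i ∉ Set.range cp := by
      rintro i ⟨c, e⟩
      exact hdi _ _ e.symm
    have hac : ∀ ν, a ν ∉ Set.range cp := by
      rintro ν ⟨c, e⟩
      exact hai _ _ e.symm
    have hrc : ∀ s, reg s ∉ Set.range cp := by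
      rintro s ⟨c, e⟩
      exact hcr s c e.symm
    have hcr' : ∀ c, cp c ∉ Set.range reg := by
      rintro c ⟨s, e⟩
      exact hcr s c e
    have hyι : ∀ c, y (ι c) = false := fun c => by rw [← hr.off _ (hιd c) (hιa c), hx]
    set x1 := overwrite reg x β with hx1
    set x2 := overwrite cp x1 (fun c => x1 (reg c.bit)) with hx2
    have hx2c : ∀ c, x2 (cp c) = β c.bit := fun c => by
      rw [hx2, overwrite_apply hcp, hx1, overwrite_apply hreg]
    have h3 := netMaps_forward h.a_inj (fun c ν => (hai ν _).symm) β x2 hx2c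
    set x3 := netMaps a cp (fun s => List.finRange (s : ℕ)) x2 with hx3
    have h4 := run_swaps h x3
    set x4 := runMaps ((List.finRange k).map fun s =>
      swapMap (d s) (a ⟨s, ⟨0, pow_pos_two _⟩⟩)) x3 with hx4
    have hx4c : ∀ c, x4 (cp c) = β c.bit := fun c => by
      rw [h4.2.2 _ (hιd _) (hιa _), h3.2 _ (hιa _), hx2c]
    have h5 := netMaps_backward h.a_inj (fun c ν => (hai ν _).symm) β x4 hx4c
    set x5 := netMaps a cp (fun s => (List.finRange (s : ℕ)).reverse) x4 with hx5
    have hx2d : ∀ i, x2 (d i) = x (d i) := fun i => by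
      rw [hx2, overwrite_of_notMem _ _ (hdc i), hx1, overwrite_of_notMem _ _ (hdr i)]
    have hx2a : ∀ ν, x2 (a ν) = x (a ν) := fun ν => by
      rw [hx2, overwrite_of_notMem _ _ (hac ν), hx1, overwrite_of_notMem _ _ (har ν)]
    -- Copying out of the final state, with the register still holding `β`, reproduces `x5`. Hence
    -- the inverse copying circuit removes the copies.
    have hback : C2.op *ᵥ ket (overwrite reg y β) = ket x5 := by
      rw [o2 _ fun c => by rw [overwrite_of_notMem _ _ (hcr' c), hyι]]
      congr 1
      ext w
      by_cases hwc : w ∈ Set.range cp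
      · obtain ⟨c, rfl⟩ := hwc
        rw [overwrite_apply hcp, overwrite_apply hreg, h5.2 _ (hιa _), hx4c]
      · rw [overwrite_of_notMem _ _ hwc]
        by_cases hwa : w ∈ Set.range a
        · obtain ⟨⟨s, j⟩, rfl⟩ := hwa
          rw [overwrite_of_notMem _ _ (har _), h5.1, h4.2.1]
          have hj : ((((netOf β s)⁻¹ : Equiv.Perm _) j : Fin _) : ℕ) = 0 ↔ j = pathFin β s := by
            rw [← netOf_zero, Equiv.Perm.inv_def, ← Equiv.symm_apply_eq, Fin.ext_iff]
          split_ifs with h0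
          · rw [hj] at h0
            rw [h3.2 _ (notMem_range_tree h s), hx2d, hr.data, h0]
          · have h0' : j ≠ pathFin β s := fun e => h0 (hj.2 e)
            rw [h3.1, Equiv.Perm.inv_def, Equiv.apply_symm_apply, hx2a, hr.tree, if_neg h0']
        · rw [h5.2 w hwa]
          by_cases hwd : w ∈ Set.range d
          · obtain ⟨s, rfl⟩ := hwd
            rw [overwrite_of_notMem _ _ (hdr s), h4.1, h3.1, netOf_zero, hx2a, hr.tree, if_pos rfl]
          · rw [h4.2.2 w hwd hwa, h3.2 w hwa, hx2, overwrite_of_notMem _ _ hwc, hx1]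
            by_cases hwr : w ∈ Set.range reg
            · obtain ⟨s, rfl⟩ := hwr
              rw [overwrite_apply hreg, overwrite_apply hreg]
            · rw [overwrite_of_notMem _ _ hwr, overwrite_of_notMem _ _ hwr, hr.off w hwd hwa]
    simp only [Circuit.op_append, ← Matrix.mulVec_mulVec]
    rw [o1 x β hx (fun s => by rw [hr.tree, if_pos rfl]), o2 x1 (fun c => by
      rw [hx1, overwrite_of_notMem _ _ (hcr' c), hx]), o3, o4, o5,
      Circuit.dagger_mulVec_of_mulVec hback]
    refine o6 _ _ (fun s => ?_) fun w hw => ?_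
    · rw [overwrite_apply hreg, overwrite_of_notMem _ _ (hdr s), Bool.xor_self]
      exact hyι _
    · rw [overwrite_of_notMem _ _ hw]

end SpfCircuit

/-! ### Layers of one-qubit gates -/

section SingleLayers

variable {W : Type} [Fintype W] [DecidableEq W] {I : Type} [Fintype I]

theorem exists_singleLayer {z : I → W} (hz : Function.Injective z)
    (u : I → Matrix.unitaryGroup Bool ℂ) :
    ∃ C : Circuit W, C.Valid ∧ C.length = 1 ∧ C.Within (Set.range z) ∧
      C.op = parallelOp z fun _ i => (u i : Matrix Bool Bool ℂ) := by
  classical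
  have key : ∀ l : List I, l.Nodup → gatesOp (l.map fun i => Gate.single (z i) (u i)) =
      parallelOp z fun _ i => if i ∈ l then (u i : Matrix Bool Bool ℂ) else 1 := by
    intro l hl
    induction l with
    | nil => simp [parallelOp_one hz]
    | cons i l ih =>
      rw [List.nodup_cons] at hl
      have h1 : (Gate.single (z i) (u i)).op =
          parallelOp z fun _ j => if j = i then (u i : Matrix Bool Bool ℂ) else 1 := by
        ext y x
        simp only [Gate.op]
        by_cases h : ∀ w, w ∉ Set.range (fun _ : Unit => z i) → y w = x w
        · rw [parallelOp_apply_of h, parallelOp_apply_of fun w hw => h w fun ⟨_, e⟩ => hw ⟨i, e⟩,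
            Fintype.prod_eq_single i]
          · simp
          · intro j hj
            rw [if_neg hj, h, Matrix.one_apply_eq]
            exact fun ⟨_, e⟩ => hj (hz e.symm)
        · rw [parallelOp_apply_of_not h]
          by_contra hne
          by_cases h' : ∀ w, w ∉ Set.range z → y w = x w
          · rw [eq_comm, parallelOp_apply_of h', ← ne_eq, Finset.prod_ne_zero_iff] at hne
            refine h fun w hw => ?_
            by_cases hwz : w ∈ Set.range z
            · obtain ⟨j, rfl⟩ := hwz
              have hj := hne j (Finset.mem_univ _)
              rw [if_neg (fun e => hw ⟨(), by rw [e]⟩)] at hj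
              by_contra hc
              exact hj (Matrix.one_apply_ne hc)
            · exact h' w hwz
          · exact hne (parallelOp_apply_of_not h').symm
      rw [List.map_cons, gatesOp_cons, ih hl.2, h1, parallelOp_mul hz _ _ fun _ _ _ => rfl]
      refine parallelOp_congr fun x j => ?_
      by_cases hj : j = i
      · subst hj
        simp [hl.1]
      · simp [hj]
  refine ⟨[Finset.univ.toList.map fun i => Gate.single (z i) (u i)], ?_, rfl, ?_, ?_⟩
  · intro L hL
    rw [List.mem_singleton] at hL
    rw [hL, List.pairwise_map]
    refine List.Pairwise.imp ?_ (Finset.nodup_toList _)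
    intro i j hij
    simpa [Gate.wires] using fun e => hij (hz e)
  · intro L hL g hg
    rw [List.mem_singleton] at hL
    subst hL
    obtain ⟨i, -, rfl⟩ := List.mem_map.1 hg
    rintro w rfl
    exact ⟨i, rfl⟩
  · rw [Circuit.op_singleton, key _ (Finset.nodup_toList _)]
    simp

variable {V A : Type} [Fintype V] [DecidableEq V] [Fintype A] [DecidableEq A]

theorem block_singleLayer {z : I → V} (hz : Function.Injective z)
    (u : I → Matrix.unitaryGroup Bool ℂ) :
    ∃ C : Circuit (V ⊕ A), Block C (parallelOp z fun _ i => (u i : Matrix Bool Bool ℂ)) 1 0 := by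
  classical
  have hz' : Function.Injective (Sum.inl ∘ z : I → V ⊕ A) := Sum.inl_injective.comp hz
  obtain ⟨C, hv, hl, hw, ho⟩ := exists_singleLayer hz' u
  refine ⟨C, ?_⟩
  have hc : Clean C (parallelOp z fun _ i => (u i : Matrix Bool Bool ℂ)) := by
    refine clean_of_ket fun x => ?_
    rw [ho, injectOp_mulVec Sum.inl_injective]
    ext y
    rw [mulVec_ket, inject]
    beta_reduce
    by_cases h : ∀ w, w ∉ Set.range (Sum.inl ∘ z : I → V ⊕ A) →
        y w = (Sum.elim x fun _ => false : V ⊕ A → Bool) w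
    · rw [parallelOp_apply_of h, if_pos, mulVec_ket]
      · beta_reduce
        rw [parallelOp_apply_of]
        · simp
        · intro w hw
          exact h (Sum.inl w) fun ⟨i, hi⟩ => hw ⟨i, Sum.inl_injective hi⟩
      · rintro (w | w) hw
        · exact absurd ⟨w, rfl⟩ hw
        · exact h (Sum.inr w) fun ⟨i, hi⟩ => by simp at hi
    · rw [parallelOp_apply_of_not h]
      split_ifs with h'
      · rw [mulVec_ket]
        beta_reduce
        rw [parallelOp_apply_of_not]
        intro h''
        refine h ?_
        rintro (w | w) hw
        · exact h'' w fun ⟨i, hi⟩ => hw ⟨i, congrArg Sum.inl hi⟩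
        · exact h' _ (by simp)
      · rfl
  have := Block.of_within hv hc hl.le hw (k := 0) (by simp)
  simpa using this

/-- A circuit that computes classical auxiliary values, applies phases to them and uncomputes. -/
theorem Prog.WF.exists_phaseBlock {P : Prog (V ⊕ A) I} {D : ℕ} (h : P.WF D) {τ : I → A}
    (hτ : ∀ i, P.tgt i = Sum.inr (τ i))
    (hr : ∀ i, ∀ j, Sum.inr j ∈ (P.ins i).reads → j ∈ Set.range τ)
    (X : (V → Bool) → I → Bool)
    (hX : ∀ x i, X x i = (P.ins i).eval (Sum.elim x (Function.extend τ (X x) fun _ => false)))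
    {J : Type} [Fintype J] {ζ : J → I} (hζ : Function.Injective ζ) (c : J → Bool → ℂ)
    (hc : ∀ j b, ‖c j b‖ = 1) :
    ∃ C : Circuit (V ⊕ A), Block C (Matrix.diagonal fun x => ∏ j, c j (X x (ζ j)))
      (2 * (D * instrDepth) + 1)
      (∑ i, (2 * (D * instrDepth) + 1 - 2 * (P.lev i * instrDepth))) := by
  classical
  obtain ⟨C1, v1, l1, w1, t1, o1⟩ := h.exists_circuit
  have hτi : Function.Injective τ := fun i j e => h.tgt_inj (by rw [hτ, hτ, e])
  obtain ⟨C2, v2, l2, w2, o2⟩ := exists_singleLayer (h.tgt_inj.comp hζ)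
    fun j => diagU (c j) (hc j)
  have w1' : ∀ t j, C1.Touches t (Sum.inr j) → ∃ i, j = τ i ∧ P.lev i * instrDepth ≤ t := by
    intro t j ht
    obtain ⟨i, hi⟩ := w1.touches ht
    have : j ∈ Set.range τ := by
      rcases hi with hi | hi
      · rw [hτ] at hi
        exact ⟨i, (Sum.inr_injective hi).symm⟩
      · exact hr i j hi
    obtain ⟨i', rfl⟩ := this
    exact ⟨i', rfl, t1 t i' (by rwa [hτ])⟩
  have w2' : ∀ t j, C2.Touches t (Sum.inr j) → ∃ i, j = τ i := by
    intro t j ht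
    obtain ⟨i, hi⟩ := w2.touches ht
    simp only [Function.comp_apply, hτ] at hi
    exact ⟨_, (Sum.inr_injective hi).symm⟩
  have hclean : Clean (C1 ++ (C2 ++ C1.dagger) : Circuit (V ⊕ A))
      (Matrix.diagonal fun x => ∏ j, c j (X x (ζ j))) := by
    refine clean_of_ket fun x => ?_
    have hx0 : ∀ i, (Sum.elim x fun _ => false : V ⊕ A → Bool) (P.tgt i) = false := fun i => by
      rw [hτ, Sum.elim_inr]
    have ho1 := o1 (Sum.elim x fun _ => false)
      (Sum.elim x (Function.extend τ (X x) fun _ => false)) hx0 (fun w hw => by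
        rcases w with w | w
        · rfl
        · refine Function.extend_apply' (f := τ) (X x) (fun _ => false) w ?_
          rintro ⟨i, rfl⟩
          exact hw ⟨i, hτ i⟩)
        (fun i => by rw [hτ, Sum.elim_inr, hτi.extend_apply, ← hX])
    have hdiag : (Matrix.diagonal fun x => ∏ j, c j (X x (ζ j))) *ᵥ ket x =
        (∏ j, c j (X x (ζ j))) • ket x := by
      ext y
      rw [Matrix.mulVec_diagonal]
      simp only [Pi.smul_apply, smul_eq_mul, ket_apply]
      split_ifs with e
      · rw [e]
      · simp
    have ho2 : C2.op *ᵥ ket (Sum.elim x (Function.extend τ (X x) fun _ => false)) =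
        (∏ j, c j (X x (ζ j))) • ket (Sum.elim x (Function.extend τ (X x) fun _ => false)) := by
      rw [o2]
      refine (parallelOp_diagonal_mulVec_ket (h.tgt_inj.comp hζ) (fun _ j => c j) _).trans ?_
      congr 1
      refine Finset.prod_congr rfl fun j _ => ?_
      rw [Function.comp_apply, hτ, Sum.elim_inr, hτi.extend_apply]
    rw [Circuit.op_append, Circuit.op_append, ← Matrix.mulVec_mulVec, ← Matrix.mulVec_mulVec,
      ho1, ho2, Matrix.mulVec_smul, Circuit.dagger_mulVec_of_mulVec ho1, hdiag,
      Matrix.mulVec_smul, injectOp_mulVec_ket, embed_inl]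
  have hlen : (C1 ++ (C2 ++ C1.dagger) : Circuit (V ⊕ A)).length =
      2 * (D * instrDepth) + 1 := by
    simp only [List.length_append, Circuit.length_dagger, l1, l2]
    ring
  have hlev : ∀ i, P.lev i * instrDepth ≤ D * instrDepth := fun i =>
    Nat.mul_le_mul_right _ (h.lev_lt i).le
  have hlt : ∀ i, P.lev i * instrDepth < D * instrDepth := fun i =>
    Nat.mul_lt_mul_of_pos_right (h.lev_lt i) (by norm_num [instrDepth])
  -- Wire `τ i` is first used at level `lev i` and, the circuit being a palindrome around the phase
  -- layer, last used equally far from the end. Wires outside the image of `τ` are never touched;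
  -- taking `lo` equal to the full length makes them free.
  refine ⟨_, Block.of_touches (v1.append (v2.append v1.dagger)) hclean hlen.le
    (Function.extend τ (fun i => P.lev i * instrDepth) fun _ => 2 * (D * instrDepth) + 1)
    (fun t j ht => ?_) ?_⟩
  · rw [hlen]
    rcases Circuit.touches_append ht with h1 | ⟨h0, h1⟩
    · have h2 := h1.lt_length
      obtain ⟨i, rfl, hi⟩ := w1' _ _ h1
      rw [hτi.extend_apply]
      have := hlev i
      omega
    · rcases Circuit.touches_append h1 with h2 | ⟨h2, h3⟩
      · have h3 := h2.lt_length
        obtain ⟨i, rfl⟩ := w2' _ _ h2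
        rw [hτi.extend_apply]
        have := hlev i
        omega
      · have h4 := h3.lt_length
        rw [Circuit.length_dagger] at h4
        obtain ⟨i, rfl, hi⟩ := w1' _ _ (Circuit.touches_dagger h3)
        rw [hτi.extend_apply]
        have := hlev i
        omega
  · rw [hlen, ← Finset.sum_subset (Finset.subset_univ (Finset.univ.map ⟨τ, hτi⟩)),
      Finset.sum_map]
    · refine Finset.sum_le_sum fun i _ => ?_
      rw [Function.Embedding.coeFn_mk, hτi.extend_apply]
    · intro j _ hj
      rw [Function.extend_apply']
      · omega
      · rintro ⟨i, rfl⟩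
        exact hj (by simp)

end SingleLayers

/-! ### Counting nodes and lifetimes in binary trees -/

theorem card_node_lt (k : ℕ) : Fintype.card (Node k) < 2 ^ k := by
  rw [Fintype.card_sigma]
  simp only [Fintype.card_fin]
  rw [Fin.sum_univ_eq_sum_range (fun s => 2 ^ s)]
  induction k with
  | zero => simp
  | succ k ih =>
    rw [Finset.sum_range_succ, pow_succ]
    omega

/-- In the step from `R` to `R + 1` the upper half contributes nothing and each number in the lower
half contributes one more. This geometric series shows that copies created by doubling live only a
bounded number of levels on average. -/
theorem sum_sub_size_lt (R : ℕ) : ∑ j ∈ Finset.range (2 ^ R), (R - j.size) < 2 ^ R := by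
  induction R with
  | zero => simp
  | succ R ih =>
    rw [pow_succ, mul_two, Finset.sum_range_add]
    have h1 : ∑ j ∈ Finset.range (2 ^ R), (R + 1 - j.size) =
        ∑ j ∈ Finset.range (2 ^ R), (R - j.size) + 2 ^ R := by
      have h : ∑ j ∈ Finset.range (2 ^ R), (R + 1 - j.size) =
          ∑ j ∈ Finset.range (2 ^ R), ((R - j.size) + 1) := by
        refine Finset.sum_congr rfl fun j hj => ?_
        have : j.size ≤ R := Nat.size_le.2 (Finset.mem_range.1 hj)
        omega
      rw [h, Finset.sum_add_distrib, Finset.sum_const, Finset.card_range, smul_eq_mul, mul_one]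
    have h2 : ∑ j ∈ Finset.range (2 ^ R), (R + 1 - (2 ^ R + j).size) = 0 := by
      refine Finset.sum_eq_zero fun j _ => ?_
      have : R < (2 ^ R + j).size := Nat.lt_size.2 (Nat.le_add_right _ _)
      omega
    omega

theorem sum_fin_sub_size_le {L R : ℕ} (hL : L ≤ 2 ^ R) :
    ∑ j : Fin L, (R - (j : ℕ).size) ≤ 2 ^ R := by
  rw [Fin.sum_univ_eq_sum_range (fun j => R - j.size)]
  exact (Finset.sum_le_sum_of_subset (Finset.range_subset_range.2 hL)).trans (sum_sub_size_lt R).le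

/-! ### Multiplexed diagonal operators -/

/-- Auxiliary wires for a diagonal operator controlled on an address of `μ` bits: copies of the
address bits, the one-hot encodings of the prefixes of the address, `L` literals, copies of the
one-hot encoding and of the literals, and their conjunctions. -/
inductive MuxAnc (μ L : ℕ) : Type
  | addr (ν : Node μ) : MuxAnc μ L
  | onehot (ν : Node (μ + 1)) : MuxAnc μ L
  | lit (j : Fin L) : MuxAnc μ L
  | fan (k : Fin (2 ^ μ)) (j : Fin L) : MuxAnc μ L
  | fanLit (k : Fin (2 ^ μ)) (j : Fin L) : MuxAnc μ L
  | gate (k : Fin (2 ^ μ)) (j : Fin L) : MuxAnc μ L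
  deriving Fintype

section Mux

variable {μ L : ℕ}

theorem MuxAnc.sum_eq (g : MuxAnc μ L → ℕ) : ∑ i, g i = ∑ ν, g (.addr ν) + (∑ ν, g (.onehot ν) +
    (∑ j, g (.lit j) + (∑ k, ∑ j, g (.fan k j) + (∑ k, ∑ j, g (.fanLit k j) +
      ∑ k, ∑ j, g (.gate k j))))) := by
  let e : Node μ ⊕ Node (μ + 1) ⊕ Fin L ⊕ (Fin (2 ^ μ) × Fin L) ⊕ (Fin (2 ^ μ) × Fin L) ⊕
      (Fin (2 ^ μ) × Fin L) → MuxAnc μ L :=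
    Sum.elim .addr (Sum.elim .onehot (Sum.elim .lit (Sum.elim (fun p => .fan p.1 p.2)
      (Sum.elim (fun p => .fanLit p.1 p.2) fun p => .gate p.1 p.2))))
  have he : Function.Bijective e := by
    constructor
    · rintro (a | a | a | a | a | a) (b | b | b | b | b | b) h <;> simp [e] at h ⊢
      · exact h
      · exact h
      · exact h
      · exact Prod.ext h.1 h.2
      · exact Prod.ext h.1 h.2
      · exact Prod.ext h.1 h.2
    · rintro (a | a | a | ⟨a, b⟩ | ⟨a, b⟩ | ⟨a, b⟩)
      · exact ⟨.inl a, rfl⟩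
      · exact ⟨.inr (.inl a), rfl⟩
      · exact ⟨.inr (.inr (.inl a)), rfl⟩
      · exact ⟨.inr (.inr (.inr (.inl (a, b)))), rfl⟩
      · exact ⟨.inr (.inr (.inr (.inr (.inl (a, b))))), rfl⟩
      · exact ⟨.inr (.inr (.inr (.inr (.inr (a, b))))), rfl⟩
  rw [← Function.Bijective.sum_comp he]
  simp only [Fintype.sum_sum_type, Fintype.sum_prod_type]
  rfl

variable {V A : Type} [Fintype V] [DecidableEq V] [Fintype A] [DecidableEq A]
  {κ : Type} [Fintype κ]

/-- The levels are staggered to avoid conflicts and to save space. One-hot siblings share their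
reads and take consecutive levels, as do the two literals of a wire. The two fan-outs are delayed by
`μ` and `R` respectively, so that both end at level `4 * μ + R + 2`, just before the conjunctions;
most of their wires are then created only shortly before use. -/
def muxProg (R : ℕ) (d : Fin μ → V) (f a : κ → V) (lit : Fin L → κ × Bool)
    (ι : MuxAnc μ L → A) : Prog (V ⊕ A) (MuxAnc μ L) where
  tgt i := .inr (ι i)
  ins
    | .addr ν => if (ν.2 : ℕ) = 0 then .copy (.inl (d ν.1)) else
        .copy (.inr (ι (.addr ⟨ν.1, ⟨dropTop ν.2, (dropTop_le _).trans_lt ν.2.2⟩⟩)))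
    | .onehot ν => if h : (ν.1 : ℕ) = 0 then .one else
        .bin (.inr (ι (.onehot (parent ν h))))
          (.inr (ι (.addr ⟨⟨(ν.1 : ℕ) - 1, by have := ν.1.2; omega⟩, (parent ν h).2⟩)))
          fun u v => u && (v == decide ((ν.2 : ℕ) % 2 = 1))
    | .lit j => .bin (.inl (f (lit j).1)) (.inl (a (lit j).1)) fun p q => p && (q == (lit j).2)
    | .fan k j => if (j : ℕ) = 0 then .copy (.inr (ι (.onehot ⟨Fin.last μ, k⟩))) else
        .copy (.inr (ι (.fan k ⟨dropTop j, (dropTop_le _).trans_lt j.2⟩)))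
    | .fanLit k j => if (k : ℕ) = 0 then .copy (.inr (ι (.lit j))) else
        .copy (.inr (ι (.fanLit ⟨dropTop k, (dropTop_le _).trans_lt k.2⟩ j)))
    | .gate k j => .bin (.inr (ι (.fan k j))) (.inr (ι (.fanLit k j))) and
  lev
    | .addr ν => (ν.2 : ℕ).size
    | .onehot ν => μ + 2 * (ν.1 : ℕ) + (ν.2 : ℕ) % 2
    | .lit j => (lit j).2.toNat
    | .fan _ j => 3 * μ + 2 + μ + (j : ℕ).size
    | .fanLit k _ => 3 * μ + 2 + R + (k : ℕ).size
    | .gate _ _ => 3 * μ + 2 + μ + R + 1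

variable {R : ℕ} {d : Fin μ → V} {f a : κ → V} {lit : Fin L → κ × Bool} {ι : MuxAnc μ L → A}

theorem muxProg_wf (hL : L ≤ 2 ^ R) (hd : Function.Injective d) (hf : Function.Injective f)
    (ha : Function.Injective a) (hdf : ∀ i ν, d i ≠ f ν) (hda : ∀ i ν, d i ≠ a ν)
    (hfa : ∀ ν ν', f ν ≠ a ν') (hlit : Function.Injective lit) (hι : Function.Injective ι) :
    (muxProg R d f a lit ι).WF (4 * μ + R + 4) where
  tgt_inj := fun i j h => hι (Sum.inr_injective h)
  lev_lt := by
    rintro (ν | ν | j | ⟨k, j⟩ | ⟨k, j⟩ | ⟨k, j⟩) <;> simp only [muxProg]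
    · have h1 := ν.1.2
      have h3 : (ν.2 : ℕ).size ≤ ν.1 := Nat.size_le.2 ν.2.2
      omega
    · have h1 := ν.1.2
      omega
    · have := Bool.toNat_le (lit j).2
      omega
    · have h3 : (j : ℕ).size ≤ R := Nat.size_le.2 (j.2.trans_le hL)
      omega
    · have h3 : (k : ℕ).size ≤ μ := Nat.size_le.2 k.2
      omega
    · omega
  ins_wf := by
    rintro (ν | ν | j | ⟨k, j⟩ | ⟨k, j⟩ | ⟨k, j⟩) <;> simp only [muxProg]
    · split_ifs <;> trivial
    · split_ifs
      · trivial
      · simp [Instr.WF, hι.eq_iff]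
    · simp [Instr.WF, hfa]
    · split_ifs <;> trivial
    · split_ifs <;> trivial
    · simp [Instr.WF, hι.eq_iff]
  reads_lt := by
    rintro (ν | ν | j | ⟨k, j⟩ | ⟨k, j⟩ | ⟨k, j⟩) i h <;> simp only [muxProg] at h
    · by_cases h0 : (ν.2 : ℕ) = 0
      · simp [h0, Instr.reads] at h
      · simp only [h0, if_false, Instr.reads, Set.mem_singleton_iff, Sum.inr.injEq,
          hι.eq_iff] at h
        subst h
        exact size_dropTop_lt h0
    · by_cases h0 : (ν.1 : ℕ) = 0
      · simp [h0, Instr.reads] at h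
      · simp only [h0, dif_neg, not_false_eq_true, Instr.reads, Set.mem_singleton_iff,
          Set.mem_insert_iff, Sum.inr.injEq, hι.eq_iff] at h
        have h1 := ν.1.2
        rcases h with rfl | rfl
        · simp only [muxProg, parent]
          omega
        · have h3 : ((parent ν h0).2 : ℕ).size ≤ (ν.1 : ℕ) - 1 :=
            Nat.size_le.2 (parent ν h0).2.2
          simp only [muxProg]
          omega
    · simp [Instr.reads] at h
    · by_cases h0 : (j : ℕ) = 0
      · simp only [h0, if_true, Instr.reads, Set.mem_singleton_iff, Sum.inr.injEq,
          hι.eq_iff] at h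
        subst h
        simp only [muxProg, Fin.val_last]
        omega
      · simp only [h0, if_false, Instr.reads, Set.mem_singleton_iff, Sum.inr.injEq,
          hι.eq_iff] at h
        subst h
        have := size_dropTop_lt h0
        simp only [muxProg]
        omega
    · by_cases h0 : (k : ℕ) = 0
      · simp only [h0, if_true, Instr.reads, Set.mem_singleton_iff, Sum.inr.injEq,
          hι.eq_iff] at h
        subst h
        have := Bool.toNat_le (lit j).2
        simp only [muxProg]
        omega
      · simp only [h0, if_false, Instr.reads, Set.mem_singleton_iff, Sum.inr.injEq,
          hι.eq_iff] at h
        subst h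
        have := size_dropTop_lt h0
        simp only [muxProg]
        omega
    · simp only [Instr.reads, Set.mem_singleton_iff, Set.mem_insert_iff, Sum.inr.injEq,
        hι.eq_iff] at h
      have h3 : (j : ℕ).size ≤ R := Nat.size_le.2 (j.2.trans_le hL)
      have h4 : (k : ℕ).size ≤ μ := Nat.size_le.2 k.2
      rcases h with rfl | rfl <;> simp only [muxProg] <;> omega
  disj := by
    have sz : ∀ ν : Node μ, (ν.2 : ℕ).size < μ := fun ν =>
      (Nat.size_le.2 ν.2.2).trans_lt ν.1.2
    have sj : ∀ j : Fin L, (j : ℕ).size ≤ R := fun j => Nat.size_le.2 (j.2.trans_le hL)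
    have sk : ∀ k : Fin (2 ^ μ), (k : ℕ).size ≤ μ := fun k => Nat.size_le.2 k.2
    have sb : ∀ j : Fin L, (lit j).2.toNat ≤ 1 := fun j => Bool.toNat_le _
    have so : ∀ ν : Node (μ + 1), (ν.1 : ℕ) < μ + 1 := fun ν => ν.1.2
    -- These facts record which kinds of wires each kind of instruction reads. Two instructions of
    -- different kinds are separated either by their levels or because they read different kinds of
    -- wires.
    have r1 : ∀ (ν : Node μ) w, w ∈ ((muxProg R d f a lit ι).ins (.addr ν)).reads →
        (∃ i, w = .inl (d i)) ∨ ∃ ν, w = .inr (ι (.addr ν)) := fun ν w hw => by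
      simp only [muxProg] at hw
      split_ifs at hw
      exacts [Or.inl ⟨_, hw⟩, Or.inr ⟨_, hw⟩]
    have r2 : ∀ (ν : Node (μ + 1)) w, w ∈ ((muxProg R d f a lit ι).ins (.onehot ν)).reads →
        (∃ ν, w = .inr (ι (.onehot ν))) ∨ ∃ ν, w = .inr (ι (.addr ν)) := fun ν w hw => by
      simp only [muxProg] at hw
      split_ifs at hw
      · exact absurd hw (Set.notMem_empty _)
      · exact hw.imp (fun h => ⟨_, h⟩) fun h => ⟨_, h⟩
    have r3 : ∀ (j : Fin L) w, w ∈ ((muxProg R d f a lit ι).ins (.lit j)).reads →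
        (∃ ν, w = .inl (f ν)) ∨ ∃ ν, w = .inl (a ν) := fun ν w hw =>
      hw.imp (fun h => ⟨_, h⟩) fun h => ⟨_, h⟩
    have r4 : ∀ k (j : Fin L) w, w ∈ ((muxProg R d f a lit ι).ins (.fan k j)).reads →
        (∃ ν, w = .inr (ι (.onehot ν))) ∨ ∃ p : _ × _, w = .inr (ι (.fan p.1 p.2)) :=
      fun k j w hw => by
        simp only [muxProg] at hw
        split_ifs at hw
        exacts [Or.inl ⟨_, hw⟩, Or.inr ⟨(_, _), hw⟩]
    have r5 : ∀ k (j : Fin L) w, w ∈ ((muxProg R d f a lit ι).ins (.fanLit k j)).reads →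
        (∃ ν, w = .inr (ι (.lit ν))) ∨ ∃ p : _ × _, w = .inr (ι (.fanLit p.1 p.2)) :=
      fun k j w hw => by
        simp only [muxProg] at hw
        split_ifs at hw
        exacts [Or.inl ⟨_, hw⟩, Or.inr ⟨(_, _), hw⟩]
    have r6 : ∀ k (j : Fin L) w, w ∈ ((muxProg R d f a lit ι).ins (.gate k j)).reads →
        (∃ p : _ × _, w = .inr (ι (.fan p.1 p.2))) ∨
          ∃ p : _ × _, w = .inr (ι (.fanLit p.1 p.2)) :=
      fun k j w hw => hw.imp (fun h => ⟨(_, _), h⟩) fun h => ⟨(_, _), h⟩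
    intro i i' hne hl
    rw [Set.disjoint_left]
    intro w hw hw'
    rcases i with ν | ν | j | ⟨k, j⟩ | ⟨k, j⟩ | ⟨k, j⟩ <;>
      rcases i' with ν' | ν' | j' | ⟨k', j'⟩ | ⟨k', j'⟩ | ⟨k', j'⟩
    · refine hne (congrArg _ (node_ext_iff.2 ?_))
      simp only [muxProg] at hl hw hw'
      by_cases h0 : (ν.2 : ℕ) = 0 <;> by_cases h0' : (ν'.2 : ℕ) = 0 <;>
        simp only [h0, h0', if_true, if_false, Instr.reads, Set.mem_singleton_iff] at hw hw' <;>
        subst hw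
      · exact ⟨congrArg Fin.val (hd (Sum.inl_injective hw')), h0.trans h0'.symm⟩
      · simp at hw'
      · simp at hw'
      · have e := MuxAnc.addr.inj (hι (Sum.inr_injective hw'))
        have e := node_ext_iff.1 e
        exact ⟨e.1, dropTop_inj h0 h0' hl e.2⟩
    -- Only the diagonal cases of the six by six table need individual arguments. Each one that is
    -- closed shifts the numbering of the rest by one.
    on_goal 7 =>
      refine hne (congrArg _ (node_ext_iff.2 ?_))
      simp only [muxProg] at hl hw hw'
      by_cases h0 : (ν.1 : ℕ) = 0
      · simp [h0, Instr.reads] at hw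
      by_cases h0' : (ν'.1 : ℕ) = 0
      · simp [h0', Instr.reads] at hw'
      rw [dif_neg h0] at hw
      rw [dif_neg h0'] at hw'
      rcases hw with rfl | rfl <;> rcases hw' with e | e <;> have e := hι (Sum.inr_injective e) <;>
        simp only [MuxAnc.onehot.injEq, MuxAnc.addr.injEq, reduceCtorEq] at e <;>
        have e := node_ext_iff.1 e <;> simp only [parent] at e <;> constructor <;> omega
    on_goal 13 =>
      refine hne (congrArg _ (hlit ?_))
      simp only [muxProg, Instr.reads] at hl hw hw'
      have hb : (lit j).2 = (lit j').2 := by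
        revert hl
        cases (lit j).2 <;> cases (lit j').2 <;> simp
      rcases hw with rfl | rfl <;> rcases hw' with e | e <;> have e := Sum.inl_injective e
      · exact Prod.ext (hf e) hb
      · exact absurd e (hfa _ _)
      · exact absurd e.symm (hfa _ _)
      · exact Prod.ext (ha e) hb
    on_goal 19 =>
      simp only [muxProg] at hl hw hw'
      by_cases h0 : (j : ℕ) = 0 <;> by_cases h0' : (j' : ℕ) = 0 <;>
        simp only [h0, h0', if_true, if_false, Instr.reads, Set.mem_singleton_iff] at hw hw' <;>
        subst hw <;> have e := hι (Sum.inr_injective hw') <;>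
        simp only [MuxAnc.onehot.injEq, MuxAnc.fan.injEq, reduceCtorEq] at e
      · have e := (node_ext_iff.1 e).2
        exact hne (by rw [Fin.ext (a := k) e, Fin.ext (h0.trans h0'.symm)])
      · exact hne (by rw [e.1, Fin.ext (dropTop_inj h0 h0' (by omega) (Fin.ext_iff.1 e.2))])
    on_goal 25 =>
      simp only [muxProg] at hl hw hw'
      by_cases h0 : (k : ℕ) = 0 <;> by_cases h0' : (k' : ℕ) = 0 <;>
        simp only [h0, h0', if_true, if_false, Instr.reads, Set.mem_singleton_iff] at hw hw' <;>
        subst hw <;> have e := hι (Sum.inr_injective hw') <;>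
        simp only [MuxAnc.lit.injEq, MuxAnc.fanLit.injEq, reduceCtorEq] at e
      · exact hne (by rw [e, Fin.ext (h0.trans h0'.symm)])
      · exact hne (by rw [e.2, Fin.ext (dropTop_inj h0 h0' (by omega) (Fin.ext_iff.1 e.1))])
    on_goal 31 =>
      simp only [muxProg, Instr.reads] at hl hw hw'
      rcases hw with rfl | rfl <;> rcases hw' with e | e <;> have e := hι (Sum.inr_injective e) <;>
        simp only [MuxAnc.fan.injEq, MuxAnc.fanLit.injEq, reduceCtorEq] at e <;>
        exact hne (by rw [e.1, e.2])
    all_goals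
      first
        | (simp only [muxProg] at hl; have := sz ν; omega)
        | (simp only [muxProg] at hl; have := sz ν'; omega)
        | (simp only [muxProg] at hl; have := so ν; omega)
        | (simp only [muxProg] at hl; have := so ν'; omega)
        | (simp only [muxProg] at hl; have := sj j; have := sk k; omega)
        | (simp only [muxProg] at hl; have := sj j'; have := sk k'; omega)
        | ((first
            | obtain ⟨p, rfl⟩ | ⟨p, rfl⟩ := r1 _ _ hw
            | obtain ⟨p, rfl⟩ | ⟨p, rfl⟩ := r2 _ _ hw
            | obtain ⟨p, rfl⟩ | ⟨p, rfl⟩ := r3 _ _ hw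
            | obtain ⟨p, rfl⟩ | ⟨p, rfl⟩ := r4 _ _ _ hw
            | obtain ⟨p, rfl⟩ | ⟨p, rfl⟩ := r5 _ _ _ hw
            | obtain ⟨p, rfl⟩ | ⟨p, rfl⟩ := r6 _ _ _ hw) <;>
            (first
            | obtain ⟨q, e⟩ | ⟨q, e⟩ := r1 _ _ hw'
            | obtain ⟨q, e⟩ | ⟨q, e⟩ := r2 _ _ hw'
            | obtain ⟨q, e⟩ | ⟨q, e⟩ := r3 _ _ hw'
            | obtain ⟨q, e⟩ | ⟨q, e⟩ := r4 _ _ _ hw'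
            | obtain ⟨q, e⟩ | ⟨q, e⟩ := r5 _ _ _ hw'
            | obtain ⟨q, e⟩ | ⟨q, e⟩ := r6 _ _ _ hw') <;>
            simp [hι.eq_iff, hdf, hda, (hdf _ _).symm, (hda _ _).symm] at e)

end Mux

section Mux

variable {μ L R : ℕ} {V A : Type} [Fintype V] [DecidableEq V] [Fintype A] [DecidableEq A]
  {κ : Type} [Fintype κ] {d : Fin μ → V} {f a : κ → V} {ι : MuxAnc μ L → A}

/-- The values computed by `muxProg`. -/
def muxVal (d : Fin μ → V) (f a : κ → V) (lit : Fin L → κ × Bool) (x : V → Bool) :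
    MuxAnc μ L → Bool
  | .addr ν => x (d ν.1)
  | .onehot ν => decide ((ν.2 : ℕ) = path (fun i => x (d i)) ν.1)
  | .lit j => x (f (lit j).1) && (x (a (lit j).1) == (lit j).2)
  | .fan k _ => decide ((k : ℕ) = path (fun i => x (d i)) μ)
  | .fanLit _ j => x (f (lit j).1) && (x (a (lit j).1) == (lit j).2)
  | .gate k j => decide ((k : ℕ) = path (fun i => x (d i)) μ) &&
      (x (f (lit j).1) && (x (a (lit j).1) == (lit j).2))

theorem muxVal_eq_eval {lit : Fin L → κ × Bool} (hι : Function.Injective ι) (x : V → Bool)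
    (i : MuxAnc μ L) : muxVal d f a lit x i = ((muxProg R d f a lit ι).ins i).eval
      (Sum.elim x (Function.extend ι (muxVal d f a lit x) fun _ => false)) := by
  rcases i with ν | ν | j | ⟨k, j⟩ | ⟨k, j⟩ | ⟨k, j⟩
  · simp only [muxProg]
    split_ifs <;> simp [Instr.eval, hι.extend_apply, muxVal]
  · simp only [muxProg]
    split_ifs with h0
    · have h2 : 2 ^ (ν.1 : ℕ) = 1 := by rw [h0, pow_zero]
      have h3 := path_lt (fun i => x (d i)) ν.1
      have h4 := ν.2.2
      simp only [Instr.eval, muxVal, decide_eq_true_eq]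
      omega
    · have hb : (ν.1 : ℕ) - 1 < μ := by
        have := ν.1.2
        omega
      have hs : path (fun i => x (d i)) ν.1 = 2 * path (fun i => x (d i)) ((ν.1 : ℕ) - 1) +
          (x (d ⟨(ν.1 : ℕ) - 1, hb⟩)).toNat := by
        have h := path_succ (fun i => x (d i)) ⟨(ν.1 : ℕ) - 1, hb⟩
        simp only at h
        rw [← h, Nat.sub_add_cancel (Nat.pos_of_ne_zero h0)]
      simp only [Instr.eval, Sum.elim_inr, hι.extend_apply, muxVal, hs, parent]
      have := Bool.toNat_le (x (d ⟨(ν.1 : ℕ) - 1, hb⟩))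
      by_cases hp : (ν.2 : ℕ) / 2 = path (fun i => x (d i)) ((ν.1 : ℕ) - 1)
      · simp only [hp, decide_true, Bool.true_and]
        cases hb : x (d ⟨(ν.1 : ℕ) - 1, hb⟩) <;>
          by_cases hm : (ν.2 : ℕ) % 2 = 1 <;> simp [hm] <;> omega
      · simp only [hp, decide_false, Bool.false_and, decide_eq_false_iff_not]
        omega
  · simp [muxProg, Instr.eval, muxVal]
  · simp only [muxProg]
    split_ifs <;> simp [Instr.eval, hι.extend_apply, muxVal]
  · simp only [muxProg]
    split_ifs <;> simp [Instr.eval, hι.extend_apply, muxVal]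
  · simp [muxProg, Instr.eval, hι.extend_apply, muxVal]

/-- The cost of a multiplexed diagonal operator. -/
def muxCost (μ R : ℕ) : ℕ :=
  (3 * 2 ^ μ + 2 ^ R) * (38 * (4 * μ + R + 4) + 1) + 269 * (2 ^ μ * 2 ^ R)

theorem mux_sum_le {lit : Fin L → κ × Bool} (hL : L ≤ 2 ^ R) :
    ∑ i, (2 * ((4 * μ + R + 4) * instrDepth) + 1 -
      2 * ((muxProg R d f a lit ι).lev i * instrDepth)) ≤ muxCost μ R := by
  have h1 : ∀ j : Fin L, (j : ℕ).size ≤ R := fun j => Nat.size_le.2 (j.2.trans_le hL)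
  have h2 : ∀ k : Fin (2 ^ μ), (k : ℕ).size ≤ μ := fun k => Nat.size_le.2 k.2
  set T := 38 * (4 * μ + R + 4) + 1 with hT
  have full : ∀ n, 2 * ((4 * μ + R + 4) * instrDepth) + 1 - 2 * (n * instrDepth) ≤ T :=
    fun n => by
      rw [instrDepth]
      omega
  have c1 : Fintype.card (Node μ) ≤ 2 ^ μ := (card_node_lt μ).le
  have c2 : Fintype.card (Node (μ + 1)) ≤ 2 * 2 ^ μ := by
    rw [← pow_succ']
    exact (card_node_lt (μ + 1)).le
  have hcst : ∀ {I : Type} [Fintype I] (g : I → ℕ) (n c : ℕ), (∀ i, g i ≤ c) →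
      Fintype.card I ≤ n → ∑ i, g i ≤ n * c := by
    intro I _ g n c hg hn
    refine (Finset.sum_le_card_nsmul _ _ c fun i _ => hg i).trans ?_
    rw [smul_eq_mul, Finset.card_univ]
    exact Nat.mul_le_mul_right _ hn
  rw [MuxAnc.sum_eq]
  -- Copy `j` exists during the last `R + 2 - size j` levels. Two passes of depth 19 per level and
  -- the phase layer give `38 * (R - size j) + 77` layers, and `115 = 38 + 77`.
  have b1 : ∑ j : Fin L, (38 * (R - (j : ℕ).size) + 77) ≤ 115 * 2 ^ R := by
    rw [Finset.sum_add_distrib, ← Finset.mul_sum]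
    have := sum_fin_sub_size_le hL
    simp only [Finset.sum_const, Finset.card_univ, Fintype.card_fin, smul_eq_mul]
    omega
  have b2 : ∑ k : Fin (2 ^ μ), (38 * (μ - (k : ℕ).size) + 77) ≤ 115 * 2 ^ μ := by
    rw [Finset.sum_add_distrib, ← Finset.mul_sum]
    have := sum_fin_sub_size_le (le_refl (2 ^ μ))
    simp only [Finset.sum_const, Finset.card_univ, Fintype.card_fin, smul_eq_mul]
    omega
  have s1 := hcst (fun ν => 2 * ((4 * μ + R + 4) * instrDepth) + 1 -
    2 * ((muxProg R d f a lit ι).lev (.addr ν) * instrDepth)) _ _ (fun _ => full _) c1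
  have s2 := hcst (fun ν => 2 * ((4 * μ + R + 4) * instrDepth) + 1 -
    2 * ((muxProg R d f a lit ι).lev (.onehot ν) * instrDepth)) _ _ (fun _ => full _) c2
  have s3 := hcst (fun j => 2 * ((4 * μ + R + 4) * instrDepth) + 1 -
    2 * ((muxProg R d f a lit ι).lev (.lit j) * instrDepth)) (2 ^ R) _ (fun _ => full _)
      (by simpa using hL)
  have s4 : ∑ k, ∑ j, (2 * ((4 * μ + R + 4) * instrDepth) + 1 -
      2 * ((muxProg R d f a lit ι).lev (.fan k j) * instrDepth)) ≤ 2 ^ μ * (115 * 2 ^ R) := by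
    refine hcst _ _ _ (fun k => le_trans (Finset.sum_le_sum fun j _ => ?_) b1) (by simp)
    have := h1 j
    simp only [muxProg, instrDepth]
    omega
  have s5 : ∑ k, ∑ j, (2 * ((4 * μ + R + 4) * instrDepth) + 1 -
      2 * ((muxProg R d f a lit ι).lev (.fanLit k j) * instrDepth)) ≤ 2 ^ R * (115 * 2 ^ μ) := by
    rw [Finset.sum_comm]
    refine hcst _ _ _ (fun j => le_trans (Finset.sum_le_sum fun k _ => ?_) b2) (by simpa using hL)
    have := h2 k
    simp only [muxProg, instrDepth]
    omega
  -- Conjunctions occupy the last level only, which is `2 * 19 + 1 = 39` layers each.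
  have s6 : ∑ k, ∑ j, (2 * ((4 * μ + R + 4) * instrDepth) + 1 -
      2 * ((muxProg R d f a lit ι).lev (.gate k j) * instrDepth)) ≤ 2 ^ μ * (2 ^ R * 39) := by
    refine hcst _ _ _ (fun k => hcst _ _ _ (fun j => ?_) (by simpa using hL)) (by simp)
    simp only [muxProg, instrDepth]
    omega
  have e : muxCost μ R = 2 ^ μ * T + (2 * 2 ^ μ * T + (2 ^ R * T + (2 ^ μ * (115 * 2 ^ R) +
      (2 ^ R * (115 * 2 ^ μ) + 2 ^ μ * (2 ^ R * 39))))) := by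
    rw [muxCost, ← hT]
    ring
  rw [e]
  gcongr

/-- A circuit for a diagonal operator on the wires `a`, controlled on the flags `f` and on the
address held by the wires `d`. -/
theorem exists_mux (hL : L = 2 * Fintype.card κ) (hLR : L ≤ 2 ^ R) (hd : Function.Injective d)
    (hf : Function.Injective f) (ha : Function.Injective a) (hdf : ∀ i ν, d i ≠ f ν)
    (hda : ∀ i ν, d i ≠ a ν) (hfa : ∀ ν ν', f ν ≠ a ν') (hι : Function.Injective ι)
    (τ : ℕ → κ → Bool → ℂ) (hτ : ∀ k ν b, ‖τ k ν b‖ = 1) :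
    ∃ C : Circuit (V ⊕ A), Block C
      (parallelOp a fun x ν => if x (f ν) then
        Matrix.diagonal (τ (path (fun i => x (d i)) μ) ν) else 1)
      (38 * (4 * μ + R + 4) + 1) (muxCost μ R) := by
  classical
  have hcard : Fintype.card (Fin L) = Fintype.card (κ × Bool) := by
    simp [hL, mul_comm]
  let lit : Fin L ≃ κ × Bool := Fintype.equivOfCardEq hcard
  have hr : ∀ i j, Sum.inr j ∈ ((muxProg R d f a lit ι).ins i).reads → j ∈ Set.range ι := by
    intro i j hj
    rcases i with ν | ν | i | ⟨k, i⟩ | ⟨k, i⟩ | ⟨k, i⟩ <;> simp only [muxProg] at hj <;>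
      (try split_ifs at hj) <;> simp [Instr.reads] at hj
    all_goals
      first
        | exact ⟨_, hj.symm⟩
        | (rcases hj with hj | hj <;> exact ⟨_, hj.symm⟩)
  obtain ⟨C, hC⟩ := (muxProg_wf hLR hd hf ha hdf hda hfa lit.injective hι).exists_phaseBlock
    (τ := ι) (fun _ => rfl) hr (muxVal d f a lit) (muxVal_eq_eval hι)
    (ζ := fun p : Fin (2 ^ μ) × Fin L => .gate p.1 p.2)
    (fun p q e => by simpa [Prod.ext_iff] using e)
    (fun p b => if b then τ p.1 (lit p.2).1 (lit p.2).2 else 1)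
    (fun p b => by split_ifs <;> simp [hτ])
  · refine ⟨C, ?_⟩
    -- Among all addresses only the one held by `d` has its one-hot bit set, and of the two literals
    -- of `ν` only the one matching the bit on `a ν` can be true. So at most one phase per `ν`
    -- survives, the prescribed one, and only if the flag is set.
    have e : (Matrix.diagonal fun x => ∏ p : Fin (2 ^ μ) × Fin L,
        if muxVal d f a lit x (.gate p.1 p.2) then τ p.1 (lit p.2).1 (lit p.2).2 else 1) =
        parallelOp a fun x ν => if x (f ν) then
          Matrix.diagonal (τ (path (fun i => x (d i)) μ) ν) else 1 := by
      refine matrix_ext_ket fun x => ?_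
      have h1 : (fun (x : V → Bool) ν => if x (f ν) then
          Matrix.diagonal (τ (path (fun i => x (d i)) μ) ν) else 1) =
          fun x ν => Matrix.diagonal fun b =>
            if x (f ν) then τ (path (fun i => x (d i)) μ) ν b else 1 := by
        ext x ν
        split_ifs
        · rfl
        · rw [Matrix.diagonal_one]
      rw [h1, parallelOp_diagonal_mulVec_ket ha]
      have hdiag : ∀ g : (V → Bool) → ℂ, Matrix.diagonal g *ᵥ ket x = g x • ket x := by
        intro g
        ext y
        rw [Matrix.mulVec_diagonal]
        simp only [Pi.smul_apply, smul_eq_mul, ket_apply]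
        split_ifs with e
        · rw [e]
        · simp
      rw [hdiag]
      congr 1
      have hk : path (fun i => x (d i)) μ < 2 ^ μ := path_lt _ _
      rw [Fintype.prod_prod_type, Fintype.prod_eq_single ⟨_, hk⟩]
      · rw [← Equiv.prod_comp lit.symm, Fintype.prod_prod_type]
        refine Finset.prod_congr rfl fun ν _ => ?_
        simp only [muxVal, Equiv.apply_symm_apply, Fintype.prod_bool]
        cases x (f ν) <;> cases x (a ν) <;> simp
      · intro k hk
        refine Finset.prod_eq_one fun j _ => ?_
        rw [if_neg]
        have : (k : ℕ) ≠ path (fun i => x (d i)) μ := fun e => hk (Fin.ext e)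
        simp [muxVal, this]
    rw [← e]
    refine hC.mono ?_ (mux_sum_le hLR)
    rw [instrDepth]
    omega

end Mux

/-! ### Multiplexed rotations -/

/-- The unitary that diagonalizes all rotations `R_y`. -/
def ryBasis : Matrix.unitaryGroup Bool ℂ :=
  ⟨Matrix.of fun i j => ((√2 : ℝ) : ℂ)⁻¹ *
    (if i then (if j then -Complex.I else Complex.I) else 1), by
    rw [Matrix.mem_unitaryGroup_iff]
    ext i j
    have h := inv_sqrt_two_sq
    cases i <;> cases j <;>
      simp [Matrix.mul_apply, Matrix.star_apply, h]
    all_goals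
      ring_nf
      simp [Complex.I_sq]
      linear_combination 2 * h⟩

/-- The eigenvalues of `R_y(θ)`. -/
def ryEigen (θ : ℝ) (b : Bool) : ℂ := Complex.exp (((if b then θ / 2 else -(θ / 2) : ℝ) : ℂ) * Complex.I)

theorem norm_ryEigen (θ : ℝ) (b : Bool) : ‖ryEigen θ b‖ = 1 := Complex.norm_exp_ofReal_mul_I _

/-- All rotations about one axis share an eigenbasis. The change of basis does not depend on the
angle, so controls are needed for the diagonal factor only. -/
theorem Ry_eq (θ : ℝ) : Ry θ = (ryBasis : Matrix Bool Bool ℂ) *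
    (Matrix.diagonal (ryEigen θ) * ((ryBasis⁻¹ : Matrix.unitaryGroup Bool ℂ) :
      Matrix Bool Bool ℂ)) := by
  have h : ((√2 : ℝ) : ℂ) ^ 2 = 2 := by
    rw [← Complex.ofReal_pow, Real.sq_sqrt (by norm_num)]
    norm_num
  have e : ∀ t : ℝ, Complex.exp ((t : ℂ) * Complex.I) = Real.cos t + Real.sin t * Complex.I := by
    intro t
    rw [Complex.exp_mul_I, Complex.ofReal_cos, Complex.ofReal_sin]
  have h1 : ryEigen θ true = Real.cos (θ / 2) + Real.sin (θ / 2) * Complex.I := by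
    simp only [ryEigen, if_true]
    exact e _
  have h0 : ryEigen θ false = Real.cos (θ / 2) - Real.sin (θ / 2) * Complex.I := by
    simp only [ryEigen, Bool.false_eq_true, if_false]
    rw [e, Real.cos_neg, Real.sin_neg]
    push_cast
    ring
  ext i j
  rw [Matrix.UnitaryGroup.inv_val, Matrix.star_eq_conjTranspose]
  cases i <;> cases j <;>
    simp only [Ry, ryBasis, Matrix.mul_apply, Matrix.conjTranspose_apply, Matrix.of_apply,
      Fintype.sum_bool, Matrix.diagonal_apply, h0, h1] <;> simp
  all_goals ring_nf
  all_goals simp [Complex.I_sq]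
  all_goals rw [h]; ring

section MuxRotation

variable {μ L R : ℕ} {V A : Type} [Fintype V] [DecidableEq V] [Fintype A] [DecidableEq A]
  {κ : Type} [Fintype κ] {d : Fin μ → V} {f a : κ → V} {ι : MuxAnc μ L → A}

theorem indep_mux {β : Type} (hda : ∀ i ν, d i ≠ a ν) (hfa : ∀ ν ν', f ν ≠ a ν')
    (G : Bool → ℕ → κ → β) :
    Indep a fun x ν => G (x (f ν)) (path (fun i => x (d i)) μ) ν := by
  intro x y h
  have h1 : (fun i => y (d i)) = fun i => x (d i) :=
    funext fun i => h _ fun ⟨ν, e⟩ => hda i ν e.symm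
  funext ν
  simp only [h1, h (f ν) fun ⟨ν', e⟩ => hfa ν ν' e.symm]

/-- A circuit for the rotations `R_y` on the wires `a`, controlled on the flags `f` and on the
address held by the wires `d`. -/
theorem exists_muxRy (hL : L = 2 * Fintype.card κ) (hLR : L ≤ 2 ^ R) (hd : Function.Injective d)
    (hf : Function.Injective f) (ha : Function.Injective a) (hdf : ∀ i ν, d i ≠ f ν)
    (hda : ∀ i ν, d i ≠ a ν) (hfa : ∀ ν ν', f ν ≠ a ν') (hι : Function.Injective ι)
    (θ : ℕ → κ → ℝ) :
    ∃ C : Circuit (V ⊕ A), Block C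
      (parallelOp a fun x ν => if x (f ν) then Ry (θ (path (fun i => x (d i)) μ) ν) else 1)
      (38 * (4 * μ + R + 4) + 3) (muxCost μ R) := by
  obtain ⟨C1, h1⟩ := block_singleLayer (A := A) ha fun _ => ryBasis⁻¹
  obtain ⟨C2, h2⟩ := exists_mux hL hLR hd hf ha hdf hda hfa hι (fun k ν => ryEigen (θ k ν))
    fun k ν b => norm_ryEigen _ _
  obtain ⟨C3, h3⟩ := block_singleLayer (A := A) ha fun _ => ryBasis
  refine ⟨C1 ++ C2 ++ C3, ?_⟩
  have h := (h1.append h2).append h3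
  rw [parallelOp_mul ha _ _ (indep_mux hda hfa fun p k ν => if p then
    Matrix.diagonal (ryEigen (θ k ν)) else 1), parallelOp_mul ha _ _ fun _ _ _ => rfl] at h
  have e : (fun (x : V → Bool) ν => (ryBasis : Matrix Bool Bool ℂ) *
      ((if x (f ν) then Matrix.diagonal (ryEigen (θ (path (fun i => x (d i)) μ) ν)) else 1) *
        ((ryBasis⁻¹ : Matrix.unitaryGroup Bool ℂ) : Matrix Bool Bool ℂ))) =
      fun x ν => if x (f ν) then Ry (θ (path (fun i => x (d i)) μ) ν) else 1 := by
    funext x ν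
    split_ifs
    · rw [Ry_eq]
    -- When the flag is not set, the two uncontrolled changes of basis cancel.
    · rw [Matrix.one_mul]
      exact congrArg Subtype.val (mul_inv_cancel ryBasis)
  rw [e] at h
  exact h.mono (by omega) (by omega)

end MuxRotation

/-! ### The reflection about `|0⟩` -/

/-- The disjunction of the leaves below the node `n` of a heap whose inner nodes are `1, …, L - 1`
and whose leaves are `L, …, 2 * L - 1`. -/
def heapOr (L : ℕ) (c : ℕ → Bool) (n : ℕ) : Bool :=
  if h : 0 < n ∧ n < L then heapOr L c (2 * n) || heapOr L c (2 * n + 1) else c (n - L)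
termination_by L - n

theorem heapOr_inner {L n : ℕ} (c : ℕ → Bool) (h0 : 0 < n) (h : n < L) :
    heapOr L c n = (heapOr L c (2 * n) || heapOr L c (2 * n + 1)) := by
  rw [heapOr, dif_pos ⟨h0, h⟩]

theorem heapOr_leaf {L n : ℕ} (c : ℕ → Bool) (h : L ≤ n) : heapOr L c n = c (n - L) := by
  rw [heapOr, dif_neg (by omega)]

/-- In the heap a false node forces both children to be false, and conversely; so falsity spreads
from the root to all leaves and back. -/
theorem heapOr_root {L : ℕ} (hL : 0 < L) (c : ℕ → Bool) :
    heapOr L c 1 = false ↔ ∀ j < L, c j = false := by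
  constructor
  · intro h
    have key : ∀ n, 0 < n → n < 2 * L → heapOr L c n = false := by
      intro n
      induction n using Nat.strong_induction_on with
      | _ n ih =>
        intro h0 hn
        by_cases h1 : n = 1
        · rw [h1, h]
        · have h2 := ih (n / 2) (by omega) (by omega) (by omega)
          rw [heapOr_inner c (by omega) (by omega), Bool.or_eq_false_iff] at h2
          rcases Nat.mod_two_eq_zero_or_one n with h3 | h3
          · rw [show n = 2 * (n / 2) by omega]
            exact h2.1
          · rw [show n = 2 * (n / 2) + 1 by omega]
            exact h2.2
    intro j hj
    have := key (L + j) (by omega) (by omega)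
    rwa [heapOr_leaf c (by omega), Nat.add_sub_cancel_left] at this
  · intro h
    have key : ∀ k n, 0 < n → n < 2 * L → L - n ≤ k → heapOr L c n = false := by
      intro k
      induction k with
      | zero =>
        intro n h0 hn hk
        rw [heapOr_leaf c (by omega), h _ (by omega)]
      | succ k ih =>
        intro n h0 hn hk
        by_cases hnL : n < L
        · rw [heapOr_inner c h0 hnL, ih _ (by omega) (by omega) (by omega),
            ih _ (by omega) (by omega) (by omega)]
          rfl
        · rw [heapOr_leaf c (by omega), h _ (by omega)]
    exact key L 1 one_pos (by omega) (by omega)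

section ZeroReflection

variable {L D : ℕ} {V A : Type} [Fintype V] [DecidableEq V] [Fintype A] [DecidableEq A]
  {c : Fin L → V} {ι : Fin (2 * L - 1) → A}

/-- Position `i` holds heap node `i + 1`. The binary length of a node number measures its depth, so
subtracting it from `D` computes children before parents. -/
def heapProg (D : ℕ) (c : Fin L → V) (ι : Fin (2 * L - 1) → A) :
    Prog (V ⊕ A) (Fin (2 * L - 1)) where
  tgt i := .inr (ι i)
  ins i := if h : (i : ℕ) + 1 < L then
      .bin (.inr (ι ⟨2 * i + 1, by omega⟩)) (.inr (ι ⟨2 * i + 2, by omega⟩)) or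
    else .copy (.inl (c ⟨(i : ℕ) + 1 - L, by omega⟩))
  lev i := D - ((i : ℕ) + 1).size

theorem size_two_mul {n : ℕ} (h : 0 < n) : (2 * n).size = n.size + 1 := by
  have := Nat.size_shiftLeft h.ne' 1
  rwa [Nat.shiftLeft_eq, pow_one, mul_comm] at this

theorem heapProg_wf (hD : 2 * L ≤ 2 ^ D) (hc : Function.Injective c) (hι : Function.Injective ι) :
    (heapProg D c ι).WF D where
  tgt_inj := fun i j h => hι (Sum.inr_injective h)
  lev_lt i := by
    have h1 : 0 < ((i : ℕ) + 1).size := Nat.size_pos.2 (Nat.succ_pos _)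
    have h2 : ((i : ℕ) + 1).size ≤ D := Nat.size_le.2 (by omega)
    simp only [heapProg]
    omega
  ins_wf i := by
    simp only [heapProg]
    split_ifs
    · simp [Instr.WF, hι.eq_iff]
    · trivial
  reads_lt i j h := by
    have h2 : ((j : ℕ) + 1).size ≤ D := Nat.size_le.2 (by omega)
    simp only [heapProg] at h ⊢
    split_ifs at h with h0
    · have hj : (i : ℕ) + 1 = ((j : ℕ) + 1) / 2 := by
        rcases h with h | h <;> have e := Fin.ext_iff.1 (hι (Sum.inr_injective h)) <;>
          simp only at e <;> omega
      have h3 : ((i : ℕ) + 1).size < ((j : ℕ) + 1).size := by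
        have h4 := size_two_mul (n := (i : ℕ) + 1) (by omega)
        have h5 := Nat.size_le_size (show 2 * ((i : ℕ) + 1) ≤ (j : ℕ) + 1 by omega)
        omega
      omega
    · simp [Instr.reads] at h
  disj i j hne _ := by
    have hne : (i : ℕ) ≠ j := fun e => hne (Fin.ext e)
    rw [Set.disjoint_left]
    intro w hw hw'
    simp only [heapProg] at hw hw'
    split_ifs at hw hw'
    · rcases hw with rfl | rfl <;> rcases hw' with h | h <;>
        have e := Fin.ext_iff.1 (hι (Sum.inr_injective h)) <;> simp only at e <;> omega
    · rcases hw with rfl | rfl <;> simp [Instr.reads] at hw'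
    · rcases hw' with rfl | rfl <;> simp [Instr.reads] at hw
    · obtain rfl : w = _ := hw
      have e := Fin.ext_iff.1 (hc (Sum.inl_injective hw'))
      simp only at e
      omega

/-- The wires are all zero if and only if the root of a tree of disjunctions is false, so the phase
`-1` is attached to the value false at the root. Charging fewer than `2 * L` auxiliary wires for the
whole duration is affordable here. -/
theorem exists_zeroReflection (hL : 0 < L) (hD : 2 * L ≤ 2 ^ D) (hc : Function.Injective c)
    (hι : Function.Injective ι) :
    ∃ C : Circuit (V ⊕ A), Block C (zeroReflection (Set.range c)) (38 * D + 1)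
      (2 * L * (38 * D + 1)) := by
  classical
  let val : (V → Bool) → ℕ → Bool := fun x n =>
    heapOr L (fun j => if h : j < L then x (c ⟨j, h⟩) else false) n
  have hr : ∀ i j, Sum.inr j ∈ ((heapProg D c ι).ins i).reads → j ∈ Set.range ι := by
    intro i j hj
    simp only [heapProg] at hj
    split_ifs at hj
    · rcases hj with h | h <;> exact ⟨_, (Sum.inr_injective h).symm⟩
    · simp [Instr.reads] at hj
  obtain ⟨C, hC⟩ := (heapProg_wf hD hc hι).exists_phaseBlock (fun _ => rfl) hr
    (fun x i => val x (i + 1)) (fun x i => by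
      simp only [heapProg]
      split_ifs with h0
      · simp only [Instr.eval, Sum.elim_inr, hι.extend_apply, val]
        rw [heapOr_inner _ (Nat.succ_pos _) h0]
        rfl
      · simp only [Instr.eval, Sum.elim_inl, val]
        rw [heapOr_leaf _ (by omega), dif_pos])
    (ζ := fun _ : Unit => ⟨0, by omega⟩) (fun _ _ _ => rfl) (fun _ b => if b then 1 else -1)
    (fun _ b => by split_ifs <;> simp)
  refine ⟨C, ?_⟩
  have e : (Matrix.diagonal fun x : V → Bool => ∏ j : Unit,
      if val x (((⟨0, by omega⟩ : Fin (2 * L - 1)) : ℕ) + 1) then (1 : ℂ) else -1) =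
      zeroReflection (Set.range c) := by
    rw [zeroReflection, ← Matrix.diagonal_one, ← Matrix.diagonal_smul, Matrix.diagonal_sub]
    congr 1
    ext x
    simp only [Finset.univ_unique, Finset.prod_singleton, zero_add, Pi.smul_apply, smul_eq_mul]
    have h := heapOr_root hL fun j => if h : j < L then x (c ⟨j, h⟩) else false
    have h' : (∀ w ∈ Set.range c, x w = false) ↔ val x 1 = false := by
      rw [h]
      constructor
      · intro hw j hj
        rw [dif_pos hj]
        exact hw _ ⟨_, rfl⟩
      · rintro hj w ⟨j, rfl⟩
        simpa using hj j j.2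
    by_cases hv : val x 1 = false
    · rw [if_pos (h'.2 hv), if_neg (by simp [hv])]
      norm_num
    · rw [if_neg (fun hw => hv (h'.1 hw)), if_pos (by simpa using hv)]
      norm_num
  rw [e] at hC
  refine hC.mono (by rw [instrDepth]; omega) ?_
  refine (Finset.sum_le_card_nsmul _ _ (38 * D + 1) fun i _ => ?_).trans ?_
  · rw [instrDepth]
    omega
  · rw [smul_eq_mul, Finset.card_univ, Fintype.card_fin]
    exact Nat.mul_le_mul_right _ (Nat.sub_le _ _)

end ZeroReflection

/-! ### Operators that do not change certain wires -/

section Keeps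

variable {W : Type} [Fintype W] [DecidableEq W]

/-- `T` maps basis states to superpositions of basis states that agree with them on `S`. -/
def Keeps (S : Set W) (T : Matrix (W → Bool) (W → Bool) ℂ) : Prop :=
  ∀ y x, T y x ≠ 0 → ∀ w ∈ S, y w = x w

variable {S : Set W} {T T' : Matrix (W → Bool) (W → Bool) ℂ}

theorem Keeps.mul (h : Keeps S T) (h' : Keeps S T') : Keeps S (T * T') := by
  intro y x hyx w hw
  rw [Matrix.mul_apply] at hyx
  obtain ⟨z, -, hz⟩ := Finset.exists_ne_zero_of_sum_ne_zero hyx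
  rw [h y z (left_ne_zero_of_mul hz) w hw, h' z x (right_ne_zero_of_mul hz) w hw]

theorem keeps_parallelOp {κ : Type} [Fintype κ] {a : κ → W}
    (G : (W → Bool) → κ → Matrix Bool Bool ℂ) (hS : ∀ ν, a ν ∉ S) : Keeps S (parallelOp a G) := by
  intro y x hyx w hw
  by_cases h : ∀ w, w ∉ Set.range a → y w = x w
  · refine h w ?_
    rintro ⟨ν, rfl⟩
    exact hS ν hw
  · exact absurd (parallelOp_apply_of_not h) hyx

theorem keeps_basisOp {f : (W → Bool) → (W → Bool)} (h : ∀ x, ∀ w ∈ S, f x w = x w) :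
    Keeps S (basisOp f) := by
  intro y x hyx w hw
  have e : y = f x := by
    by_contra hne
    exact hyx (by simp [basisOp, hne])
  rw [e, h x w hw]

theorem basisOp_mul_apply {f : (W → Bool) → (W → Bool)} (hf : Function.Injective f)
    (w x : W → Bool) : (basisOp f * T) (f w) x = T w x := by
  rw [Matrix.mul_apply, Finset.sum_eq_single w]
  · simp [basisOp]
  · intro z _ hz
    have : f w ≠ f z := fun e => hz (hf e).symm
    simp [basisOp, this]
  · simp

end Keeps

/-! ### The action of load – SPF – unload -/

section Stage

variable {W : Type} [Fintype W] [DecidableEq W] {k : ℕ} {d : Fin k → W} {a f : Node k → W}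

/-- The wires `f` negated. -/
def flipAll (f : Node k → W) (x : W → Bool) : W → Bool := overwrite f x fun ν => !x (f ν)

theorem flipAll_apply (hf : Function.Injective f) (x : W → Bool) (ν : Node k) :
    flipAll f x (f ν) = !x (f ν) := overwrite_apply hf _ _ _

theorem flipAll_of_notMem (x : W → Bool) {w : W} (hw : w ∉ Set.range f) : flipAll f x w = x w :=
  overwrite_of_notMem _ _ hw

theorem flipAll_flipAll (hf : Function.Injective f) (x : W → Bool) :
    flipAll f (flipAll f x) = x := by
  ext w
  by_cases hw : w ∈ Set.range f
  · obtain ⟨ν, rfl⟩ := hw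
    rw [flipAll_apply hf, flipAll_apply hf, Bool.not_not]
  · rw [flipAll_of_notMem _ hw, flipAll_of_notMem _ hw]

theorem xAll_eq_basisOp (hf : Function.Injective f) : xAll f = basisOp (flipAll f) := by
  ext y x
  simp only [xAll, basisOp, Matrix.of_apply]
  by_cases h : ∀ w, w ∉ Set.range f → y w = x w
  · rw [parallelOp_apply_of h]
    split_ifs with e
    · refine Finset.prod_eq_one fun ν _ => ?_
      rw [e, flipAll_apply hf]
      simp
    · by_contra hne
      rw [← ne_eq, Finset.prod_ne_zero_iff] at hne
      refine e (funext fun w => ?_)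
      by_cases hw : w ∈ Set.range f
      · obtain ⟨ν, rfl⟩ := hw
        rw [flipAll_apply hf]
        have := hne ν (Finset.mem_univ _)
        simp only [Matrix.of_apply] at this
        revert this
        cases y (f ν) <;> cases x (f ν) <;> simp
      · rw [flipAll_of_notMem _ hw, h w hw]
  · rw [parallelOp_apply_of_not h, if_neg]
    rintro rfl
    exact h fun w hw => flipAll_of_notMem _ hw

theorem xAll_conj_parallelOp (hf : Function.Injective f) (haf : ∀ ν ν', a ν ≠ f ν')
    (G : (W → Bool) → Node k → Matrix Bool Bool ℂ) :
    xAll f * parallelOp a G * xAll f = parallelOp a fun x => G (flipAll f x) := by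
  have h := basisOp_conj_parallelOp (a := a) (flipAll f)
    (fun x y e => by rw [← flipAll_flipAll hf x, e, flipAll_flipAll hf])
    (fun x ν => flipAll_of_notMem _ fun ⟨ν', e⟩ => haf ν ν' e.symm)
    (fun x y h w hw => by
      by_cases hwf : w ∈ Set.range f
      · obtain ⟨ν, rfl⟩ := hwf
        rw [flipAll_apply hf, flipAll_apply hf, h _ hw]
      · rw [flipAll_of_notMem _ hwf, flipAll_of_notMem _ hwf, h _ hw]) G
  rwa [basisOp_conjTranspose_of_leftInverse (flipAll_flipAll hf) (flipAll_flipAll hf),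
    ← xAll_eq_basisOp hf] at h

theorem xAll_mul_xAll (hf : Function.Injective f) : xAll f * xAll f = 1 := by
  refine matrix_ext_ket fun x => ?_
  rw [← Matrix.mulVec_mulVec, xAll_eq_basisOp hf, basisOp_mulVec_ket, basisOp_mulVec_ket,
    flipAll_flipAll hf, Matrix.one_mulVec]

/-- SPF is characterised by `Routed`, a relation on data and tree wires that merely preserves the
flags. -/
theorem spfMap_flipAll (h : Layout d a) (hf : Function.Injective f) (hdf : ∀ i ν, d i ≠ f ν)
    (haf : ∀ ν ν', a ν ≠ f ν') (x : W → Bool) :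
    spfMap d a (flipAll f x) = flipAll f (spfMap d a x) := by
  have hr := routed_spfMap h x
  have hd : ∀ (z : W → Bool) i, flipAll f z (d i) = z (d i) := fun z i =>
    flipAll_of_notMem _ fun ⟨ν, e⟩ => hdf i ν e.symm
  have ha : ∀ (z : W → Bool) ν, flipAll f z (a ν) = z (a ν) := fun z ν =>
    flipAll_of_notMem _ fun ⟨ν', e⟩ => haf ν ν' e.symm
  refine spfMap_of_routed h ⟨fun s => ?_, fun s p => ?_, fun w hw1 hw2 => ?_⟩
  · simp only [hd, ha]
    exact hr.data s
  · simp only [hd, ha]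
    exact hr.tree s p
  · by_cases hw : w ∈ Set.range f
    · obtain ⟨ν, rfl⟩ := hw
      rw [flipAll_apply hf, flipAll_apply hf, hr.off _ hw1 hw2]
    · rw [flipAll_of_notMem _ hw, flipAll_of_notMem _ hw, hr.off _ hw1 hw2]

theorem xAll_conj_spf (h : Layout d a) (hf : Function.Injective f) (hdf : ∀ i ν, d i ≠ f ν)
    (haf : ∀ ν ν', a ν ≠ f ν') :
    xAll f * basisOp (spfMap d a) * xAll f = basisOp (spfMap d a) := by
  refine matrix_ext_ket fun x => ?_
  rw [← Matrix.mulVec_mulVec, ← Matrix.mulVec_mulVec, xAll_eq_basisOp hf, basisOp_mulVec_ket,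
    basisOp_mulVec_ket, basisOp_mulVec_ket, basisOp_mulVec_ket, spfMap_flipAll h hf hdf haf,
    flipAll_flipAll hf]

/-- FLAG changes flags only, in a way that depends on data and flags but not on the targets.
Conjugation therefore just evaluates the controls at the flagged state. -/
theorem flag_conj_parallelOp (h : Layout d f) (hda : ∀ i ν, d i ≠ a ν)
    (haf : ∀ ν ν', a ν ≠ f ν') (G : (W → Bool) → Node k → Matrix Bool Bool ℂ) :
    (basisOp (flagMap d f))ᴴ * parallelOp a G * basisOp (flagMap d f) =
      parallelOp a fun x => G (flagMap d f x) := by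
  have hoff : ∀ x y : W → Bool, (∀ w, w ∉ Set.range a → y w = x w) → ∀ w, w ∉ Set.range a →
      flagMap d f y w = flagMap d f x w := by
    intro x y e w hw
    have hd : (fun i => y (d i)) = fun i => x (d i) :=
      funext fun i => e _ fun ⟨ν, hν⟩ => hda i ν hν.symm
    by_cases hwf : w ∈ Set.range f
    · obtain ⟨⟨s, j⟩, rfl⟩ := hwf
      rw [flagMap_apply h, flagMap_apply h, hd, e _ fun ⟨ν, hν⟩ => haf _ _ hν]
    · rw [flagMap_of_notMem h _ hwf, flagMap_of_notMem h _ hwf, e w hw]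
  refine basisOp_conj_parallelOp _ (fun x y e => ?_)
    (fun x ν => flagMap_of_notMem h _ fun ⟨ν', e⟩ => haf ν ν' e.symm) hoff G
  have hn : ∀ w, w ∉ Set.range f → x w = y w := fun w hw => by
    rw [← flagMap_of_notMem h x hw, e, flagMap_of_notMem h y hw]
  have hd : (fun i => x (d i)) = fun i => y (d i) :=
    funext fun i => hn _ (notMem_range_tree h i)
  ext w
  by_cases hw : w ∈ Set.range f
  · obtain ⟨⟨s, j⟩, rfl⟩ := hw
    have e' := congrFun e (f ⟨s, netOf (fun i => x (d i)) s j⟩)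
    rw [flagMap_apply h, flagMap_apply h, hd, Bool.xor_left_inj] at e'
    simpa using e'
  · exact hn w hw

/-- The matrix elements of load – SPF – unload when exactly the angles off the path are
unloaded. -/
theorem load_spf_unload_apply (h : Layout d a) {H G : (W → Bool) → Node k → Matrix Bool Bool ℂ}
    {g : Node k → Matrix Bool Bool ℂ} (hg : ∀ ν, (g ν)ᴴ * g ν = 1) {y x : W → Bool}
    (hH : ∀ w, (∀ v, v ∉ Set.range a → w v = y v) → ∀ ν, H w ν =
      if ν.2 = pathFin (fun i => y (d i)) ν.1 then 1 else (g ν)ᴴ)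
    (hG : ∀ ν, G x ν = g ν) (hoff : ∀ w, w ∉ Set.range d → w ∉ Set.range a → y w = x w) :
    (parallelOp a H * basisOp (spfMap d a) * parallelOp a G) y x =
      ∏ ν, if ν.2 = pathFin (fun i => y (d i)) ν.1 then
          (if y (a ν) = x (d ν.1) then g ν (y (d ν.1)) (x (a ν)) else 0)
        else if y (a ν) = x (a ν) then 1 else 0 := by
  classical
  have hy : ∀ b : Node k → Bool, ∀ w, w ∉ Set.range a → overwrite a y b w = y w :=
    fun b w hw => overwrite_of_notMem _ _ hw
  have hyd : ∀ (b : Node k → Bool), (fun i => overwrite a y b (d i)) = fun i => y (d i) :=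
    fun b => funext fun i => hy b _ (notMem_range_tree h i)
  have hyd' : ∀ (b : Node k → Bool) i, overwrite a y b (d i) = y (d i) :=
    fun b i => hy b _ (notMem_range_tree h i)
  rw [Matrix.mul_assoc, Matrix.mul_apply, sum_eq_sum_overwrite h.a_inj y _ fun z hz => by
    rw [parallelOp_apply_of_not fun e => hz fun w hw => (e w hw).symm, zero_mul]]
  -- The state between SPF and unloading is `y` with tree bits `b`, and its preimage under SPF is
  -- given explicitly by `Routed`. Each summand thus becomes a product over nodes.
  have key : ∀ b : Node k → Bool, parallelOp a H y (overwrite a y b) *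
      (basisOp (spfMap d a) * parallelOp a G) (overwrite a y b) x =
      ∏ ν, if ν.2 = pathFin (fun i => y (d i)) ν.1 then
          (1 : Matrix Bool Bool ℂ) (y (a ν)) (b ν) *
            (if b ν = x (d ν.1) then g ν (y (d ν.1)) (x (a ν)) else 0)
        else (g ν)ᴴ (y (a ν)) (b ν) * g ν (b ν) (x (a ν)) := by
    intro b
    obtain ⟨z, hz⟩ := exists_routed h (overwrite a y b)
    have hzd : ∀ s : Fin k, z (d s) = b ⟨s, pathFin (fun i => y (d i)) s⟩ := fun s => by
      rw [hz.data, overwrite_apply h.a_inj, hyd]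
    have hza : ∀ ν, z (a ν) = if ν.2 = pathFin (fun i => y (d i)) ν.1 then y (d ν.1) else b ν := by
      rintro ⟨s, p⟩
      rw [hz.tree, overwrite_apply h.a_inj, hyd, hyd']
    have hbm : (basisOp (spfMap d a) * parallelOp a G) (overwrite a y b) x =
        parallelOp a G z x := by
      conv_lhs => rw [← spfMap_of_routed h hz]
      exact basisOp_mul_apply (spfMap_injective h) z x
    rw [parallelOp_apply_of fun w hw => (hy b w hw).symm, hbm]
    by_cases hb : ∀ s : Fin k, b ⟨s, pathFin (fun i => y (d i)) s⟩ = x (d s)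
    · rw [parallelOp_apply_of, ← Finset.prod_mul_distrib]
      · refine Finset.prod_congr rfl fun ν _ => ?_
        rw [hH _ (hy b), hG, hza, overwrite_apply h.a_inj]
        obtain ⟨s, p⟩ := ν
        by_cases hp : p = pathFin (fun i => y (d i)) s
        · subst hp
          simp [hb]
        · simp [hp]
      · intro w hw
        by_cases hwd : w ∈ Set.range d
        · obtain ⟨s, rfl⟩ := hwd
          rw [hzd, hb]
        · rw [hz.off w hwd hw, hy b w hw, hoff w hwd hw]
    · push Not at hb
      obtain ⟨s, hs⟩ := hb
      rw [parallelOp_apply_of_not, mul_zero, eq_comm]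
      · refine Finset.prod_eq_zero (Finset.mem_univ ⟨s, pathFin (fun i => y (d i)) s⟩) ?_
        simp [hs]
      · intro e
        refine hs ?_
        rw [← hzd, e _ (notMem_range_tree h s)]
  simp only [key]
  -- The sum over all `b` of products over nodes is the product over nodes of sums over a single
  -- bit.
  rw [← Fintype.piFinset_univ, ← Finset.prod_univ_sum (fun _ => Finset.univ) fun ν c =>
    if ν.2 = pathFin (fun i => y (d i)) ν.1 then
          (1 : Matrix Bool Bool ℂ) (y (a ν)) c *
            (if c = x (d ν.1) then g ν (y (d ν.1)) (x (a ν)) else 0)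
        else (g ν)ᴴ (y (a ν)) c * g ν c (x (a ν))]
  refine Finset.prod_congr rfl fun ν _ => ?_
  split_ifs with h1 h2 h2
  · rw [Finset.sum_eq_single (y (a ν))]
    · simp [h2]
    · intro c _ hc
      rw [Matrix.one_apply_ne hc.symm, zero_mul]
    · simp
  · refine Finset.sum_eq_zero fun c _ => ?_
    by_cases hc : y (a ν) = c
    · rw [if_neg (hc ▸ h2), mul_zero]
    · rw [Matrix.one_apply_ne hc, zero_mul]
  -- Off the path the bit is loaded and unloaded by inverse operators.
  · rw [← Matrix.mul_apply, hg, h2, Matrix.one_apply_eq]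
  · rw [← Matrix.mul_apply, hg, Matrix.one_apply_ne h2]

/-- X sets all clean flags, and FLAG flips back exactly the one on the path in each part. Unloading
is thereby switched on exactly off the path. -/
theorem flagMap_flipAll (h : Layout d f) {y : W → Bool} (hy : ∀ ν, y (f ν) = false) (ν : Node k) :
    flagMap d f (flipAll f y) (f ν) = !decide (ν.2 = pathFin (fun i => y (d i)) ν.1) := by
  obtain ⟨s, p⟩ := ν
  have hd : (fun i => flipAll f y (d i)) = fun i => y (d i) :=
    funext fun i => flipAll_of_notMem _ (notMem_range_tree h i)
  rw [flagMap_apply h, flipAll_apply h.a_inj, hy, hd]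
  simp

end Stage

/-! ### Matrix elements of the two parts of the protocol -/

theorem Ry_conjTranspose (θ : ℝ) : (Ry θ)ᴴ = Ry (-θ) := by
  ext i j
  cases i <;> cases j <;> simp [Ry, Matrix.conjTranspose_apply, neg_div,
    -Complex.ofReal_cos, -Complex.ofReal_sin, Complex.conj_ofReal]

theorem Ry_conjTranspose_mul (θ : ℝ) : (Ry θ)ᴴ * Ry θ = 1 := by
  have h : (Real.cos (θ / 2) : ℂ) ^ 2 + (Real.sin (θ / 2) : ℂ) ^ 2 = 1 := by
    exact_mod_cast Real.cos_sq_add_sin_sq (θ / 2)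
  rw [Ry_conjTranspose]
  ext i j
  cases i <;> cases j <;> simp only [Ry, Matrix.mul_apply, Matrix.of_apply, Fintype.sum_bool,
    neg_div, Real.cos_neg, Real.sin_neg, Complex.ofReal_neg, neg_neg, Matrix.one_apply_eq,
    ne_eq, reduceCtorEq, not_false_eq_true, Matrix.one_apply_ne] <;>
    first | linear_combination h | ring

theorem norm_phase (z : ℂ) : ‖phase z‖ = 1 := by
  rw [phase]
  split_ifs with h
  · simp
  · simp [h]

theorem phase_mul_norm (z : ℂ) : phase z * (‖z‖ : ℂ) = z := by
  rw [phase]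
  split_ifs with h
  · simp [h]
  · have : (‖z‖ : ℂ) ≠ 0 := by simpa using h
    field_simp

theorem diagonal_conjTranspose_mul {c : Bool → ℂ} (hc : ∀ b, ‖c b‖ = 1) :
    (Matrix.diagonal c)ᴴ * Matrix.diagonal c = 1 := by
  rw [Matrix.diagonal_conjTranspose, Matrix.diagonal_mul_diagonal, ← Matrix.diagonal_one]
  congr 1
  ext b
  simp [mul_comm, Complex.mul_conj, Complex.normSq_eq_norm_sq, hc b]

section Protocol

variable {m r : ℕ} (ψ : (Fin (m + r) → Bool) → ℂ)

theorem rotCSP_conjTranspose_mul (k : ℕ) (ν : Node r) :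
    (rotCSP ψ k ν)ᴴ * rotCSP ψ k ν = 1 := by
  rw [rotCSP]
  split_ifs
  · rw [Matrix.conjTranspose_mul, Matrix.mul_assoc, ← Matrix.mul_assoc _ _ (Ry _),
      diagonal_conjTranspose_mul fun b => norm_phase _, Matrix.one_mul, Ry_conjTranspose_mul]
  · exact Ry_conjTranspose_mul _

theorem regA_injective : Function.Injective (Wire.regA : Node m → Wire m r) :=
  fun _ _ h => Wire.regA.inj h

theorem regB_injective : Function.Injective (Wire.regB : Node r → Wire m r) :=
  fun _ _ h => Wire.regB.inj h

theorem data_injective : Function.Injective (Wire.data : Fin (m + r) → Wire m r) :=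
  fun _ _ h => Wire.data.inj h

theorem dataSP_injective : Function.Injective (dataSP m r) := fun i j h => by
  simpa [dataSP] using h

theorem dataCSP_injective : Function.Injective (dataCSP m r) := fun i j h => by
  simpa [dataCSP] using h

theorem dataSP_ne_dataCSP (i : Fin m) (j : Fin r) : dataSP m r i ≠ dataCSP m r j := fun h => by
  have h := congrArg Fin.val (Wire.data.inj h)
  have := i.2
  simp at h
  omega

theorem flagSP_injective : Function.Injective (flagSP m r) := fun ν ν' h => by
  have h := node_ext_iff.1 (Wire.regF.inj h)
  exact node_ext_iff.2 h

theorem flagCSP_injective : Function.Injective (flagCSP m r) := fun ν ν' h => by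
  have h := node_ext_iff.1 (Wire.regF.inj h)
  exact node_ext_iff.2 h

theorem layout_regA : Layout (dataSP m r) Wire.regA :=
  ⟨dataSP_injective, regA_injective, by simp [dataSP]⟩

theorem layout_regB : Layout (dataCSP m r) Wire.regB :=
  ⟨dataCSP_injective, regB_injective, by simp [dataCSP]⟩

theorem layout_flagSP : Layout (dataSP m r) (flagSP m r) :=
  ⟨dataSP_injective, flagSP_injective, by simp [dataSP, flagSP]⟩

theorem layout_flagCSP : Layout (dataCSP m r) (flagCSP m r) :=
  ⟨dataCSP_injective, flagCSP_injective, by simp [dataCSP, flagCSP]⟩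

theorem unitarySP_eq : unitarySP ψ = parallelOp Wire.regA (fun x ν =>
      if flagMap (dataSP m r) (flagSP m r) (flipAll (flagSP m r) x) (flagSP m r ν) then
        Ry (-angleSP ψ ν) else 1) *
    basisOp (spfMap (dataSP m r) Wire.regA) * parallelOp Wire.regA (fun _ ν => Ry (angleSP ψ ν)) := by
  have h1 := flag_conj_parallelOp (a := Wire.regA) (layout_flagSP (m := m) (r := r))
    (by simp [dataSP]) (by simp [flagSP])
    (fun x ν => if x (flagSP m r ν) then Ry (-angleSP ψ ν) else 1)
  have h2 := xAll_conj_parallelOp (a := Wire.regA) (f := flagSP m r) flagSP_injective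
    (by simp [flagSP]) fun x ν => if flagMap (dataSP m r) (flagSP m r) x (flagSP m r ν) then
        Ry (-angleSP ψ ν) else 1
  rw [unitarySP, ← h2, ← h1]
  simp only [Matrix.mul_assoc]

theorem address_congr {x y : Wire m r → Bool} (h : ∀ i, x (dataSP m r i) = y (dataSP m r i)) :
    address m r x = address m r y := by
  simp only [address, h]

theorem address_eq_path (x : Wire m r → Bool) :
    address m r x = path (fun i => x (dataSP m r i)) m := by
  rw [path_eq_sum _ m le_rfl, address]
  refine Finset.sum_congr rfl fun i _ => ?_
  simp only [Fin.eta]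
  cases x (dataSP m r i) <;> simp

theorem indep_loadf : Indep (Wire.regB : Node r → Wire m r) fun x ν =>
    if x (flagCSP m r ν) then rotCSP ψ (address m r x) ν else 1 := by
  intro x y h
  funext ν
  beta_reduce
  rw [h (flagCSP m r ν) (by simp [flagCSP]),
    address_congr fun i => h (dataSP m r i) (by simp [dataSP])]

/-- Pairs of X layers are inserted between unloading, SPF and loading. SPF commutes with them, and
around the other two factors they only alter the control condition. -/
theorem unitaryCSP_eq : unitaryCSP ψ = parallelOp Wire.regB (fun x ν =>
      if flagMap (dataCSP m r) (flagCSP m r) (flipAll (flagCSP m r) x) (flagCSP m r ν) then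
        (rotCSP ψ (address m r x) ν)ᴴ else 1) *
    basisOp (spfMap (dataCSP m r) Wire.regB) * parallelOp Wire.regB (fun x ν =>
      if flipAll (flagCSP m r) x (flagCSP m r ν) then rotCSP ψ (address m r x) ν else 1) := by
  have a1 : ∀ x, address m r (flipAll (flagCSP m r) x) = address m r x := fun x =>
    address_congr fun i => flipAll_of_notMem _ (by simp [dataSP, flagCSP])
  have a2 : ∀ x, address m r (flagMap (dataCSP m r) (flagCSP m r) x) = address m r x := fun x =>
    address_congr fun i => flagMap_of_notMem layout_flagCSP _ (by simp [dataSP, flagCSP])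
  have h0 : (loadf ψ)ᴴ = parallelOp Wire.regB fun x ν =>
      if x (flagCSP m r ν) then (rotCSP ψ (address m r x) ν)ᴴ else 1 := by
    rw [loadf, parallelOp_conjTranspose _ (indep_loadf ψ)]
    refine parallelOp_congr fun x ν => ?_
    split_ifs
    · rfl
    · exact Matrix.conjTranspose_one
  have h1 := flag_conj_parallelOp (a := Wire.regB) (layout_flagCSP (m := m) (r := r))
    (by simp [dataCSP]) (by simp [flagCSP])
    (fun x ν => if x (flagCSP m r ν) then (rotCSP ψ (address m r x) ν)ᴴ else 1)
  have h2 := xAll_conj_parallelOp (a := Wire.regB) (f := flagCSP m r) flagCSP_injective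
    (by simp [flagCSP]) fun x ν => if flagMap (dataCSP m r) (flagCSP m r) x (flagCSP m r ν) then
        (rotCSP ψ (address m r x) ν)ᴴ else 1
  have h3 := xAll_conj_parallelOp (a := Wire.regB) (f := flagCSP m r) flagCSP_injective
    (by simp [flagCSP]) fun x ν => if x (flagCSP m r ν) then rotCSP ψ (address m r x) ν else 1
  have h4 := xAll_conj_spf (a := Wire.regB) (f := flagCSP m r) layout_regB flagCSP_injective
    (by simp [flagCSP, dataCSP]) (by simp [flagCSP])
  have hX := xAll_mul_xAll (flagCSP_injective (m := m) (r := r))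
  simp only [a1, a2] at h1 h2 h3
  rw [← h2, ← h1, ← h3, ← h4, unitaryCSP, h0, loadf]
  set X := xAll (flagCSP m r)
  have c : ∀ T : Matrix (Wire m r → Bool) (Wire m r → Bool) ℂ, X * (X * T) = T := fun T => by
    rw [← Matrix.mul_assoc, hX, Matrix.one_mul]
  simp only [Matrix.mul_assoc, c]

/-- The flags are not changed by the protocol. -/
theorem unitarySP_keeps :
    Keeps {w | w ∉ Set.range (dataSP m r) ∧ w ∉ Set.range Wire.regA} (unitarySP ψ) := by
  rw [unitarySP_eq]
  refine Keeps.mul (Keeps.mul (keeps_parallelOp _ fun ν h => h.2 ⟨ν, rfl⟩)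
    (keeps_basisOp fun x w hw => ((routed_spfMap layout_regA x).off w hw.1 hw.2).symm))
    (keeps_parallelOp _ fun ν h => h.2 ⟨ν, rfl⟩)

theorem unitaryCSP_keeps :
    Keeps {w | w ∉ Set.range (dataCSP m r) ∧ w ∉ Set.range Wire.regB} (unitaryCSP ψ) := by
  rw [unitaryCSP_eq]
  refine Keeps.mul (Keeps.mul (keeps_parallelOp _ fun ν h => h.2 ⟨ν, rfl⟩)
    (keeps_basisOp fun x w hw => ((routed_spfMap layout_regB x).off w hw.1 hw.2).symm))
    (keeps_parallelOp _ fun ν h => h.2 ⟨ν, rfl⟩)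

theorem unitarySP_apply {y x : Wire m r → Bool} (hF : ∀ ν, y (.regF ν) = false)
    (hoff : ∀ w, w ∉ Set.range (dataSP m r) → w ∉ Set.range Wire.regA → y w = x w) :
    unitarySP ψ y x = ∏ ν : Node m,
      if ν.2 = pathFin (fun i => y (dataSP m r i)) ν.1 then
        (if y (.regA ν) = x (dataSP m r ν.1) then
          Ry (angleSP ψ ν) (y (dataSP m r ν.1)) (x (.regA ν)) else 0)
      else if y (.regA ν) = x (.regA ν) then 1 else 0 := by
  rw [unitarySP_eq]
  refine load_spf_unload_apply layout_regA (g := fun ν => Ry (angleSP ψ ν))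
    (fun ν => Ry_conjTranspose_mul _) (fun w hw ν => ?_) (fun _ => rfl) hoff
  rw [flagMap_flipAll layout_flagSP fun ν => by
    rw [hw _ (by simp [flagSP])]
    exact hF _]
  have hd : (fun i => w (dataSP m r i)) = fun i => y (dataSP m r i) :=
    funext fun i => hw _ (by simp [dataSP])
  rw [hd]
  by_cases h : ν.2 = pathFin (fun i => y (dataSP m r i)) ν.1
  · simp [h]
  · simp [h, Ry_conjTranspose]

theorem unitaryCSP_apply {y x : Wire m r → Bool} (hF : ∀ ν, y (.regF ν) = false)
    (hoff : ∀ w, w ∉ Set.range (dataCSP m r) → w ∉ Set.range Wire.regB → y w = x w) :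
    unitaryCSP ψ y x = ∏ ν : Node r,
      if ν.2 = pathFin (fun i => y (dataCSP m r i)) ν.1 then
        (if y (.regB ν) = x (dataCSP m r ν.1) then
          rotCSP ψ (address m r y) ν (y (dataCSP m r ν.1)) (x (.regB ν)) else 0)
      else if y (.regB ν) = x (.regB ν) then 1 else 0 := by
  rw [unitaryCSP_eq]
  refine load_spf_unload_apply layout_regB (g := fun ν => rotCSP ψ (address m r y) ν)
    (fun ν => rotCSP_conjTranspose_mul _ _ _) (fun w hw ν => ?_) (fun ν => ?_) hoff
  · rw [flagMap_flipAll layout_flagCSP fun ν => by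
      rw [hw _ (by simp [flagCSP])]
      exact hF _]
    have hd : (fun i => w (dataCSP m r i)) = fun i => y (dataCSP m r i) :=
      funext fun i => hw _ (by simp [dataCSP])
    rw [hd, address_congr fun i => hw (dataSP m r i) (by simp [dataSP])]
    by_cases h : ν.2 = pathFin (fun i => y (dataCSP m r i)) ν.1
    · simp [h]
    · simp [h]
  · rw [flipAll_apply flagCSP_injective, ← hoff _ (by simp [dataCSP, flagCSP]) (by simp [flagCSP]),
      flagCSP, hF, address_congr fun i => hoff (dataSP m r i) ?_ (by simp [dataSP])]
    · rfl
    · rintro ⟨j, e⟩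
      exact dataSP_ne_dataCSP _ _ e.symm

end Protocol

/-! ### Binary expansions and tree angles -/

section Tree

theorem testBit_path {k : ℕ} (β : Fin k → Bool) (s : ℕ) (hs : s ≤ k) (i : Fin s) :
    (path β s).testBit (s - 1 - (i : ℕ)) = β ⟨i, i.2.trans_le hs⟩ := by
  induction s with
  | zero => exact i.elim0
  | succ s ih =>
    have e := path_succ β ⟨s, hs⟩
    simp only at e
    rw [e]
    have hb := Bool.toNat_le (β ⟨s, hs⟩)
    by_cases hi : (i : ℕ) = s
    · have h0 : s + 1 - 1 - (i : ℕ) = 0 := by omega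
      have h1 : (⟨i, i.2.trans_le hs⟩ : Fin k) = ⟨s, hs⟩ := Fin.ext hi
      rw [h0, h1, Nat.testBit_zero]
      cases β ⟨s, hs⟩ <;> simp
    · have hi' : (i : ℕ) < s := by
        have := i.2
        omega
      have h0 : s + 1 - 1 - (i : ℕ) = (s - 1 - (i : ℕ)) + 1 := by omega
      have h1 : (2 * path β s + (β ⟨s, hs⟩).toNat) / 2 = path β s := by omega
      rw [h0, Nat.testBit_succ, h1]
      exact ih (by omega) ⟨i, hi'⟩

theorem amplitude_path {n : ℕ} (ψ : (Fin n → Bool) → ℂ) (z : Fin n → Bool) :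
    amplitude ψ (path z n) = ψ z := by
  rw [amplitude]
  congr 1
  funext i
  exact testBit_path z n le_rfl i

theorem path_add {m r : ℕ} (z : Fin (m + r) → Bool) (s : ℕ) (hs : s ≤ r) :
    path z (m + s) = path (fun i : Fin m => z (Fin.castAdd r i)) m * 2 ^ s +
      path (fun i : Fin r => z (Fin.natAdd m i)) s := by
  induction s with
  | zero =>
    have key : ∀ t ≤ m, path z t = path (fun i : Fin m => z (Fin.castAdd r i)) t := by
      intro t
      induction t with
      | zero => intro _; rfl
      | succ t ih =>
        intro ht
        have e1 := path_succ z ⟨t, by omega⟩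
        have e2 := path_succ (fun i : Fin m => z (Fin.castAdd r i)) ⟨t, ht⟩
        simp only at e1 e2
        rw [e1, e2, ih (by omega)]
        rfl
    rw [Nat.add_zero, key m le_rfl, pow_zero, mul_one]
    rfl
  | succ s ih =>
    have e1 := path_succ z ⟨m + s, by omega⟩
    have e2 := path_succ (fun i : Fin r => z (Fin.natAdd m i)) ⟨s, hs⟩
    simp only at e1 e2
    rw [← Nat.add_assoc, e1, e2, ih (by omega), pow_succ]
    have e3 : Fin.natAdd m (⟨s, hs⟩ : Fin r) = ⟨m + s, by omega⟩ := rfl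
    rw [e3]
    ring

theorem sum_amplitude {n : ℕ} (ψ : (Fin n → Bool) → ℂ) :
    ∑ j ∈ Finset.range (2 ^ n), ‖amplitude ψ j‖ ^ 2 = ∑ z, ‖ψ z‖ ^ 2 := by
  have hinj : Function.Injective fun z : Fin n → Bool => pathFin z n := by
    intro z z' e
    have e := Fin.ext_iff.1 e
    simp only [pathFin] at e
    funext i
    rw [← testBit_path z n le_rfl i, e, testBit_path z' n le_rfl i]
  have hbij : Function.Bijective fun z : Fin n → Bool => pathFin z n :=
    (Fintype.bijective_iff_injective_and_card _).2 ⟨hinj, by simp⟩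
  rw [← Fin.sum_univ_eq_sum_range (fun j => ‖amplitude ψ j‖ ^ 2), ← hbij.sum_comp]
  simp only [pathFin, amplitude_path]

theorem sum_range_mul_add (F : ℕ → ℝ) (M Q : ℕ) :
    ∑ i ∈ Finset.range M, ∑ l ∈ Finset.range Q, F (i * Q + l) = ∑ j ∈ Finset.range (M * Q), F j := by
  induction M with
  | zero => simp
  | succ M ih => rw [Finset.sum_range_succ, ih, Nat.succ_mul, Finset.sum_range_add]

/-- The norm of the weights below the node `(s, p)`. -/
def treeNorm (k : ℕ) (v : ℕ → ℝ) (s p : ℕ) : ℝ :=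
  √(∑ l ∈ Finset.range (2 ^ (k - s)), v (p * 2 ^ (k - s) + l) ^ 2)

/-- The cosine of the half angle is the norm of the left child divided by that of the parent, and
the sine gives the right child by Pythagoras. Multiplying by the parent norm instead of dividing
covers the degenerate case, in which both children vanish and the angle is irrelevant. -/
theorem treeNorm_mul_Ry {k : ℕ} (v : ℕ → ℝ) {s : ℕ} (hs : s < k) (p : ℕ) (b : Bool) :
    (treeNorm k v s p : ℂ) * Ry (treeAngle k v s p) b false =
      (treeNorm k v (s + 1) (2 * p + b.toNat) : ℂ) := by
  have hk : k - s = k - s - 1 + 1 := by omega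
  have hk' : k - (s + 1) = k - s - 1 := by omega
  set K := k - s - 1 with hK
  set A := ∑ l ∈ Finset.range (2 ^ K), v (p * 2 ^ (k - s) + l) ^ 2 with hA
  set B := ∑ l ∈ Finset.range (2 ^ K), v (p * 2 ^ (k - s) + (2 ^ K + l)) ^ 2 with hB
  have hAB : ∑ l ∈ Finset.range (2 ^ (k - s)), v (p * 2 ^ (k - s) + l) ^ 2 = A + B := by
    rw [hA, hB]
    conv_lhs => rw [show Finset.range (2 ^ (k - s)) = Finset.range (2 ^ K + 2 ^ K) by
      rw [hk, pow_succ, mul_two]]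
    rw [Finset.sum_range_add]
  have hA0 : 0 ≤ A := Finset.sum_nonneg fun _ _ => sq_nonneg _
  have hB0 : 0 ≤ B := Finset.sum_nonneg fun _ _ => sq_nonneg _
  have h1 : treeNorm k v s p = √(A + B) := by rw [treeNorm, hAB]
  have h2 : treeNorm k v (s + 1) (2 * p) = √A := by
    rw [treeNorm, hk', hA]
    have e : 2 * p * 2 ^ K = p * 2 ^ (k - s) := by
      rw [hk, pow_succ]
      ring
    rw [e]
  have h3 : treeNorm k v (s + 1) (2 * p + 1) = √B := by
    rw [treeNorm, hk', hB]
    have e : ∀ l, (2 * p + 1) * 2 ^ K + l = p * 2 ^ (k - s) + (2 ^ K + l) := fun l => by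
      rw [hk, pow_succ]
      ring
    simp only [e]
  have h4 : treeAngle k v s p / 2 = Real.arccos (√A / √(A + B)) := by
    rw [treeAngle, hAB, ← hK, ← hA]
    ring
  have hq0 : 0 ≤ √A / √(A + B) := by positivity
  have hq1 : √A / √(A + B) ≤ 1 :=
    div_le_one_of_le₀ (Real.sqrt_le_sqrt (by linarith)) (Real.sqrt_nonneg _)
  by_cases hz : A + B = 0
  · have hAz : A = 0 := by linarith
    have hBz : B = 0 := by linarith
    rw [h1, hz, Real.sqrt_zero]
    cases b
    · simp [h2, hAz]
    · simp [h3, hBz]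
  · have hpos : 0 < A + B := lt_of_le_of_ne (by linarith) (Ne.symm hz)
    have hs0 : √(A + B) ≠ 0 := (Real.sqrt_pos.2 hpos).ne'
    cases b
    · simp only [Ry, Matrix.of_apply, Bool.toNat_false, add_zero]
      rw [h1, h2, h4, Real.cos_arccos (by linarith) hq1, ← Complex.ofReal_mul,
        mul_div_cancel₀ _ hs0]
    · simp only [Ry, Matrix.of_apply, Bool.toNat_true]
      rw [h1, h3, h4, Real.sin_arccos, ← Complex.ofReal_mul, ← Real.sqrt_mul hpos.le, div_pow,
        Real.sq_sqrt hA0, Real.sq_sqrt hpos.le]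
      congr 2
      field_simp
      ring

theorem treeNorm_mul_prod {k : ℕ} (v : ℕ → ℝ) (β : Fin k → Bool) (j : ℕ) (hj : j ≤ k) :
    (treeNorm k v 0 0 : ℂ) * ∏ s : Fin j,
      Ry (treeAngle k v s (path β s)) (β ⟨s, s.2.trans_le hj⟩) false =
        (treeNorm k v j (path β j) : ℂ) := by
  induction j with
  | zero => simp [path]
  | succ j ih =>
    rw [Fin.prod_univ_castSucc, ← mul_assoc]
    have e := path_succ β ⟨j, hj⟩
    simp only at e
    rw [e, ← treeNorm_mul_Ry v hj, ← ih (by omega)]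
    rfl

theorem treeNorm_leaf (k : ℕ) {v : ℕ → ℝ} (hv : ∀ l, 0 ≤ v l) (p : ℕ) :
    treeNorm k v k p = v p := by
  simp [treeNorm, Real.sqrt_sq (hv p)]

end Tree

/-! ### The prepared state -/

section Prepare

variable {m r : ℕ} (ψ : (Fin (m + r) → Bool) → ℂ)

theorem rotCSP_apply_false (k : ℕ) (ν : Node r) (b : Bool) :
    rotCSP ψ k ν b false = (if (ν.1 : ℕ) + 1 = r then
      phase (amplitude ψ (k * 2 ^ r + (2 * (ν.2 : ℕ) + b.toNat))) else 1) *
        Ry (angleCSP ψ k ν) b false := by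
  rw [rotCSP]
  split_ifs
  · rw [Matrix.diagonal_mul]
    cases b <;> rfl
  · rw [one_mul]

/-- The product telescopes from the root, whose norm is `1` by normalisation, to the leaf reached by
the path. -/
theorem prod_angleSP (hψ : ∑ z, ‖ψ z‖ ^ 2 = 1) (β : Fin m → Bool) :
    ∏ s : Fin m, Ry (angleSP ψ ⟨s, pathFin β s⟩) (β s) false = (blockNorm ψ (path β m) : ℂ) := by
  have h := treeNorm_mul_prod (blockNorm ψ) β m le_rfl
  rw [treeNorm_leaf m (v := blockNorm ψ) (fun l => Real.sqrt_nonneg _)] at h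
  have h0 : treeNorm m (blockNorm ψ) 0 0 = 1 := by
    rw [treeNorm, Real.sqrt_eq_one]
    simp only [zero_mul, zero_add, Nat.sub_zero]
    have e : ∀ i, blockNorm ψ i ^ 2 =
        ∑ l ∈ Finset.range (2 ^ r), ‖amplitude ψ (i * 2 ^ r + l)‖ ^ 2 := fun i =>
      Real.sq_sqrt (Finset.sum_nonneg fun _ _ => sq_nonneg _)
    simp only [e]
    rw [sum_range_mul_add fun j => ‖amplitude ψ j‖ ^ 2, ← pow_add, sum_amplitude, hψ]
  rw [h0, Complex.ofReal_one, one_mul] at h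
  exact h

/-- The moduli telescope from the block norm to the modulus of the amplitude. The statement involves
no division, so vanishing blocks need no separate treatment. -/
theorem prod_rotCSP (hr : 1 ≤ r) (k : ℕ) (β : Fin r → Bool) :
    (blockNorm ψ k : ℂ) * ∏ s : Fin r, rotCSP ψ k ⟨s, pathFin β s⟩ (β s) false =
      amplitude ψ (k * 2 ^ r + path β r) := by
  have h := treeNorm_mul_prod (fun l => ‖amplitude ψ (k * 2 ^ r + l)‖) β r le_rfl
  rw [treeNorm_leaf r (fun l => norm_nonneg _)] at h
  have h0 : treeNorm r (fun l => ‖amplitude ψ (k * 2 ^ r + l)‖) 0 0 = blockNorm ψ k := by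
    simp [treeNorm, blockNorm]
  rw [h0] at h
  simp only [rotCSP_apply_false]
  -- Phases occur at the last level only, which exists because `r ≥ 1`; otherwise no qubit of `B`
  -- could supply them.
  rw [Finset.prod_mul_distrib, Fintype.prod_eq_single (⟨r - 1, by omega⟩ : Fin r)]
  · rw [if_pos (by simp only; omega)]
    have e := path_succ β ⟨r - 1, by omega⟩
    simp only at e
    rw [Nat.sub_add_cancel hr] at e
    have e' : 2 * ((pathFin β (r - 1) : Fin _) : ℕ) + (β ⟨r - 1, by omega⟩).toNat = path β r :=
      e.symm
    simp only [e']
    rw [mul_left_comm]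
    refine Eq.trans (congrArg _ h) (phase_mul_norm _)
  · intro s hs
    rw [if_neg]
    intro e
    refine hs (Fin.ext ?_)
    simp only at e ⊢
    omega

theorem prod_path {k : ℕ} (β : Fin k → Bool) (F : Node k → ℂ) :
    (∏ ν : Node k, if ν.2 = pathFin β ν.1 then F ν else 1) = ∏ s : Fin k, F ⟨s, pathFin β s⟩ := by
  rw [Fintype.prod_sigma]
  refine Finset.prod_congr rfl fun s _ => ?_
  simp

/-- A nonzero product has nonzero factors. Those on the path say that the ancilla there received the
old data bit; for zero input all factors force clean ancillae. -/
theorem unitarySP_support {y x : Wire m r → Bool} (hF : ∀ ν, x (.regF ν) = false)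
    (h : unitarySP ψ y x ≠ 0) : (∀ s : Fin m, y (.regA ⟨s, pathFin (fun i => y (dataSP m r i)) s⟩) =
      x (dataSP m r s)) ∧ ((∀ i, x (dataSP m r i) = false) → (∀ ν, x (.regA ν) = false) →
        ∀ ν, y (.regA ν) = false) := by
  have hk := unitarySP_keeps ψ y x h
  rw [unitarySP_apply ψ (fun ν => by rw [hk _ (by simp [dataSP]), hF])
    (fun w h1 h2 => hk w ⟨h1, h2⟩), Finset.prod_ne_zero_iff] at h
  refine ⟨fun s => ?_, fun h1 h2 ν => ?_⟩
  · have hs := h ⟨s, pathFin (fun i => y (dataSP m r i)) s⟩ (Finset.mem_univ _)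
    rw [if_pos rfl] at hs
    by_contra hne
    exact hs (if_neg hne)
  · have hs := h ν (Finset.mem_univ _)
    rw [h1, h2] at hs
    by_contra hne
    simp [hne] at hs

theorem unitaryCSP_support {y x : Wire m r → Bool} (hF : ∀ ν, x (.regF ν) = false)
    (h : unitaryCSP ψ y x ≠ 0) :
    (∀ s : Fin r, y (.regB ⟨s, pathFin (fun i => y (dataCSP m r i)) s⟩) =
      x (dataCSP m r s)) ∧ ((∀ i, x (dataCSP m r i) = false) → (∀ ν, x (.regB ν) = false) →
        ∀ ν, y (.regB ν) = false) := by
  have hk := unitaryCSP_keeps ψ y x h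
  rw [unitaryCSP_apply ψ (fun ν => by rw [hk _ (by simp [dataCSP]), hF])
    (fun w h1 h2 => hk w ⟨h1, h2⟩), Finset.prod_ne_zero_iff] at h
  refine ⟨fun s => ?_, fun h1 h2 ν => ?_⟩
  · have hs := h ⟨s, pathFin (fun i => y (dataCSP m r i)) s⟩ (Finset.mem_univ _)
    rw [if_pos rfl] at hs
    by_contra hne
    exact hs (if_neg hne)
  · have hs := h ν (Finset.mem_univ _)
    rw [h1, h2] at hs
    by_contra hne
    simp [hne] at hs

theorem dataSP_notMem_csp (i : Fin m) : dataSP m r i ∈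
    {w | w ∉ Set.range (dataCSP m r) ∧ w ∉ Set.range Wire.regB} :=
  ⟨fun ⟨j, e⟩ => dataSP_ne_dataCSP i j e.symm, by simp [dataSP]⟩

theorem dataCSP_notMem_sp (i : Fin r) : dataCSP m r i ∈
    {w | w ∉ Set.range (dataSP m r) ∧ w ∉ Set.range Wire.regA} :=
  ⟨fun ⟨j, e⟩ => dataSP_ne_dataCSP j i e, by simp [dataCSP]⟩

theorem forall_data {P : Wire m r → Prop} (i : Fin (m + r)) (h1 : ∀ i, P (dataSP m r i))
    (h2 : ∀ i, P (dataCSP m r i)) : P (.data i) := by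
  refine Fin.addCases (fun j => ?_) (fun j => ?_) i
  · exact h1 j
  · exact h2 j

/-- The protocol prepares `ψ`. -/
theorem prepUnitary_mulVec_zero (hr : 1 ≤ r) (hψ : ∑ z, ‖ψ z‖ ^ 2 = 1) :
    prepUnitary ψ *ᵥ inject Wire.data (ket fun _ => false) = inject Wire.data ψ := by
  classical
  have hx : embed (Wire.data : Fin (m + r) → Wire m r) (fun _ => false) = fun _ => false := by
    refine ((eq_embed_iff data_injective _ _).2 ⟨fun _ _ => rfl, rfl⟩).symm
  rw [inject_ket data_injective, hx]
  funext y
  rw [mulVec_ket, prepUnitary]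
  beta_reduce
  rw [Matrix.mul_apply]
  set x0 : Wire m r → Bool := fun _ => false with hx0
  have h1 : ∀ w, unitarySP ψ w x0 ≠ 0 → ∀ v, v ∉ Set.range (dataSP m r) → w v = false := by
    intro w hw v hv
    by_cases hA : v ∈ Set.range Wire.regA
    · obtain ⟨ν, rfl⟩ := hA
      exact (unitarySP_support ψ (fun _ => rfl) hw).2 (fun _ => rfl) (fun _ => rfl) ν
    · exact unitarySP_keeps ψ w x0 hw v ⟨hv, hA⟩
  by_cases hy : ∀ w, w ∉ Set.range (Wire.data : Fin (m + r) → Wire m r) → y w = false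
  · have hy' : ∀ v, (∀ i, v ≠ .data i) → y v = false := fun v hv =>
      hy v fun ⟨i, e⟩ => hv i e.symm
    rw [inject, if_pos hy]
    -- The only intermediate state that contributes: SP has written the first `m` bits of `y`, and
    -- everything else is zero.
    let w0 : Wire m r → Bool := fun v => if v ∈ Set.range (dataSP m r) then y v else false
    have hw0d : ∀ i, w0 (dataSP m r i) = y (dataSP m r i) := fun i => if_pos ⟨i, rfl⟩
    have hw0n : ∀ v, v ∉ Set.range (dataSP m r) → w0 v = false := fun v hv => if_neg hv
    rw [Finset.sum_eq_single w0]
    · have hB := unitaryCSP_apply ψ (y := y) (x := w0) (fun ν => hy' _ (by simp)) (by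
        intro v hv1 hv2
        by_cases hv : v ∈ Set.range (dataSP m r)
        · obtain ⟨i, rfl⟩ := hv
          rw [hw0d]
        · rw [hw0n v hv, hy']
          rintro i rfl
          exact forall_data (P := fun v => v ∉ Set.range (dataSP m r) →
            v ∉ Set.range (dataCSP m r) → False) i (fun i h _ => h ⟨i, rfl⟩)
              (fun i _ h => h ⟨i, rfl⟩) hv hv1)
      have hA := unitarySP_apply ψ (y := w0) (x := x0) (fun ν => hw0n _ (by simp [dataSP])) (by
        intro v hv1 hv2
        rw [hw0n v hv1])
      have e1 : ∀ ν, y (.regB ν) = false := fun ν => hy' _ (by simp)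
      have e2 : ∀ ν, w0 (.regB ν) = false := fun ν => hw0n _ (by simp [dataSP])
      have e3 : ∀ ν, w0 (.regA ν) = false := fun ν => hw0n _ (by simp [dataSP])
      have e4 : ∀ i, w0 (dataCSP m r i) = false := fun i => hw0n _ (dataCSP_notMem_sp i).1
      simp only [e1, e2, e4, if_true] at hB
      simp only [e3, hw0d, hx0, if_true] at hA
      rw [hA, hB, prod_path (fun i => y (dataCSP m r i)) (fun ν : Node r =>
          rotCSP ψ (address m r y) ν (y (dataCSP m r ν.1)) false),
        prod_path (fun i => y (dataSP m r i)) (fun ν : Node m =>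
          Ry (angleSP ψ ν) (y (dataSP m r ν.1)) false)]
      have p1 := prod_angleSP ψ hψ fun i => y (dataSP m r i)
      have p2 := prod_rotCSP ψ hr (address m r y) fun i => y (dataCSP m r i)
      simp only at p1 p2 ⊢
      -- Block norm times CSP product is the amplitude at block number times `2 ^ r` plus position
      -- in the block, which by `path_add` is the number spelled by all data bits.
      rw [p1, mul_comm, ← address_eq_path, p2, address_eq_path]
      rw [← amplitude_path ψ, path_add _ r le_rfl]
      rfl
    · intro w _ hw
      by_contra hne
      refine hw (funext fun v => ?_)
      by_cases hv : v ∈ Set.range (dataSP m r)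
      · obtain ⟨i, rfl⟩ := hv
        rw [hw0d, unitaryCSP_keeps ψ y w (left_ne_zero_of_mul hne) _ (dataSP_notMem_csp i)]
      · rw [hw0n v hv, h1 w (right_ne_zero_of_mul hne) v hv]
    · simp
  · rw [inject, if_neg hy]
    by_contra hne
    obtain ⟨w, -, hw⟩ := Finset.exists_ne_zero_of_sum_ne_zero hne
    have hw1 := h1 w (right_ne_zero_of_mul hw)
    refine hy fun v hv => ?_
    by_cases hB : v ∈ Set.range Wire.regB
    · obtain ⟨ν, rfl⟩ := hB
      exact (unitaryCSP_support ψ (fun ν => hw1 _ (by simp [dataSP])) (left_ne_zero_of_mul hw)).2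
        (fun i => hw1 _ (dataCSP_notMem_sp i).1) (fun ν => hw1 _ (by simp [dataSP])) ν
    · rw [unitaryCSP_keeps ψ y w (left_ne_zero_of_mul hw) v ⟨?_, hB⟩, hw1]
      · rintro ⟨i, rfl⟩
        exact hv ⟨_, rfl⟩
      · rintro ⟨i, rfl⟩
        exact hv ⟨_, rfl⟩

theorem prepUnitary_keeps_regF : Keeps (Set.range Wire.regF) (prepUnitary ψ) := by
  refine Keeps.mul (fun y x h w hw => unitaryCSP_keeps ψ y x h w ?_)
    fun y x h w hw => unitarySP_keeps ψ y x h w ?_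
  all_goals
    obtain ⟨ν, rfl⟩ := hw
    constructor <;> simp [dataSP, dataCSP]

/-- Nonzero data on input leave a trace in the ancilla registers. -/
theorem prepUnitary_dirty {y x : Wire m r → Bool} (hF : ∀ ν, x (.regF ν) = false)
    (hx : ∃ i, x (.data i) = true) (h : prepUnitary ψ y x ≠ 0) :
    (∃ ν, y (Wire.regA ν) = true) ∨ ∃ ν, y (Wire.regB ν) = true := by
  rw [prepUnitary, Matrix.mul_apply] at h
  obtain ⟨w, -, hw⟩ := Finset.exists_ne_zero_of_sum_ne_zero h
  have hw1 := left_ne_zero_of_mul hw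
  have hw2 := right_ne_zero_of_mul hw
  have k1 := unitaryCSP_keeps ψ y w hw1
  have k2 := unitarySP_keeps ψ w x hw2
  obtain ⟨i, hi⟩ := hx
  revert hi
  -- A bit among the first `m` is moved into `A` by SP, and CSP leaves `A` alone. A bit among the
  -- last `r` passes SP unchanged and is moved into `B` by CSP.
  refine forall_data (P := fun v => x v = true → _) i (fun s hs => ?_) fun s hs => ?_
  · left
    have := (unitarySP_support ψ hF hw2).1 s
    rw [hs] at this
    exact ⟨_, (k1 _ (by simp [dataCSP])).trans this⟩
  · right
    have := (unitaryCSP_support ψ (fun ν => (k2 _ (by simp [dataSP])).trans (hF ν)) hw1).1 s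
    rw [k2 _ (dataCSP_notMem_sp s), hs] at this
    exact ⟨_, this⟩

end Prepare

/-! ### The subroutines as blocks -/

section Blocks

variable {V A : Type} [Fintype V] [DecidableEq V] [Fintype A] [DecidableEq A]

theorem Block.of_eq {C : Circuit (V ⊕ A)} {T T' : Matrix (V → Bool) (V → Bool) ℂ}
    {D K D' K' : ℕ} (h : Block C T D K) (hT : T' = T) (hD : D ≤ D') (hK : K ≤ K') :
    Block C T' D' K' := hT ▸ h.mono hD hK

theorem block_of_computesFrom {X : Type} [Fintype X] {ι : X → A} {D : ℕ} {S : Set (V ⊕ A)}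
    {F : (V ⊕ A → Bool) → (V ⊕ A → Bool)} {f : (V → Bool) → (V → Bool)}
    (h : ComputesFrom D S (Set.range (Sum.inr ∘ ι)) F) (hS : ∀ j, Sum.inr j ∈ S → j ∈ Set.range ι)
    (hF : ∀ x, F (Sum.elim x fun _ => false) = Sum.elim (f x) fun _ => false) :
    ∃ C : Circuit (V ⊕ A), Block C (basisOp f) D (Fintype.card X * D) := by
  classical
  obtain ⟨C, hv, hl, hw, ho⟩ := h
  refine ⟨C, Block.of_within hv (clean_of_maps fun x => ?_) hl hw ?_⟩
  · rw [ho _ _, hF]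
    rintro w ⟨j, rfl⟩
    rfl
  · rw [← Finset.card_univ]
    refine (Finset.card_le_card fun j hj => ?_).trans
      (Finset.card_image_le (s := Finset.univ) (f := ι))
    rw [Finset.mem_filter] at hj
    obtain ⟨i, rfl⟩ := hS j hj.2
    exact Finset.mem_image_of_mem _ (Finset.mem_univ _)

variable {k : ℕ} {d : Fin k → V} {a f : Node k → V}

theorem Layout.inl (h : Layout d a) :
    Layout (Sum.inl ∘ d : Fin k → V ⊕ A) (Sum.inl ∘ a : Node k → V ⊕ A) :=
  ⟨Sum.inl_injective.comp h.d_inj, Sum.inl_injective.comp h.a_inj, fun i ν e =>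
    h.disj i ν (Sum.inl_injective e)⟩

theorem block_spf (h : Layout d a) {ι : SpfAnc k → A} (hι : Function.Injective ι) :
    ∃ C : Circuit (V ⊕ A), Block C (basisOp (spfMap d a)) (300 * (k + 1))
      (Fintype.card (SpfAnc k) * (300 * (k + 1))) := by
  have hl : Layout (Sum.inl ∘ d : Fin k → V ⊕ A) (Sum.inl ∘ a : Node k → V ⊕ A) := h.inl
  refine block_of_computesFrom (computesFrom_spfMap hl
    (Sum.inr_injective.comp hι : Function.Injective (Sum.inr ∘ ι : SpfAnc k → V ⊕ A))
    (by simp) (by simp)) (fun j hj => ?_) fun x => ?_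
  · rcases hj with (⟨i, e⟩ | ⟨i, e⟩) | ⟨i, e⟩
    · simp at e
    · simp at e
    · exact ⟨i, Sum.inr_injective e⟩
  · have hr := routed_spfMap h x
    refine spfMap_of_routed hl ⟨hr.data, hr.tree, ?_⟩
    rintro (w | w) h1 h2
    · exact hr.off w (fun ⟨i, e⟩ => h1 ⟨i, congrArg Sum.inl e⟩)
        fun ⟨i, e⟩ => h2 ⟨i, congrArg Sum.inl e⟩
    · rfl

theorem block_flag (h : Layout d f) {ι : CopyIdx k → A} (hι : Function.Injective ι) :
    ∃ C : Circuit (V ⊕ A), Block C (basisOp (flagMap d f)) (300 * (k + 1))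
      (Fintype.card (CopyIdx k) * (300 * (k + 1))) := by
  have hl : Layout (Sum.inl ∘ d : Fin k → V ⊕ A) (Sum.inl ∘ f : Node k → V ⊕ A) := h.inl
  refine block_of_computesFrom (computesFrom_flagMap hl
    (Sum.inr_injective.comp hι : Function.Injective (Sum.inr ∘ ι : CopyIdx k → V ⊕ A))
    (by simp) (by simp)) (fun j hj => ?_) fun x => ?_
  · rcases hj with (⟨i, e⟩ | ⟨i, e⟩) | ⟨i, e⟩
    · simp at e
    · simp at e
    · exact ⟨i, Sum.inr_injective e⟩
  · ext w
    by_cases hw : w ∈ Set.range (Sum.inl ∘ f : Node k → V ⊕ A)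
    · obtain ⟨⟨s, j⟩, rfl⟩ := hw
      rw [flagMap_apply hl]
      exact (flagMap_apply h x s j).symm
    · rw [flagMap_of_notMem hl _ hw]
      rcases w with w | w
      · exact (flagMap_of_notMem h x fun ⟨i, e⟩ => hw ⟨i, congrArg Sum.inl e⟩).symm
      · rfl

theorem block_xAll (hf : Function.Injective f) :
    ∃ C : Circuit (V ⊕ A), Block C (xAll f) 1 0 := by
  obtain ⟨C, hC⟩ := block_singleLayer (A := A) hf fun _ => pauliX
  have e : xAll f = parallelOp f fun _ _ => (pauliX : Matrix Bool Bool ℂ) := by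
    rw [xAll]
    congr 1
  exact ⟨C, e ▸ hC⟩

end Blocks

/-- The rotation `R_y(θ)` as a unitary. -/
def ryU (θ : ℝ) : Matrix.unitaryGroup Bool ℂ :=
  ⟨Ry θ, Matrix.mem_unitaryGroup_iff'.2 (Ry_conjTranspose_mul θ)⟩

/-! ### Sizes -/

theorem sum_fin_two_pow_lt (k : ℕ) : ∑ s : Fin k, 2 ^ (s : ℕ) < 2 ^ k := by
  have := card_node_lt k
  rw [Fintype.card_sigma] at this
  simpa using this

theorem card_copyIdx_le (k : ℕ) : Fintype.card (CopyIdx k) ≤ 2 ^ k := by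
  rw [Fintype.card_sigma]
  calc _ ≤ ∑ s : Fin k, 2 ^ (s : ℕ) := Finset.sum_le_sum fun s _ => (card_node_lt s).le
    _ ≤ _ := (sum_fin_two_pow_lt k).le

theorem card_parIdx_le (k : ℕ) : Fintype.card (ParIdx k) ≤ 2 * 2 ^ k := by
  rw [Fintype.card_sigma]
  calc _ ≤ ∑ s : Fin k, 2 * 2 ^ (s : ℕ) := by
        refine Finset.sum_le_sum fun s _ => ?_
        rw [← pow_succ']
        exact (card_node_lt _).le
    _ ≤ _ := by
        rw [← Finset.mul_sum]
        exact Nat.mul_le_mul_left _ (sum_fin_two_pow_lt k).le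

theorem card_spfAnc_le (k : ℕ) : Fintype.card (SpfAnc k) ≤ 5 * 2 ^ k := by
  let e : SpfAnc k → Node k ⊕ ParIdx k ⊕ Fin k ⊕ CopyIdx k
    | .onehot ν => .inl ν
    | .par c => .inr (.inl c)
    | .reg s => .inr (.inr (.inl s))
    | .copy c => .inr (.inr (.inr c))
  have he : Function.Injective e := by
    rintro (a | a | a | a) (b | b | b | b) h <;> cases h <;> rfl
  refine (Fintype.card_le_of_injective e he).trans ?_
  simp only [Fintype.card_sum, Fintype.card_fin]
  have h1 := card_node_lt k
  have h2 := card_parIdx_le k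
  have h3 := card_copyIdx_le k
  have h4 := Nat.lt_two_pow_self (n := k)
  omega

theorem card_muxAnc_le (μ L : ℕ) :
    Fintype.card (MuxAnc μ L) ≤ 3 * 2 ^ μ + L + 3 * (2 ^ μ * L) := by
  rw [← Finset.card_univ, Finset.card_eq_sum_ones, MuxAnc.sum_eq]
  simp only [Finset.sum_const, Finset.card_univ, smul_eq_mul, mul_one, Fintype.card_fin]
  have h1 := card_node_lt μ
  have h2 := card_node_lt (μ + 1)
  rw [pow_succ] at h2
  omega

theorem card_wire_le (m r : ℕ) : Fintype.card (Wire m r) ≤ 5 * max (2 ^ r) (2 ^ m) := by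
  let e : Wire m r → Fin (m + r) ⊕ Node m ⊕ Node r ⊕ Node (max m r)
    | .data i => .inl i
    | .regA ν => .inr (.inl ν)
    | .regB ν => .inr (.inr (.inl ν))
    | .regF ν => .inr (.inr (.inr ν))
  have he : Function.Injective e := by
    rintro (a | a | a | a) (b | b | b | b) h <;> cases h <;> rfl
  refine (Fintype.card_le_of_injective e he).trans ?_
  simp only [Fintype.card_sum, Fintype.card_fin]
  have h1 := card_node_lt m
  have h2 := card_node_lt r
  have h3 := card_node_lt (max m r)
  have h4 := Nat.lt_two_pow_self (n := m)
  have h5 := Nat.lt_two_pow_self (n := r)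
  have h6 := le_max_left (2 ^ r) (2 ^ m)
  have h7 := le_max_right (2 ^ r) (2 ^ m)
  have h8 : 2 ^ max m r ≤ max (2 ^ r) (2 ^ m) := by
    rcases le_total m r with h | h
    · rw [max_eq_right h]
      exact le_max_left _ _
    · rw [max_eq_left h]
      exact le_max_right _ _
  omega

/-! ### The circuit for the protocol -/

section ProtocolCircuit

variable {m r : ℕ} (ψ : (Fin (m + r) → Bool) → ℂ) {A : Type} [Fintype A] [DecidableEq A]

/-- SPF, FLAG and its inverse take `300 * (m + 1)` layers each, the controlled rotations `38 * (m +
5) + 3`. The loading rotations and the two X layers add three more. -/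
def depthSP (m : ℕ) : ℕ := 900 * (m + 1) + 38 * (m + 5) + 6

/-- The factor `7 = 5 + 1 + 1` bounds the ancillae, in units of `2 ^ m`, of SPF and of the two uses
of FLAG. -/
def costSP (m : ℕ) : ℕ := 7 * 2 ^ m * (300 * (m + 1)) + muxCost 0 (m + 1)

/-- The subroutines run one after another and return their ancillae clean, so all of them embed into
the same pool `A`. -/
theorem exists_unitarySP (hA : 11 * (2 ^ m * 2 ^ r) ≤ Fintype.card A) :
    ∃ C : Circuit (Wire m r ⊕ A), Block C (unitarySP ψ) (depthSP m) (costSP m) := by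
  have hr1 : 1 ≤ 2 ^ r := Nat.one_le_two_pow
  have hm1 : 1 ≤ 2 ^ m := Nat.one_le_two_pow
  have hmr : 2 ^ m ≤ 2 ^ m * 2 ^ r := Nat.le_mul_of_pos_right _ hr1
  have hn := card_node_lt m
  obtain ⟨⟨ι1, hι1⟩⟩ := Function.Embedding.nonempty_of_card_le (α := SpfAnc m) (β := A)
    ((card_spfAnc_le m).trans (by omega))
  obtain ⟨⟨ι2, hι2⟩⟩ := Function.Embedding.nonempty_of_card_le (α := CopyIdx m) (β := A)
    ((card_copyIdx_le m).trans (by omega))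
  obtain ⟨⟨ι3, hι3⟩⟩ := Function.Embedding.nonempty_of_card_le
    (α := MuxAnc 0 (2 * Fintype.card (Node m))) (β := A)
    ((card_muxAnc_le _ _).trans (by simp only [pow_zero]; omega))
  obtain ⟨C1, h1⟩ := block_singleLayer (A := A) (regA_injective (m := m) (r := r))
    fun ν => ryU (angleSP ψ ν)
  obtain ⟨C2, h2⟩ := block_spf (layout_regA (m := m) (r := r)) hι1
  obtain ⟨C3, h3⟩ := block_xAll (A := A) (flagSP_injective (m := m) (r := r))
  obtain ⟨C4, h4⟩ := block_flag (layout_flagSP (m := m) (r := r)) hι2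
  -- The SP angles do not depend on any address, so the multiplexer is used with zero address bits.
  obtain ⟨C5, h5⟩ := exists_muxRy (d := Fin.elim0) (f := flagSP m r)
    (a := (Wire.regA : Node m → Wire m r)) (R := m + 1) (ι := ι3) rfl
    (by rw [pow_succ]; omega) (fun i => i.elim0) flagSP_injective regA_injective
    (fun i => i.elim0) (fun i => i.elim0) (by simp [flagSP]) hι3 (fun _ ν => -angleSP ψ ν)
  have h := (((((h1.append h2).append h3).append h4).append h5).append h4.dagger).append h3
  refine ⟨_, h.of_eq ?_ ?_ ?_⟩
  · rw [unitarySP]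
    simp only [Matrix.mul_assoc]
    rfl
  · rw [depthSP]
    omega
  · have c1 := Nat.mul_le_mul_right (300 * (m + 1)) (card_spfAnc_le m)
    have c2 := Nat.mul_le_mul_right (300 * (m + 1)) (card_copyIdx_le m)
    rw [costSP]
    nlinarith

theorem rotCSP_eq (k : ℕ) (ν : Node r) : rotCSP ψ k ν =
    Matrix.diagonal (fun b : Bool => if (ν.1 : ℕ) + 1 = r then
      phase (amplitude ψ (k * 2 ^ r + (2 * (ν.2 : ℕ) + cond b 1 0))) else 1) *
        Ry (angleCSP ψ k ν) := by
  rw [rotCSP]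
  split_ifs
  · rfl
  · rw [Matrix.diagonal_one, Matrix.one_mul]

theorem exists_loadf (hA : 11 * (2 ^ m * 2 ^ r) ≤ Fintype.card A) :
    ∃ C : Circuit (Wire m r ⊕ A), Block C (loadf ψ) (76 * (4 * m + r + 5) + 4)
      (2 * muxCost m (r + 1)) := by
  have hr1 : 1 ≤ 2 ^ r := Nat.one_le_two_pow
  have hm1 : 1 ≤ 2 ^ m := Nat.one_le_two_pow
  have hmr : 2 ^ m ≤ 2 ^ m * 2 ^ r := Nat.le_mul_of_pos_right _ hr1
  have hrm : 2 ^ r ≤ 2 ^ m * 2 ^ r := Nat.le_mul_of_pos_left _ hm1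
  have hn := card_node_lt r
  have hL : 2 * Fintype.card (Node r) ≤ 2 ^ (r + 1) := by
    rw [pow_succ]
    omega
  -- This is where `11` comes from: at most `3 * 2 ^ m + 2 * 2 ^ r + 6 * (2 ^ m * 2 ^ r)` ancillae
  -- are needed.
  obtain ⟨⟨ι, hι⟩⟩ := Function.Embedding.nonempty_of_card_le
    (α := MuxAnc m (2 * Fintype.card (Node r))) (β := A) ((card_muxAnc_le _ _).trans (by
      have := Nat.mul_le_mul_left (2 ^ m) hL
      rw [pow_succ] at this
      nlinarith))
  have hdf : ∀ i ν, dataSP m r i ≠ flagCSP m r ν := by simp [dataSP, flagCSP]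
  have hda : ∀ i ν, dataSP m r i ≠ .regB ν := by simp [dataSP]
  have hfa : ∀ ν ν', flagCSP m r ν ≠ .regB ν' := by simp [flagCSP]
  obtain ⟨C1, h1⟩ := exists_muxRy rfl hL dataSP_injective flagCSP_injective regB_injective hdf hda
    hfa hι fun k ν => angleCSP ψ k ν
  obtain ⟨C2, h2⟩ := exists_mux rfl hL dataSP_injective flagCSP_injective regB_injective hdf hda
    hfa hι (fun k ν b => if (ν.1 : ℕ) + 1 = r then
      phase (amplitude ψ (k * 2 ^ r + (2 * (ν.2 : ℕ) + cond b 1 0))) else 1)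
    (fun k ν b => by split_ifs <;> simp [norm_phase])
  refine ⟨_, (h1.append h2).of_eq ?_ ?_ ?_⟩
  · rw [parallelOp_mul regB_injective _ _ (indep_mux hda hfa fun p k ν => if p then
      Matrix.diagonal (fun b : Bool => if (ν.1 : ℕ) + 1 = r then
        phase (amplitude ψ (k * 2 ^ r + (2 * (ν.2 : ℕ) + cond b 1 0))) else 1) else 1), loadf]
    refine parallelOp_congr fun x ν => ?_
    rw [address_eq_path]
    by_cases hx : x (flagCSP m r ν)
    · rw [if_pos hx, if_pos hx, if_pos hx, rotCSP_eq]
    · rw [if_neg hx, if_neg hx, if_neg hx, Matrix.one_mul]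
  · omega
  · omega

def depthCSP (m r : ℕ) : ℕ := 900 * (r + 1) + 152 * (4 * m + r + 5) + 10

def costCSP (m r : ℕ) : ℕ := 7 * 2 ^ r * (300 * (r + 1)) + 4 * muxCost m (r + 1)

theorem exists_unitaryCSP (hA : 11 * (2 ^ m * 2 ^ r) ≤ Fintype.card A) :
    ∃ C : Circuit (Wire m r ⊕ A), Block C (unitaryCSP ψ) (depthCSP m r) (costCSP m r) := by
  have hm1 : 1 ≤ 2 ^ m := Nat.one_le_two_pow
  have hrm : 2 ^ r ≤ 2 ^ m * 2 ^ r := Nat.le_mul_of_pos_left _ hm1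
  obtain ⟨⟨ι1, hι1⟩⟩ := Function.Embedding.nonempty_of_card_le (α := SpfAnc r) (β := A)
    ((card_spfAnc_le r).trans (by omega))
  obtain ⟨⟨ι2, hι2⟩⟩ := Function.Embedding.nonempty_of_card_le (α := CopyIdx r) (β := A)
    ((card_copyIdx_le r).trans (by omega))
  obtain ⟨C1, h1⟩ := block_xAll (A := A) (flagCSP_injective (m := m) (r := r))
  obtain ⟨C2, h2⟩ := exists_loadf ψ hA
  obtain ⟨C3, h3⟩ := block_spf (layout_regB (m := m) (r := r)) hι1
  obtain ⟨C4, h4⟩ := block_flag (layout_flagCSP (m := m) (r := r)) hι2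
  have h := (((((h1.append h2).append h3).append h4).append h2.dagger).append h4.dagger).append h1
  refine ⟨_, h.of_eq ?_ ?_ ?_⟩
  · rw [unitaryCSP]
    simp only [Matrix.mul_assoc]
  · rw [depthCSP]
    omega
  · have c1 := Nat.mul_le_mul_right (300 * (r + 1)) (card_spfAnc_le r)
    have c2 := Nat.mul_le_mul_right (300 * (r + 1)) (card_copyIdx_le r)
    rw [costCSP]
    nlinarith

theorem exists_prepUnitary (hA : 11 * (2 ^ m * 2 ^ r) ≤ Fintype.card A) :
    ∃ C : Circuit (Wire m r ⊕ A), Block C (prepUnitary ψ) (depthSP m + depthCSP m r)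
      (costSP m + costCSP m r) := by
  obtain ⟨C1, h1⟩ := exists_unitarySP ψ hA
  obtain ⟨C2, h2⟩ := exists_unitaryCSP ψ hA
  exact ⟨_, h1.append h2⟩

theorem exists_coreReflection (hr : 1 ≤ r) (hA : 11 * (2 ^ m * 2 ^ r) ≤ Fintype.card A) :
    ∃ C : Circuit (Wire m r ⊕ A), Block C (zeroReflection (coreDAB m r))
      (38 * (m + r + 4) + 1) (10 * max (2 ^ r) (2 ^ m) * (38 * (m + r + 4) + 1)) := by
  classical
  have hr1 : 1 ≤ 2 ^ r := Nat.one_le_two_pow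
  have hm1 : 1 ≤ 2 ^ m := Nat.one_le_two_pow
  have hX : max (2 ^ r) (2 ^ m) ≤ 2 ^ m * 2 ^ r :=
    max_le (Nat.le_mul_of_pos_left _ hm1) (Nat.le_mul_of_pos_right _ hr1)
  set L := Fintype.card (coreDAB m r) with hL
  have hLV : L ≤ 5 * max (2 ^ r) (2 ^ m) :=
    (Fintype.card_subtype_le _).trans (card_wire_le m r)
  have hL0 : 0 < L := Fintype.card_pos_iff.2 ⟨⟨.data ⟨0, by omega⟩, Or.inl (Or.inl ⟨_, rfl⟩)⟩⟩
  let e := (Fintype.equivFin (coreDAB m r)).symm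
  obtain ⟨⟨ι, hι⟩⟩ := Function.Embedding.nonempty_of_card_le
    (α := Fin (2 * L - 1)) (β := A) (by
      rw [Fintype.card_fin]
      omega)
  -- The depth parameter must satisfy `2 * L ≤ 2 ^ D`; here `2 * L` is at most ten times `2 ^ (m +
  -- r)`, so four extra levels suffice.
  obtain ⟨C, hC⟩ := exists_zeroReflection (c := fun i => (e i : Wire m r)) (D := m + r + 4) hL0
    (by
      rw [pow_add, pow_add]
      omega) (Subtype.val_injective.comp e.injective) hι
  have hrange : Set.range (fun i => (e i : Wire m r)) = coreDAB m r := by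
    ext w
    constructor
    · rintro ⟨i, rfl⟩
      exact (e i).2
    · intro hw
      exact ⟨e.symm ⟨w, hw⟩, by simp⟩
  rw [hrange] at hC
  exact ⟨C, hC.mono le_rfl (Nat.mul_le_mul_right _ (by omega))⟩

end ProtocolCircuit

/-! ### Reflections -/

section Reflection

theorem zeroReflection_mulVec_ket {W : Type} [Fintype W] [DecidableEq W] {K : Set W} (x : W → Bool)
    (c : ℂ) (hc : (∀ w ∈ K, x w = false) → c = -1) (hc' : (¬ ∀ w ∈ K, x w = false) → c = 1) :
    zeroReflection K *ᵥ ket x = c • ket x := by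
  classical
  ext y
  rw [zeroReflection, Matrix.sub_mulVec, Matrix.one_mulVec, Matrix.smul_mulVec]
  simp only [Pi.sub_apply, Pi.smul_apply, Matrix.mulVec_diagonal, smul_eq_mul, ket_apply]
  by_cases hxy : y = x
  · subst hxy
    by_cases h : ∀ w ∈ K, y w = false
    · rw [if_pos rfl, if_pos h, hc h]
      norm_num
    · rw [if_pos rfl, if_neg h, hc' h]
      norm_num
  · simp [hxy]

theorem zeroReflection_image_inl {V A : Type} [Fintype V] [DecidableEq V] [Fintype A]
    [DecidableEq A] (K : Set V) :
    zeroReflection (Sum.inl '' K : Set (V ⊕ A)) * injectOp (Sum.inl : V → V ⊕ A) =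
      injectOp (Sum.inl : V → V ⊕ A) * zeroReflection K := by
  classical
  refine matrix_ext_ket fun x => ?_
  have h : (∀ w ∈ (Sum.inl '' K : Set (V ⊕ A)), (Sum.elim x fun _ => false : V ⊕ A → Bool) w =
      false) ↔ ∀ w ∈ K, x w = false := by simp
  rw [← Matrix.mulVec_mulVec, ← Matrix.mulVec_mulVec, injectOp_mulVec_ket, embed_inl,
    zeroReflection_mulVec_ket x (if ∀ w ∈ K, x w = false then -1 else 1) (fun h => if_pos h)
      fun h => if_neg h, Matrix.mulVec_smul, injectOp_mulVec_ket, embed_inl]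
  exact zeroReflection_mulVec_ket _ _ (fun h' => if_pos (h.1 h')) fun h' => if_neg fun h'' =>
    h' (h.2 h'')

variable {m r : ℕ} {ψ : (Fin (m + r) → Bool) → ℂ}

/-- An isometry does not annihilate the input, so some output component is nonzero. It stems from a
basis input with a nonzero data bit, and every such component is dirty by `prepUnitary_dirty`. -/
theorem prepUnitary_dirty_of_ne_zero (hU : (prepUnitary ψ)ᴴ * prepUnitary ψ = 1)
    {χ : (Fin (m + r) → Bool) → ℂ} (hχ : χ ≠ 0) (h0 : χ (fun _ => false) = 0) :
    ∃ y : Wire m r → Bool, ((∃ ν, y (Wire.regA ν) = true) ∨ ∃ ν, y (Wire.regB ν) = true) ∧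
      (prepUnitary ψ *ᵥ inject Wire.data χ) y ≠ 0 := by
  have hne : prepUnitary ψ *ᵥ inject Wire.data χ ≠ 0 := by
    intro h
    have h1 : inject (Wire.data : Fin (m + r) → Wire m r) χ = 0 := by
      rw [← Matrix.one_mulVec (inject Wire.data χ), ← hU, ← Matrix.mulVec_mulVec, h,
        Matrix.mulVec_zero]
    have hE := injectOp_isometry (data_injective (m := m) (r := r))
    refine hχ ?_
    rw [← Matrix.one_mulVec χ, ← hE, ← Matrix.mulVec_mulVec, injectOp_mulVec data_injective, h1,
      Matrix.mulVec_zero]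
  obtain ⟨y, hy⟩ := Function.ne_iff.1 hne
  refine ⟨y, ?_, hy⟩
  obtain ⟨x, -, hx⟩ := Finset.exists_ne_zero_of_sum_ne_zero (show ∑ x, prepUnitary ψ y x *
    inject Wire.data χ x ≠ 0 from hy)
  have hx2 := right_ne_zero_of_mul hx
  rw [inject] at hx2
  split_ifs at hx2 with hoff
  · refine prepUnitary_dirty ψ (fun ν => hoff _ (by simp)) ?_ (left_ne_zero_of_mul hx)
    by_contra hall
    push Not at hall
    refine hx2 ?_
    have e : (fun i => x (.data i)) = fun _ => false := funext fun i => by simpa using hall i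
    rw [e, h0]
  · exact absurd rfl hx2

/-- The reflection involves data, `A` and `B` only, but after the inverse of `U` the flags are still
zero. There it reflects about the single basis vector `x0`, which `U` maps to `ψ` with clean
ancillae. -/
theorem prepUnitary_reflection (hU : (prepUnitary ψ)ᴴ * prepUnitary ψ = 1)
    (h0 : prepUnitary ψ *ᵥ inject Wire.data (ket fun _ => false) = inject Wire.data ψ)
    (φ : (Fin (m + r) → Bool) → ℂ) :
    (prepUnitary ψ * zeroReflection (coreDAB m r) * (prepUnitary ψ)ᴴ) *ᵥ inject Wire.data φ =
      inject Wire.data (stateReflection ψ *ᵥ φ) := by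
  classical
  have hU' : prepUnitary ψ * (prepUnitary ψ)ᴴ = 1 := mul_eq_one_comm.1 hU
  set U := prepUnitary ψ with hUdef
  set x0 : Wire m r → Bool := fun _ => false with hx0
  have hx : embed (Wire.data : Fin (m + r) → Wire m r) (fun _ => false) = x0 :=
    ((eq_embed_iff data_injective _ _).2 ⟨fun _ _ => rfl, rfl⟩).symm
  rw [inject_ket data_injective, hx] at h0
  set v := inject (Wire.data : Fin (m + r) → Wire m r) φ with hv
  set w := Uᴴ *ᵥ v with hw
  -- The adjoint of an operator that keeps the flags keeps them too.
  have hwF : ∀ x, w x ≠ 0 → ∀ ν, x (.regF ν) = false := by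
    intro x hx ν
    obtain ⟨y, -, hy⟩ := Finset.exists_ne_zero_of_sum_ne_zero (show ∑ y, Uᴴ x y * v y ≠ 0 from hx)
    have h1 := left_ne_zero_of_mul hy
    have h2 := right_ne_zero_of_mul hy
    rw [Matrix.conjTranspose_apply, star_ne_zero] at h1
    rw [← prepUnitary_keeps_regF ψ y x h1 _ ⟨ν, rfl⟩]
    rw [hv, inject] at h2
    split_ifs at h2 with hoff
    · exact hoff _ (by simp)
    · exact absurd rfl h2
  have hZ : zeroReflection (coreDAB m r) *ᵥ w = w - (2 * w x0) • ket x0 := by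
    ext x
    rw [zeroReflection, Matrix.sub_mulVec, Matrix.one_mulVec, Matrix.smul_mulVec]
    simp only [Pi.sub_apply, Pi.smul_apply, Matrix.mulVec_diagonal, smul_eq_mul, ket_apply]
    congr 1
    by_cases hxx : x = x0
    · rw [if_pos hxx, if_pos, hxx]
      · ring
      · intro u _
        rw [hxx]
    · rw [if_neg hxx, mul_zero]
      by_cases hwx : w x = 0
      · rw [hwx, mul_zero, mul_zero]
      · rw [if_neg, zero_mul, mul_zero]
        intro hK
        refine hxx (funext fun u => ?_)
        cases u with
        | data i => exact hK _ (Or.inl (Or.inl ⟨i, rfl⟩))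
        | regA ν => exact hK _ (Or.inl (Or.inr ⟨ν, rfl⟩))
        | regB ν => exact hK _ (Or.inr ⟨ν, rfl⟩)
        | regF ν => exact hwF x hwx ν
  -- The column of `U` at `x0` is the prepared state, so this component is an inner product with
  -- `ψ`.
  have hw0 : w x0 = star ψ ⬝ᵥ φ := by
    have hcol : ∀ y, U y x0 = inject Wire.data ψ y := fun y => by
      rw [← h0, mulVec_ket]
    have hE := injectOp_isometry (data_injective (m := m) (r := r))
    calc w x0 = ∑ y, star (U y x0) * v y := rfl
      _ = star (injectOp Wire.data *ᵥ ψ) ⬝ᵥ (injectOp Wire.data *ᵥ φ) := by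
          rw [injectOp_mulVec data_injective, injectOp_mulVec data_injective]
          simp only [hcol]
          rfl
      _ = star ψ ⬝ᵥ φ := by
          rw [Matrix.star_mulVec, Matrix.dotProduct_mulVec, Matrix.vecMul_vecMul, hE,
            Matrix.vecMul_one]
  rw [← Matrix.mulVec_mulVec, ← Matrix.mulVec_mulVec, ← hw, hZ, Matrix.mulVec_sub,
    Matrix.mulVec_smul, h0, hw0, hw, Matrix.mulVec_mulVec, hU', Matrix.one_mulVec, hv,
    ← injectOp_mulVec data_injective, ← injectOp_mulVec data_injective,
    ← injectOp_mulVec data_injective, ← Matrix.mulVec_smul, ← Matrix.mulVec_sub]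
  congr 1
  rw [stateReflection, Matrix.sub_mulVec, Matrix.one_mulVec, Matrix.smul_mulVec,
    Matrix.vecMulVec_mulVec]
  ext z
  simp only [Pi.sub_apply, Pi.smul_apply, smul_eq_mul, MulOpposite.smul_eq_mul_unop,
    MulOpposite.unop_op]
  ring

end Reflection

/-! ### The other ancillae -/

section Ancillae

variable {m r g : ℕ} {ψ : (Fin (m + r) → Bool) → ℂ}

theorem Clean.apply_elim {V A : Type} [Fintype V] [DecidableEq V] [Fintype A] [DecidableEq A]
    {C : Circuit (V ⊕ A)} {T : Matrix (V → Bool) (V → Bool) ℂ} (h : Clean C T) (x : V → Bool)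
    {y : V ⊕ A → Bool} (hy : C.op y (Sum.elim x fun _ => false) ≠ 0) :
    (∀ j, y (.inr j) = false) ∧ T (fun i => y (.inl i)) x ≠ 0 := by
  classical
  have e := congrFun (h.mulVec_inject (ket x)) y
  rw [inject_ket Sum.inl_injective, embed_inl, mulVec_ket, mulVec_ket, inject] at e
  beta_reduce at e
  rw [e] at hy
  split_ifs at hy with hoff
  · exact ⟨fun j => hoff _ (by simp), hy⟩
  · exact absurd rfl hy

theorem otherAncillae_of_clean {C : Circuit (FullWire m r g)}
    {T : Matrix (Wire m r → Bool) (Wire m r → Bool) ℂ} (h : Clean C T)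
    (hT : Keeps (Set.range Wire.regF) T) {x y : FullWire m r g → Bool} (hxy : C.op y x ≠ 0)
    (hx : ∀ w ∈ otherAncillae m r g, x w = false) : ∀ w ∈ otherAncillae m r g, y w = false := by
  have e : x = Sum.elim (fun i => x (.inl i)) fun _ => false := by
    ext w
    rcases w with w | w
    · rfl
    · exact hx _ (Or.inr ⟨w, rfl⟩)
  rw [e] at hxy
  obtain ⟨h1, h2⟩ := h.apply_elim _ hxy
  rintro w (⟨ν, rfl⟩ | ⟨j, rfl⟩)
  · exact (hT _ _ h2 _ ⟨ν, rfl⟩).trans (hx _ (Or.inl ⟨ν, rfl⟩))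
  · exact h1 j

/-- The converse is the same implication for the inverse circuit, which is clean for the adjoint
operator. -/
theorem otherAncillae_iff {C : Circuit (FullWire m r g)}
    {T : Matrix (Wire m r → Bool) (Wire m r → Bool) ℂ} (h : Clean C T)
    (hT : Keeps (Set.range Wire.regF) T) {x y : FullWire m r g → Bool} (hxy : C.op y x ≠ 0) :
    (∀ w ∈ otherAncillae m r g, x w = false) ↔ ∀ w ∈ otherAncillae m r g, y w = false := by
  refine ⟨otherAncillae_of_clean h hT hxy, otherAncillae_of_clean h.dagger ?_ ?_⟩
  · intro u v huv w hw
    rw [Matrix.conjTranspose_apply, star_ne_zero] at huv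
    exact (hT _ _ huv w hw).symm
  · rw [Circuit.op_dagger, Matrix.conjTranspose_apply, star_ne_zero]
    exact hxy

end Ancillae

/-! ### Bounds -/

section Bounds

variable {m r : ℕ}

theorem depth_bound (h : 1 ≤ m + r) :
    depthSP m + depthCSP m r + (38 * (m + r + 4) + 1) + (depthSP m + depthCSP m r) ≤
      10700 * (m + r) := by
  rw [depthSP, depthCSP]
  omega

theorem costSP_le (h : 1 ≤ m + r) :
    costSP m ≤ 6000 * ((m + r) * max (2 ^ r) (2 ^ m)) := by
  have hP : 2 ^ m ≤ max (2 ^ r) (2 ^ m) := le_max_right _ _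
  have hP1 : 1 ≤ 2 ^ m := Nat.one_le_two_pow
  set X := max (2 ^ r) (2 ^ m)
  have e1 : 7 * 2 ^ m * (300 * (m + 1)) ≤ 7 * X * (300 * (2 * (m + r))) := by
    gcongr
    omega
  have e2 : (3 * 2 ^ 0 + 2 ^ (m + 1)) * (38 * (4 * 0 + (m + 1) + 4) + 1) ≤
      (5 * X) * (229 * (m + r)) := by
    refine Nat.mul_le_mul ?_ (by omega)
    rw [pow_succ, pow_zero]
    omega
  have e3 : 2 ^ 0 * 2 ^ (m + 1) ≤ (m + r) * (2 * X) := by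
    refine Nat.mul_le_mul (by omega) ?_
    rw [pow_succ]
    omega
  rw [costSP, muxCost]
  linarith [Nat.zero_le ((m + r) * X)]

/-- The only contribution not bounded by depth times `max (2 ^ r) (2 ^ m)` comes from the
conjunctions and their fan-outs in LOADF. Four multiplexers with `269 * 2 ^ m * 2 ^ (r + 1)` each
give `2152 = 4 * 269 * 2`. -/
theorem costCSP_le (h : 1 ≤ m + r) :
    costCSP m r ≤ 12000 * ((m + r) * max (2 ^ r) (2 ^ m)) + 2152 * 2 ^ (m + r) := by
  have hP : 2 ^ m ≤ max (2 ^ r) (2 ^ m) := le_max_right _ _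
  have hQ : 2 ^ r ≤ max (2 ^ r) (2 ^ m) := le_max_left _ _
  set X := max (2 ^ r) (2 ^ m)
  have e1 : 7 * 2 ^ r * (300 * (r + 1)) ≤ 7 * X * (300 * (2 * (m + r))) := by
    gcongr
    omega
  have e2 : (3 * 2 ^ m + 2 ^ (r + 1)) * (38 * (4 * m + (r + 1) + 4) + 1) ≤
      (5 * X) * (343 * (m + r)) := by
    refine Nat.mul_le_mul ?_ (by omega)
    rw [pow_succ]
    omega
  have e3 : 2 ^ m * 2 ^ (r + 1) = 2 * 2 ^ (m + r) := by
    rw [pow_succ, pow_add]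
    ring
  rw [costCSP, muxCost, e3]
  linarith [Nat.zero_le ((m + r) * X)]

end Bounds

end StatePrep

end

/-! ### The main theorem -/

theorem mainTheorem8 :
    -- splittings `n = m + r` with `max (N / M) M = O(N / n)` exist for all `n`
    (∃ c : ℕ, ∀ n : ℕ, 1 ≤ n → ∃ m r : ℕ,
      m + r = n ∧ 1 ≤ r ∧ n * max (2 ^ r) (2 ^ m) ≤ c * 2 ^ n) ∧
    -- for every such choice of splittings
    ∀ c : ℕ, ∃ K : ℕ, ∀ m r : ℕ, 1 ≤ r →
      (m + r) * max (2 ^ r) (2 ^ m) ≤ c * 2 ^ (m + r) →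
      ∀ ψ : (Fin (m + r) → Bool) → ℂ, ∑ z, ‖ψ z‖ ^ 2 = 1 →
        -- the protocol prepares `ψ` and returns all ancillae to `|0⟩`
        prepUnitary ψ *ᵥ inject Wire.data (ket fun _ => false) = inject Wire.data ψ ∧
        -- on inputs orthogonal to `|0^n⟩` it leaves the registers `A` and `B` dirty
        (∀ χ : (Fin (m + r) → Bool) → ℂ, χ ≠ 0 → χ (fun _ => false) = 0 →
          ∃ y : Wire m r → Bool,
            ((∃ ν, y (Wire.regA ν) = true) ∨ ∃ ν, y (Wire.regB ν) = true) ∧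
              (prepUnitary ψ *ᵥ inject Wire.data χ) y ≠ 0) ∧
        ∃ (g : ℕ) (CU CR : Circuit (FullWire m r g)),
          CU.Valid ∧ CR.Valid ∧
          Implements CU (prepUnitary ψ) ∧
          Implements CR (zeroReflection (coreDAB m r)) ∧
          -- the other ancillae begin in `|0⟩` if and only if they end in `|0⟩`
          (∀ x y : FullWire m r g → Bool, CU.op y x ≠ 0 →
            ((∀ w ∈ otherAncillae m r g, x w = false) ↔
              ∀ w ∈ otherAncillae m r g, y w = false)) ∧
          -- conjugating the reflection about `|0⟩` on data, `A` and `B` gives `I - 2 |ψ⟩⟨ψ|`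
          (∀ φ : (Fin (m + r) → Bool) → ℂ,
            (CU.op * zeroReflection (Sum.inl '' coreDAB m r) * CU.opᴴ) *ᵥ
                inject (dataWire m r g) φ =
              inject (dataWire m r g) (stateReflection ψ *ᵥ φ)) ∧
          -- the resulting circuit implements `I - 2 |ψ⟩⟨ψ|` with the stated cost
          (∀ φ : (Fin (m + r) → Bool) → ℂ,
            Circuit.op (CU.dagger ++ CR ++ CU) *ᵥ inject (dataWire m r g) φ =
              inject (dataWire m r g) (stateReflection ψ *ᵥ φ)) ∧
          Circuit.depth (CU.dagger ++ CR ++ CU) ≤ K * (m + r) ∧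
          Circuit.spacetimeAllocation (dataWire m r g) (CU.dagger ++ CR ++ CU) ≤
            K * 2 ^ (m + r) ∧
          Fintype.card (FullWire m r g) ≤ K * 2 ^ (m + r) := by
  classical
  -- The balanced splitting `m = n / 2` works with `c = 2`: the maximum is `2 ^ (n - m)`, and `n ≤ 2
  -- * 2 ^ m`.
  refine ⟨⟨2, fun n hn => ⟨n / 2, n - n / 2, by omega, by omega, ?_⟩⟩,
    fun c => ⟨100000 * (c + 1), fun m r hr hc ψ hψ => ?_⟩⟩
  · have h1 : 2 ^ (n / 2) ≤ 2 ^ (n - n / 2) := Nat.pow_le_pow_right (by norm_num) (by omega)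
    have h2 : 2 ^ n = 2 ^ (n / 2) * 2 ^ (n - n / 2) := by
      rw [← pow_add]
      congr 1
      omega
    have h3 := Nat.lt_two_pow_self (n := n / 2)
    rw [max_eq_left h1, h2, ← mul_assoc]
    exact Nat.mul_le_mul_right _ (by omega)
  · have hN : 2 ^ (m + r) = 2 ^ m * 2 ^ r := pow_add _ _ _
    have hm1 : 1 ≤ 2 ^ m := Nat.one_le_two_pow
    have hr1 : 1 ≤ 2 ^ r := Nat.one_le_two_pow
    have hXN : max (2 ^ r) (2 ^ m) ≤ 2 ^ (m + r) := by
      rw [hN]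
      exact max_le (Nat.le_mul_of_pos_left _ hm1) (Nat.le_mul_of_pos_right _ hr1)
    have hn : 1 ≤ m + r := by omega
    let g := 11 * (2 ^ m * 2 ^ r)
    have hg : 11 * (2 ^ m * 2 ^ r) ≤ Fintype.card (Fin g) := by rw [Fintype.card_fin]
    obtain ⟨CU, hU⟩ := exists_prepUnitary ψ hg
    obtain ⟨CR, hR⟩ := exists_coreReflection hr hg
    have hUU := hU.clean.conjTranspose_mul
    have h0 := prepUnitary_mulVec_zero ψ hr hψ
    have hB := (hU.dagger.append hR).append hU
    have hinj : ∀ φ : (Fin (m + r) → Bool) → ℂ, inject (dataWire m r g) φ =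
        inject (Sum.inl : Wire m r → FullWire m r g) (inject Wire.data φ) := fun φ =>
      (inject_inject data_injective φ).symm
    have hrefl := prepUnitary_reflection hUU h0
    refine ⟨h0, fun χ hχ hχ0 => prepUnitary_dirty_of_ne_zero hUU hχ hχ0, g, CU, CR, hU.valid,
      hR.valid, hU.clean.mulVec_inject, hR.clean.mulVec_inject,
      fun x y hxy => otherAncillae_iff hU.clean (prepUnitary_keeps_regF ψ) hxy,
      fun φ => ?_, fun φ => ?_, ?_, ?_, ?_⟩
    -- On clean further ancillae the inverse circuit, the reflection and the circuit each act as
    -- their counterparts on the protocol wires. The identity therefore reduces to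
    -- `prepUnitary_reflection`.
    · rw [hinj, hinj, ← hrefl, ← Matrix.mulVec_mulVec, ← Matrix.mulVec_mulVec,
        ← Matrix.mulVec_mulVec, ← Matrix.mulVec_mulVec, ← Circuit.op_dagger,
        hU.clean.dagger.mulVec_inject, ← injectOp_mulVec Sum.inl_injective,
        Matrix.mulVec_mulVec _ (zeroReflection _), zeroReflection_image_inl,
        ← Matrix.mulVec_mulVec, injectOp_mulVec Sum.inl_injective, hU.clean.mulVec_inject]
    · rw [hinj, hinj, ← hrefl, hB.clean.mulVec_inject, Matrix.mul_assoc]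
    · refine hB.length_le.trans ((depth_bound hn).trans ?_)
      exact Nat.mul_le_mul_right _ (by omega)
    -- Protocol wires contribute 53500, the two runs of the preparation `2 * 18000` and the
    -- reflection 1910 multiples of `(m + r) * max (2 ^ r) (2 ^ m) ≤ c * 2 ^ (m + r)`. In addition
    -- there are `2 * 2152` multiples of `2 ^ (m + r)`; all of this fits below `100000 * (c + 1)`.
    · have e1 := spacetimeAllocation_le (data_injective (m := m) (r := r))
        (CU.dagger ++ CR ++ CU : Circuit (FullWire m r g))
      refine e1.trans ?_
      have e2 := Nat.mul_le_mul (hB.length_le.trans (depth_bound hn)) (card_wire_le m r)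
      have e3 := hB.cost_le
      have e4 := costSP_le (r := r) hn
      have e5 := costCSP_le hn
      have e6 : 10 * max (2 ^ r) (2 ^ m) * (38 * (m + r + 4) + 1) ≤
          10 * max (2 ^ r) (2 ^ m) * (191 * (m + r)) := Nat.mul_le_mul_left _ (by omega)
      have e7 : 10700 * (m + r) * (5 * max (2 ^ r) (2 ^ m)) =
          53500 * ((m + r) * max (2 ^ r) (2 ^ m)) := by ring
      have e8 : 10 * max (2 ^ r) (2 ^ m) * (191 * (m + r)) =
          1910 * ((m + r) * max (2 ^ r) (2 ^ m)) := by ring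
      rw [e7] at e2
      rw [e8] at e6
      have e9 : 100000 * (c + 1) * 2 ^ (m + r) =
          100000 * (c * 2 ^ (m + r)) + 100000 * 2 ^ (m + r) := by ring
      rw [e9]
      omega
    · rw [Fintype.card_sum, Fintype.card_fin]
      have e1 := card_wire_le m r
      have e9 : 100000 * (c + 1) * 2 ^ (m + r) =
          100000 * (c * 2 ^ (m + r)) + 100000 * 2 ^ (m + r) := by ring
      rw [e9]
      simp only [g]
      omega
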